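/- Let $X$ be a Kähler manifold (Hausdorff, second countable) of complex dimension $k\ge 1$ with Kähler form $\omega$; for instance, a compact Kähler manifold, or a bounded open set of $\mathbb{C}^k$ with $\omega=c\,dd^c\|z\|^2$, $c>0$. Let $L^2$ be the space of real square integrable functions (up to equality almost everywhere) for the measure $\omega^k$, and let $W^{1,2}$ be the space of $\varphi\in L^2$ whose differential in the sense of currents is a form with $L^2$ coefficients. For a positive closed current $T$ of bidegree $(1,1)$ on $X$ let $m(T)=\int_X T\wedge\omega^{k-1}\in[0,\infty]$ be its mass. Let $W^*$ be the set of $\varphi\in W^{1,2}$ for which there is a closed current $T$ of bidegree $(1,1)$ and of finite mass on $X$ such that $$ i\partial\varphi\wedge\bar\partial\varphi\le T \qquad (1)$$ in the sense of currents (such a $T$ is positive), and for $\varphi\in W^*$ put $$\|\varphi\|_*=\Big(\|\varphi\|_{L^2}^2+\inf\{m(T) : T \text{ a closed current of bidegree } (1,1) \text{ satisfying } (1)\}\Big)^{1/2}.$$ Then $W^*$ is a linear subspace of $L^2$, the function $\varphi\mapsto\|\varphi\|_*$ is a norm on $W^*$, and $W^*$ is complete with respect to this norm. -/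

import Mathlib

open scoped Manifold ContDiff ENNReal Topology ComplexOrder
open MeasureTheory Filter

noncomputable section

namespace KahlerSobolev

/-- The model space `ℂᵏ` of dimension `k = n + 1 ≥ 1`. -/
abbrev Model (n : ℕ) : Type := EuclideanSpace ℂ (Fin (n + 1))

/-- Real-multilinear alternating `p`-forms on `ℂᵏ` with complex values. -/
abbrev Alt (n p : ℕ) : Type := Model n [⋀^Fin p]→L[ℝ] ℂ

/-! ### Multilinear algebra -/

section Algebra

variable {n p q : ℕ}

/-- The tensor product `f ⊗ g` of two forms. -/
def tensor (f : Alt n p) (g : Alt n q) :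
    ContinuousMultilinearMap ℝ (fun _ : Fin (p + q) => Model n) ℂ where
  toFun v := f (fun i => v (Fin.castAdd q i)) * g (fun j => v (Fin.natAdd p j))
  map_update_add' := by
    intro inst v i x y
    obtain rfl : inst = instDecidableEqFin (p + q) := Subsingleton.elim _ _
    refine Fin.addCases (fun i => ?_) (fun j => ?_) i
    · have h1 : ∀ z, (fun k => Function.update v (Fin.castAdd q i) z (Fin.castAdd q k)) =
          Function.update (fun k => v (Fin.castAdd q k)) i z := by
        intro z; ext1 k; simp [Function.update_apply]
      have h2 : ∀ z, (fun k => Function.update v (Fin.castAdd q i) z (Fin.natAdd p k)) =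
          (fun k => v (Fin.natAdd p k)) := by
        intro z; ext1 k
        rw [Function.update_of_ne]
        intro h; have := congrArg Fin.val h; simp at this; omega
      simp only [h1, h2, f.map_update_add, add_mul]
    · have h1 : ∀ z, (fun k => Function.update v (Fin.natAdd p j) z (Fin.natAdd p k)) =
          Function.update (fun k => v (Fin.natAdd p k)) j z := by
        intro z; ext1 k; simp [Function.update_apply]
      have h2 : ∀ z, (fun k => Function.update v (Fin.natAdd p j) z (Fin.castAdd q k)) =
          (fun k => v (Fin.castAdd q k)) := by
        intro z; ext1 k
        rw [Function.update_of_ne]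
        intro h; have := congrArg Fin.val h; simp at this; omega
      simp only [h1, h2, g.map_update_add, mul_add]
  map_update_smul' := by
    intro inst v i c x
    obtain rfl : inst = instDecidableEqFin (p + q) := Subsingleton.elim _ _
    refine Fin.addCases (fun i => ?_) (fun j => ?_) i
    · have h1 : ∀ z, (fun k => Function.update v (Fin.castAdd q i) z (Fin.castAdd q k)) =
          Function.update (fun k => v (Fin.castAdd q k)) i z := by
        intro z; ext1 k; simp [Function.update_apply]
      have h2 : ∀ z, (fun k => Function.update v (Fin.castAdd q i) z (Fin.natAdd p k)) =
          (fun k => v (Fin.natAdd p k)) := by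
        intro z; ext1 k
        rw [Function.update_of_ne]
        intro h; have := congrArg Fin.val h; simp at this; omega
      simp only [h1, h2, f.map_update_smul, smul_mul_assoc]
    · have h1 : ∀ z, (fun k => Function.update v (Fin.natAdd p j) z (Fin.natAdd p k)) =
          Function.update (fun k => v (Fin.natAdd p k)) j z := by
        intro z; ext1 k; simp [Function.update_apply]
      have h2 : ∀ z, (fun k => Function.update v (Fin.natAdd p j) z (Fin.castAdd q k)) =
          (fun k => v (Fin.castAdd q k)) := by
        intro z; ext1 k
        rw [Function.update_of_ne]
        intro h; have := congrArg Fin.val h; simp at this; omega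
      simp only [h1, h2, g.map_update_smul, mul_smul_comm]
  cont := by
    refine Continuous.mul (f.cont.comp ?_) (g.cont.comp ?_) <;> fun_prop

/-- The exterior product
`(f ∧ g)(v) = (1 / (p! q!)) ∑ σ, sign σ · f (v_σ(1), …, v_σ(p)) · g (v_σ(p+1), …, v_σ(p+q))`. -/
def wedge (f : Alt n p) (g : Alt n q) : Alt n (p + q) :=
  ((p.factorial * q.factorial : ℝ)⁻¹) •
    ContinuousMultilinearMap.alternatization (tensor f g)

/-- A `p`-form regarded as a `q`-form, where `p = q`. -/
def castDeg (h : p = q) (f : Alt n p) : Alt n q := h ▸ f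

/-- The exterior power `f ∧ ⋯ ∧ f` (`m` factors) of a `2`-form. -/
def wedgePow (f : Alt n 2) : (m : ℕ) → Alt n (2 * m)
  | 0 => ContinuousAlternatingMap.constOfIsEmpty ℝ (Model n) (Fin 0) (1 : ℂ)
  | m + 1 => wedge (wedgePow f m) f

/-- A complex-valued real-linear functional, as a `1`-form. -/
def oneForm (l : Model n →L[ℝ] ℂ) : Alt n 1 :=
  ContinuousAlternatingMap.ofSubsingleton ℝ (Model n) ℂ (0 : Fin 1) l

/-- Multiplication by `i` on `ℂᵏ`, as a real-linear map. -/
def J (n : ℕ) : Model n →L[ℝ] Model n :=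
  (Complex.I • ContinuousLinearMap.id ℂ (Model n)).restrictScalars ℝ

/-- The `(1,0)`-part `v ↦ (α(v) - i α(iv)) / 2` of a real covector `α`. -/
def part10 (α : Model n →L[ℝ] ℝ) : Model n →L[ℝ] ℂ :=
  (1 / 2 : ℂ) • (Complex.ofRealCLM.comp α - Complex.I • Complex.ofRealCLM.comp (α.comp (J n)))

/-- The `(0,1)`-part `v ↦ (α(v) + i α(iv)) / 2` of a real covector `α`. -/
def part01 (α : Model n →L[ℝ] ℝ) : Model n →L[ℝ] ℂ :=
  (1 / 2 : ℂ) • (Complex.ofRealCLM.comp α + Complex.I • Complex.ofRealCLM.comp (α.comp (J n)))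

/-- The `(1,1)`-form `i α^{1,0} ∧ α^{0,1}`; for `α = dφ` this is `i ∂φ ∧ ∂̄φ`. -/
def gradForm (α : Model n →L[ℝ] ℝ) : Alt n 2 :=
  Complex.I • wedge (oneForm (part10 α)) (oneForm (part01 α))

/-- `f` has type `(r, s)`: `f(u v₁, …, u v_p) = uʳ ūˢ f(v₁, …, v_p)` for all complex `u`. -/
def IsOfType (r s : ℕ) (f : Alt n p) : Prop :=
  ∀ (u : ℂ) (v : Fin p → Model n),
    f (fun i => u • v i) = u ^ r * (starRingEnd ℂ u) ^ s * f v

/-- The tuple `(v₁, i v₁, v₂, i v₂, …, v_m, i v_m)`. -/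
def interleave {m : ℕ} (v : Fin m → Model n) (j : Fin (2 * m)) : Model n :=
  if (j : ℕ) % 2 = 0 then v ⟨j / 2, by omega⟩ else Complex.I • v ⟨j / 2, by omega⟩

/-- Positivity of an `(m, m)`-form: it is of type `(m, m)` and it is nonnegative on
every complex `m`-dimensional subspace with its complex orientation. -/
def IsPositiveForm {m : ℕ} (f : Alt n (2 * m)) : Prop :=
  IsOfType m m f ∧ ∀ v : Fin m → Model n, 0 ≤ f (interleave v)

/-- The standard oriented real basis `(e₁, i e₁, …, e_k, i e_k)` of `ℂᵏ`. -/
def stdFrame (n : ℕ) : Fin (2 * (n + 1)) → Model n :=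
  interleave (fun j : Fin (n + 1) => EuclideanSpace.single j (1 : ℂ))

end Algebra

/-! ### Differential forms on a complex manifold

The tangent space of `X` at `x` is identified with the model space by the differential of the
preferred chart `chartAt x`, which is Mathlib's definition of `TangentSpace`. -/

section Forms

variable (n : ℕ) (X : Type*) [TopologicalSpace X] [ChartedSpace (Model n) X]

/-- Complex-valued `p`-forms on `X`, without regularity. -/
abbrev DForm (p : ℕ) : Type _ := X → Alt n p

variable {n X}

/-- The differential of `e⁻¹ : ℂᵏ → X` at `y`, read through the identification of the tangent
space of `X` at `e⁻¹ y` with `ℂᵏ`. -/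
def invDiff (e : OpenPartialHomeomorph X (Model n)) (y : Model n) : Model n →L[ℝ] Model n :=
  fderiv ℝ (fun z => chartAt (Model n) (e.symm y) (e.symm z)) y

/-- The coordinate expression `(e⁻¹)^* η` of a form in a chart `e`
(meaningful on the target of `e`). -/
def inChart {p : ℕ} (e : OpenPartialHomeomorph X (Model n)) (η : DForm n X p) (y : Model n) :
    Alt n p :=
  (η (e.symm y)).compContinuousLinearMap (invDiff e y)

/-- Smooth (`C^∞`) forms. -/
def SmoothForm {p : ℕ} (η : DForm n X p) : Prop :=
  ∀ e ∈ atlas (Model n) X, ContDiffOn ℝ ∞ (inChart e η) e.target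

/-- The exterior derivative, computed at `x` in the preferred chart at `x`. -/
def extD {p : ℕ} (η : DForm n X p) (x : X) : Alt n (p + 1) :=
  extDeriv (inChart (chartAt (Model n) x) η) (chartAt (Model n) x x)

variable (n X) in
/-- Test forms: smooth complex-valued `p`-forms with compact support. -/
def TestForm (p : ℕ) : Submodule ℂ (DForm n X p) where
  carrier := {η | SmoothForm η ∧ HasCompactSupport η}
  zero_mem' := by
    refine ⟨fun e _ => ?_, HasCompactSupport.zero⟩
    have : inChart e (0 : DForm n X p) = fun _ => 0 := by
      funext y; ext v; simp [inChart]
    rw [this]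
    exact contDiffOn_const
  add_mem' := by
    rintro η ζ ⟨h1, h2⟩ ⟨h3, h4⟩
    refine ⟨fun e he => ?_, h2.add h4⟩
    have : inChart e (η + ζ) = inChart e η + inChart e ζ := by
      funext y; ext v; simp [inChart]
    rw [this]
    exact (h1 e he).add (h3 e he)
  smul_mem' := by
    rintro c η ⟨h1, h2⟩
    refine ⟨fun e he => ?_, h2.mono ?_⟩
    · have : inChart e (c • η) = fun y => c • inChart e η y := by
        funext y; ext v; simp [inChart]
      rw [this]
      exact (h1 e he).const_smul c
    · intro x hx hx'
      exact hx (by simp [hx'])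

end Forms

/-! ### Currents -/

section Currents

variable {n : ℕ} {X : Type*} [TopologicalSpace X] [ChartedSpace (Model n) X]

/-- Convergence to zero in the space of test forms: the supports lie in a common compact set and
all derivatives in charts tend to zero uniformly on compact sets. -/
def TestTendsToZero {p : ℕ} (Ψ : ℕ → TestForm n X p) : Prop :=
  (∃ K : Set X, IsCompact K ∧ ∀ j, tsupport (Ψ j : DForm n X p) ⊆ K) ∧
    ∀ e ∈ atlas (Model n) X, ∀ N : ℕ, ∀ L : Set (Model n), IsCompact L → L ⊆ e.target →
      TendstoUniformlyOn (fun j y => iteratedFDeriv ℝ N (inChart e (Ψ j : DForm n X p)) y)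
        (fun _ => 0) atTop L

/-- Currents of dimension `p`: (sequentially) continuous linear functionals on test `p`-forms. -/
def IsCurrent {p : ℕ} (T : TestForm n X p →ₗ[ℂ] ℂ) : Prop :=
  ∀ Ψ : ℕ → TestForm n X p, TestTendsToZero Ψ → Tendsto (fun j => T (Ψ j)) atTop (𝓝 0)

/-- A current of dimension `p` is closed if it vanishes on all `dη`, where `η` is a test form of
degree `p - 1` (no condition if `p = 0`). -/
def IsClosedCurrent {p : ℕ} (T : TestForm n X p →ₗ[ℂ] ℂ) : Prop :=
  ∀ (q : ℕ) (hq : p = q + 1) (η : TestForm n X q) (Ψ : TestForm n X p),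
    (∀ x v, (Ψ : DForm n X p) x v = extD (η : DForm n X q) x (fun i => v (Fin.cast hq.symm i))) →
      T Ψ = 0

/-- A current of dimension `2 n` on a manifold of complex dimension `k = n + 1` has bidegree
`(1, 1)` if it vanishes on all test forms of type `(r, s) ≠ (n, n)`, `r + s = 2 n`. -/
def HasBidegree11 (T : TestForm n X (2 * n) →ₗ[ℂ] ℂ) : Prop :=
  ∀ r s : ℕ, r + s = 2 * n → (r, s) ≠ (n, n) → ∀ Ψ : TestForm n X (2 * n),
    (∀ x, IsOfType r s ((Ψ : DForm n X (2 * n)) x)) → T Ψ = 0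

end Currents

/-! ### Kähler forms, volume, integration -/

section Kahler

variable (n : ℕ) (X : Type*) [TopologicalSpace X] [ChartedSpace (Model n) X]

/-- A Kähler form: a smooth closed positive definite form of type `(1, 1)`. (The conditions force
it to be real-valued.) -/
structure KahlerForm where
  /-- the underlying `2`-form -/
  form : DForm n X 2
  smooth : SmoothForm form
  closed : ∀ x, extD form x = 0
  type11 : ∀ x, IsOfType 1 1 (form x)
  pos : ∀ x (v : Model n), v ≠ 0 → 0 < form x ![v, Complex.I • v]

variable {n X} (κ : KahlerForm n X)

/-- The form `κᵐ`. -/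
def KahlerForm.pow (m : ℕ) : DForm n X (2 * m) := fun x => wedgePow (κ.form x) m

variable [MeasurableSpace X]

/-- The measure on the domain of a chart `e` with density, in the coordinates of `e`, equal to
the coefficient of `κᵏ`. -/
def KahlerForm.chartMeasure (e : OpenPartialHomeomorph X (Model n)) : Measure X :=
  Measure.map e.symm ((volume.restrict e.target).withDensity
    (fun y => ENNReal.ofReal (inChart e (κ.pow (n + 1)) y (stdFrame n)).re))

/-- The measure on `X` given by the volume form `κᵏ`. Since the measures attached to two charts
agree on the intersection of their domains, it is the least upper bound of these measures. -/
def KahlerForm.vol : Measure X :=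
  ⨆ x : X, κ.chartMeasure (chartAt (Model n) x)

/-- The quotient `η / κᵏ` of a form of degree `2 k` by the volume form. -/
def KahlerForm.ratio (η : DForm n X (2 * (n + 1))) (x : X) : ℂ :=
  η x (stdFrame n) / κ.pow (n + 1) x (stdFrame n)

/-- The integral over `X` of a form of degree `2 k`. -/
def KahlerForm.integral (η : DForm n X (2 * (n + 1))) : ℂ :=
  ∫ x, κ.ratio η x ∂κ.vol

/-- The norm of a covector at `x` for the hermitian metric of `κ`: the supremum of `|a(v)|` over
`v` with `κ(v, iv) ≤ 1`. -/
def KahlerForm.covNorm (x : X) (a : Model n →L[ℝ] ℝ) : ℝ≥0∞ :=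
  ⨆ (v : Model n) (_ : (κ.form x ![v, Complex.I • v]).re ≤ 1), ‖a v‖ₑ

/-! ### The spaces `W^{1,2}` and `W^*` -/

/-- A real `1`-form with `L²` coefficients: its coefficients in every chart are measurable, and
its pointwise norm is square integrable. -/
def KahlerForm.IsL2OneForm (α : X → Model n →L[ℝ] ℝ) : Prop :=
  (∀ e ∈ atlas (Model n) X,
    AEStronglyMeasurable (fun y => (α (e.symm y)).comp (invDiff e y))
      (volume.restrict e.target)) ∧
  ∫⁻ x, κ.covNorm x (α x) ^ 2 ∂κ.vol < ⊤

/-- `dφ = α` in the sense of currents: `∫ α ∧ η = - ∫ φ dη` for all test forms `η` of degree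
`2 k - 1`. -/
def KahlerForm.IsWeakDifferential (φ : X → ℝ) (α : X → Model n →L[ℝ] ℝ) : Prop :=
  ∀ η : TestForm n X (2 * n + 1),
    κ.integral (fun x => castDeg (show 1 + (2 * n + 1) = 2 * (n + 1) by omega)
        (wedge (oneForm (Complex.ofRealCLM.comp (α x))) ((η : DForm n X (2 * n + 1)) x))) =
      - κ.integral (fun x => (φ x : ℂ) • extD (η : DForm n X (2 * n + 1)) x)

/-- `α` is an `L²` form and `dφ = α` in the sense of currents. -/
def KahlerForm.HasL2Differential (φ : Lp ℝ 2 κ.vol) (α : X → Model n →L[ℝ] ℝ) : Prop :=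
  κ.IsL2OneForm α ∧ κ.IsWeakDifferential φ α

/-- The Sobolev space `W^{1,2}`: real `L²` functions whose differential in the sense of currents
has `L²` coefficients. -/
def KahlerForm.W12 : Set (Lp ℝ 2 κ.vol) :=
  {φ | ∃ α, κ.HasL2Differential φ α}

/-- The inequality `i ∂φ ∧ ∂̄φ ≤ T` in the sense of currents, for `φ ∈ W^{1,2}`: for every positive
test form `Ψ` one has `∫ i ∂φ ∧ ∂̄φ ∧ Ψ ≤ ⟨T, Ψ⟩`. (As `Ψ` has even degree, it commutes with
every form. The differential `α` of `φ` is unique almost everywhere.) -/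
def KahlerForm.Dominates (φ : Lp ℝ 2 κ.vol) (T : TestForm n X (2 * n) →ₗ[ℂ] ℂ) : Prop :=
  ∃ α, κ.HasL2Differential φ α ∧
    ∀ Ψ : TestForm n X (2 * n), (∀ x, IsPositiveForm ((Ψ : DForm n X (2 * n)) x)) →
      κ.integral (fun x => wedge ((Ψ : DForm n X (2 * n)) x) (gradForm (α x))) ≤ T Ψ

/-- The mass `∫_X T ∧ κ^{k-1}` of a positive current `T` of bidegree `(1, 1)`: the supremum of
`⟨T, χ κ^{k-1}⟩` over the smooth functions `χ` with compact support and `0 ≤ χ ≤ 1`. -/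
def KahlerForm.mass (T : TestForm n X (2 * n) →ₗ[ℂ] ℂ) : ℝ≥0∞ :=
  ⨆ (Ψ : TestForm n X (2 * n))
    (_ : ∃ χ : X → ℝ, ContMDiff 𝓘(ℝ, Model n) 𝓘(ℝ, ℝ) ∞ χ ∧ HasCompactSupport χ ∧
      (∀ x, 0 ≤ χ x ∧ χ x ≤ 1) ∧ ∀ x, (Ψ : DForm n X (2 * n)) x = (χ x : ℂ) • κ.pow n x),
    ENNReal.ofReal (T Ψ).re

/-- The closed currents `T` of bidegree `(1, 1)` with `i ∂φ ∧ ∂̄φ ≤ T`. -/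
def KahlerForm.admissible (φ : Lp ℝ 2 κ.vol) : Set (TestForm n X (2 * n) →ₗ[ℂ] ℂ) :=
  {T | IsCurrent T ∧ HasBidegree11 T ∧ IsClosedCurrent T ∧ κ.Dominates φ T}

/-- The space `W^*`: functions in `W^{1,2}` for which there is a closed current `T` of bidegree
`(1, 1)` and of finite mass with `i ∂φ ∧ ∂̄φ ≤ T`. -/
def KahlerForm.Wstar : Set (Lp ℝ 2 κ.vol) :=
  {φ | φ ∈ κ.W12 ∧ ∃ T ∈ κ.admissible φ, κ.mass T < ⊤}

/-- `‖φ‖_* = (‖φ‖²_{L²} + inf m(T))^{1/2}`. -/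
def KahlerForm.starNorm (φ : Lp ℝ 2 κ.vol) : ℝ :=
  Real.sqrt (‖φ‖ ^ 2 + (⨅ T ∈ κ.admissible φ, κ.mass T).toReal)

end Kahler

end KahlerSobolev

end

/-!
Completeness of `W^*` is a statement about series. If `ψⱼ` are functions with
`i ∂ψⱼ ∧ ∂̄ψⱼ ≤ Tⱼ`, the weights `2^{j+1}` in the Cauchy–Schwarz inequality give
`i ∂φ ∧ ∂̄φ ≤ ∑ 2^{j+1} Tⱼ` for `φ = ∑ ψⱼ`
(`KahlerSobolev.KahlerForm.exists_mem_admissible_of_series`), and the right-hand side has finite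
mass as soon as the masses of `Tⱼ` decay like `4^{-j}`. Applied to the differences of a rapidly
converging subsequence this gives the limit of a Cauchy sequence, together with the estimate of the
remainder; no weak compactness of currents or of `L²` is needed. With two terms and weights
`1 + r²`, `1 + r^{-2}` the same inequality gives the triangle inequality, after optimizing `r`.

The analysis behind it rests on two pointwise facts about the hermitian metric `|·|` of `κ`.

* `dualNorm_sq`: `|α|² κᵏ = 2 k · κ^{k-1} ∧ i α^{1,0} ∧ α^{0,1}`. Hence the energy `∫ |α|²` is at
  most `2 k` times the mass of a current that dominates `i α^{1,0} ∧ α^{0,1}`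
  (`KahlerForm.lintegral_covNorm_sq_le`), and the series of the differentials `αⱼ` of `ψⱼ` converges
  almost everywhere to an `L²` form (`KahlerForm.exists_ae_sum`).
* `isPositiveForm_smul_wedgePow_add`: if `f` is a real `(m, m)`-form with
  `|f(w₁, …)| ≤ ε |w₁| ⋯ |w_{2m}|`, then `ε κᵐ + f` is positive. Hence a positive current of
  bidegree `(1, 1)` and of finite mass is bounded by its mass times the supremum of the test form
  (`KahlerForm.norm_apply_le`), so that `∑ 2^{j+1} Tⱼ` converges to a current.

The second fact is applied to the components of a test form of type `(n, n)`, which are obtained by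
averaging over rotations (`typePart`). Weak differentials and the domination pass to the limit by
dominated convergence.
-/

open scoped Manifold ContDiff ENNReal Topology ComplexOrder
open MeasureTheory Filter

noncomputable section

namespace KahlerSobolev

/-! ### The exterior product -/

section WedgeAlgebra

variable {n p q : ℕ}

theorem wedge_apply (f : Alt n p) (g : Alt n q) (v : Fin (p + q) → Model n) :
    wedge f g v = ((p.factorial * q.factorial : ℝ)⁻¹ : ℂ) *
      ∑ σ : Equiv.Perm (Fin (p + q)), ((Equiv.Perm.sign σ : ℤ) : ℂ) *
        (f (fun i => v (σ (Fin.castAdd q i))) * g (fun j => v (σ (Fin.natAdd p j)))) := by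
  simp only [wedge, ContinuousAlternatingMap.smul_apply,
    ContinuousMultilinearMap.alternatization_apply_apply, Complex.real_smul]
  congr 1
  · push_cast; rfl
  · refine Finset.sum_congr rfl fun σ _ => ?_
    rw [Units.smul_def, zsmul_eq_mul]
    rfl

theorem wedge_add_left (f f' : Alt n p) (g : Alt n q) :
    wedge (f + f') g = wedge f g + wedge f' g := by
  ext v
  simp only [wedge_apply, ContinuousAlternatingMap.add_apply, ← mul_add, ← Finset.sum_add_distrib,
    add_mul]

theorem wedge_add_right (f : Alt n p) (g g' : Alt n q) :
    wedge f (g + g') = wedge f g + wedge f g' := by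
  ext v
  simp only [wedge_apply, ContinuousAlternatingMap.add_apply, ← mul_add, ← Finset.sum_add_distrib]

theorem wedge_smul_left (c : ℂ) (f : Alt n p) (g : Alt n q) :
    wedge (c • f) g = c • wedge f g := by
  ext v
  simp only [wedge_apply, ContinuousAlternatingMap.smul_apply, smul_eq_mul, Finset.mul_sum]
  refine Finset.sum_congr rfl fun σ _ => ?_
  ring

theorem wedge_real_smul_left (c : ℝ) (f : Alt n p) (g : Alt n q) :
    wedge (c • f) g = c • wedge f g := by
  ext v
  simp only [wedge_apply, ContinuousAlternatingMap.smul_apply, Complex.real_smul, Finset.mul_sum]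
  refine Finset.sum_congr rfl fun σ _ => ?_
  ring

theorem wedge_real_smul_right (c : ℝ) (f : Alt n p) (g : Alt n q) :
    wedge f (c • g) = c • wedge f g := by
  ext v
  simp only [wedge_apply, ContinuousAlternatingMap.smul_apply, Complex.real_smul, Finset.mul_sum]
  refine Finset.sum_congr rfl fun σ _ => ?_
  ring

theorem wedge_zero_right (f : Alt n p) : wedge f (0 : Alt n q) = 0 := by
  ext v
  simp [wedge_apply]

theorem wedge_sum_right {ι : Type*} (s : Finset ι) (f : Alt n p) (g : ι → Alt n q) :
    wedge f (∑ i ∈ s, g i) = ∑ i ∈ s, wedge f (g i) := by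
  classical
  induction s using Finset.induction_on with
  | empty => simp [wedge_zero_right]
  | insert a s ha ih => rw [Finset.sum_insert ha, Finset.sum_insert ha, wedge_add_right, ih]

theorem wedge_compContinuousLinearMap (f : Alt n p) (g : Alt n q) (A : Model n →L[ℝ] Model n) :
    (wedge f g).compContinuousLinearMap A =
      wedge (f.compContinuousLinearMap A) (g.compContinuousLinearMap A) := by
  ext v
  simp [wedge_apply, Function.comp_def]

theorem wedgePow_compContinuousLinearMap (f : Alt n 2) (A : Model n →L[ℝ] Model n) (m : ℕ) :
    (wedgePow f m).compContinuousLinearMap A = wedgePow (f.compContinuousLinearMap A) m := by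
  induction m with
  | zero => ext v; simp [wedgePow]
  | succ m ih => exact (wedge_compContinuousLinearMap _ _ _).trans (by rw [ih]; rfl)

theorem norm_wedge_le (f : Alt n p) (g : Alt n q) :
    ‖wedge f g‖ ≤ ((p.factorial * q.factorial : ℝ)⁻¹ * (p + q).factorial) * (‖f‖ * ‖g‖) := by
  refine ContinuousAlternatingMap.opNorm_le_bound _ (by positivity) fun v => ?_
  rw [wedge_apply, norm_mul]
  have h1 : ‖((p.factorial * q.factorial : ℝ)⁻¹ : ℂ)‖ = (p.factorial * q.factorial : ℝ)⁻¹ := by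
    simp
  rw [h1, mul_assoc, mul_assoc]
  refine mul_le_mul_of_nonneg_left ?_ (by positivity)
  refine (norm_sum_le _ _).trans ?_
  have h2 : ∀ σ ∈ (Finset.univ : Finset (Equiv.Perm (Fin (p + q)))),
      ‖((Equiv.Perm.sign σ : ℤ) : ℂ) *
        (f (fun i => v (σ (Fin.castAdd q i))) * g (fun j => v (σ (Fin.natAdd p j))))‖ ≤
        (‖f‖ * ‖g‖) * ∏ i, ‖v i‖ := by
    intro σ _
    have h3 : ‖((Equiv.Perm.sign σ : ℤ) : ℂ)‖ = 1 := by
      rcases Int.units_eq_one_or (Equiv.Perm.sign σ) with h | h <;> simp [h]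
    rw [norm_mul, h3, one_mul, norm_mul]
    calc _ ≤ (‖f‖ * ∏ i, ‖v (σ (Fin.castAdd q i))‖) * (‖g‖ * ∏ j, ‖v (σ (Fin.natAdd p j))‖) :=
          mul_le_mul (f.le_opNorm _) (g.le_opNorm _) (norm_nonneg _) (by positivity)
      _ = (‖f‖ * ‖g‖) * ∏ i, ‖v (σ i)‖ := by rw [Fin.prod_univ_add]; ring
      _ = _ := by rw [Equiv.prod_comp σ (fun i => ‖v i‖)]
  refine (Finset.sum_le_sum h2).trans (le_of_eq ?_)
  rw [Finset.sum_const, Finset.card_univ, Fintype.card_perm, Fintype.card_fin, nsmul_eq_mul]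

variable (n p q) in
/-- The exterior product as a continuous bilinear map over `ℝ`. -/
def wedgeL : Alt n p →L[ℝ] Alt n q →L[ℝ] Alt n (p + q) :=
  LinearMap.mkContinuous₂
    (LinearMap.mk₂ ℝ wedge wedge_add_left
      wedge_real_smul_left
      wedge_add_right
      wedge_real_smul_right)
    _ (fun f g => (norm_wedge_le f g).trans (le_of_eq (mul_assoc _ _ _).symm))

theorem wedgeL_apply (f : Alt n p) (g : Alt n q) : wedgeL n p q f g = wedge f g := rfl

/-- If `g` vanishes whenever one of its arguments is among the first `p` vectors of `v`, only one
shuffle contributes to `(f ∧ g)(v)`. -/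
theorem wedge_apply_of_vanish (f : Alt n p) (g : Alt n q) (v : Fin (p + q) → Model n)
    (h : ∀ s : Fin q → Fin (p + q), (∃ j i, s j = Fin.castAdd q i) → g (v ∘ s) = 0) :
    wedge f g v = f (fun i => v (Fin.castAdd q i)) * g (fun j => v (Fin.natAdd p j)) := by
  classical
  rw [wedge_apply]
  let Φ : Equiv.Perm (Fin p) × Equiv.Perm (Fin q) → Equiv.Perm (Fin (p + q)) := fun ab =>
    finSumFinEquiv.permCongr (Equiv.Perm.sumCongr ab.1 ab.2)
  have hΦ : Function.Injective Φ := by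
    intro a b hab
    have h1 := (Equiv.permCongr finSumFinEquiv).injective hab
    exact Equiv.Perm.sumCongrHom_injective (a₁ := a) (a₂ := b) h1
  have hc : ∀ ab i, Φ ab (Fin.castAdd q i) = Fin.castAdd q (ab.1 i) := by
    intro ab i; simp [Φ, Equiv.permCongr_apply]
  have hn : ∀ ab j, Φ ab (Fin.natAdd p j) = Fin.natAdd p (ab.2 j) := by
    intro ab i; simp [Φ, Equiv.permCongr_apply]
  have hs : ∀ ab, Equiv.Perm.sign (Φ ab) = Equiv.Perm.sign ab.1 * Equiv.Perm.sign ab.2 := by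
    intro ab; simp [Φ, Equiv.Perm.sign_permCongr, Equiv.Perm.sign_sumCongr]
  have key : ∑ σ : Equiv.Perm (Fin (p + q)), ((Equiv.Perm.sign σ : ℤ) : ℂ) *
        (f (fun i => v (σ (Fin.castAdd q i))) * g (fun j => v (σ (Fin.natAdd p j)))) =
      ∑ ab : Equiv.Perm (Fin p) × Equiv.Perm (Fin q),
        f (fun i => v (Fin.castAdd q i)) * g (fun j => v (Fin.natAdd p j)) := by
    rw [← Finset.sum_subset (Finset.subset_univ (Finset.univ.image Φ))]
    · rw [Finset.sum_image (fun a _ b _ hab => hΦ hab)]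
      refine Finset.sum_congr rfl fun ab _ => ?_
      rw [hs]
      simp only [hc, hn]
      have e1 := f.toAlternatingMap.map_perm (fun i => v (Fin.castAdd q i)) ab.1
      have e2 := g.toAlternatingMap.map_perm (fun i => v (Fin.natAdd p i)) ab.2
      simp only [ContinuousAlternatingMap.coe_toAlternatingMap, Function.comp_def] at e1 e2
      rw [e1, e2]
      rcases Int.units_eq_one_or (Equiv.Perm.sign ab.1) with h1 | h1 <;>
      rcases Int.units_eq_one_or (Equiv.Perm.sign ab.2) with h2 | h2 <;> simp [h1, h2]
    · intro σ _ hσ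
      suffices g (fun j => v (σ (Fin.natAdd p j))) = 0 by rw [this]; simp
      refine h (fun j => σ (Fin.natAdd p j)) ?_
      by_contra! hcon
      apply hσ
      have hm : Set.MapsTo (finSumFinEquiv.permCongr.symm σ)
          (Set.range (Sum.inr : Fin q → Fin p ⊕ Fin q)) (Set.range Sum.inr) := by
        rintro _ ⟨j, rfl⟩
        have h3 := hcon j
        simp only [Equiv.permCongr_symm_apply, finSumFinEquiv_apply_right]
        obtain ⟨a, ha⟩ | ⟨b, hb⟩ : (∃ a, σ (Fin.natAdd p j) = Fin.castAdd q a) ∨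
            ∃ b, σ (Fin.natAdd p j) = Fin.natAdd p b := by
          refine Fin.addCases (motive := fun k => (∃ a, k = Fin.castAdd q a) ∨
            ∃ b, k = Fin.natAdd p b) (fun a => Or.inl ⟨a, rfl⟩) (fun b => Or.inr ⟨b, rfl⟩) _
        · exact absurd ha (h3 a)
        · exact ⟨b, by rw [hb]; simp⟩
      have hm' : Set.MapsTo (finSumFinEquiv.permCongr.symm σ)
          (Set.range (Sum.inl : Fin p → Fin p ⊕ Fin q)) (Set.range Sum.inl) := by
        have := Equiv.Perm.perm_mapsTo_inl_iff_mapsTo_inr (finSumFinEquiv.permCongr.symm σ)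
        exact this.2 hm
      obtain ⟨ab, hab⟩ := Equiv.Perm.mem_sumCongrHom_range_of_perm_mapsTo_inl hm'
      rw [Finset.mem_image]
      refine ⟨ab, Finset.mem_univ _, ?_⟩
      have : Equiv.Perm.sumCongr ab.1 ab.2 = finSumFinEquiv.permCongr.symm σ := hab
      simp only [Φ]
      rw [this, Equiv.apply_symm_apply]
  rw [key, Finset.sum_const, Finset.card_univ, Fintype.card_prod, Fintype.card_perm,
    Fintype.card_perm, Fintype.card_fin, Fintype.card_fin, nsmul_eq_mul, ← mul_assoc]
  have hp : (p.factorial : ℂ) ≠ 0 := by exact_mod_cast p.factorial_ne_zero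
  have hq : (q.factorial : ℂ) ≠ 0 := by exact_mod_cast q.factorial_ne_zero
  push_cast
  field_simp

theorem IsOfType.wedge {r s r' s' : ℕ} {f : Alt n p} {g : Alt n q} (hf : IsOfType r s f)
    (hg : IsOfType r' s' g) : IsOfType (r + r') (s + s') (wedge f g) := by
  intro u v
  simp only [wedge_apply]
  rw [Finset.mul_sum, Finset.mul_sum, Finset.mul_sum]
  refine Finset.sum_congr rfl fun σ _ => ?_
  rw [hf u, hg u]
  ring

theorem IsOfType.add {r s : ℕ} {f g : Alt n p} (hf : IsOfType r s f) (hg : IsOfType r s g) :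
    IsOfType r s (f + g) := by
  intro u v
  simp only [ContinuousAlternatingMap.add_apply, hf u v, hg u v]; ring

theorem IsOfType.smul {r s : ℕ} {f : Alt n p} (hf : IsOfType r s f) (c : ℂ) :
    IsOfType r s (c • f) := by
  intro u v
  simp only [ContinuousAlternatingMap.smul_apply, hf u v, smul_eq_mul]; ring

theorem isOfType_zero (r s : ℕ) : IsOfType r s (0 : Alt n p) := by
  intro u v
  simp

end WedgeAlgebra

/-! ### Complex frames -/

section Frames

variable {n : ℕ}

/-- An alternating form of top degree is multiplied by the determinant under a linear map. -/
theorem map_comp_eq_det_smul {V N ι : Type*} [AddCommGroup V] [Module ℝ V] [AddCommGroup N]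
    [Module ℝ N] [Fintype ι] [DecidableEq ι] (b : Module.Basis ι ℝ V) (f : V [⋀^ι]→ₗ[ℝ] N)
    (A : V →ₗ[ℝ] V) (v : ι → V) : f (A ∘ v) = LinearMap.det A • f v := by
  have key : f = b.det.smulRight (f b) := by
    refine Module.Basis.ext_alternating b fun σ hσ => ?_
    let τ : Equiv.Perm ι := Equiv.ofBijective σ (Finite.injective_iff_bijective.1 hσ)
    have e1 : f (b ∘ τ) = _ := f.map_perm b τ
    have e2 : b.det (b ∘ τ) = _ := b.det.map_perm b τ
    change f (b ∘ τ) = b.det (b ∘ τ) • f b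
    rw [e1, e2, b.det_self]
    rcases Int.units_eq_one_or (Equiv.Perm.sign τ) with h1 | h1 <;> simp [h1]
  have e : ∀ w, f w = b.det w • f b := fun w => by
    conv_lhs => rw [key]
    rfl
  rw [e (A ∘ v), e v, Module.Basis.det_comp, mul_smul]

/-- The tuple `(v₁, i v₁, …, v_m, i v_m)` in any complex vector space. -/
def complexFrame {V : Type*} [SMul ℂ V] {m : ℕ} (v : Fin m → V) (j : Fin (2 * m)) : V :=
  if (j : ℕ) % 2 = 0 then v ⟨j / 2, by omega⟩ else Complex.I • v ⟨j / 2, by omega⟩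

theorem interleave_eq_complexFrame {m : ℕ} (v : Fin m → Model n) :
    interleave v = complexFrame v := rfl

theorem comp_complexFrame {V W : Type*} [AddCommGroup V] [Module ℂ V] [AddCommGroup W]
    [Module ℂ W] {m : ℕ} (L : V →ₗ[ℂ] W) (v : Fin m → V) :
    L ∘ complexFrame v = complexFrame (L ∘ v) := by
  funext j
  simp only [complexFrame, Function.comp_def]
  split_ifs <;> simp

/-- A complex linear change of a frame multiplies forms of top degree by `|det A|²`. -/
theorem map_interleave_matrix {m : ℕ} (f : Alt n (2 * m)) (A : Matrix (Fin m) (Fin m) ℂ)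
    (w : Fin m → Model n) :
    f (interleave fun i => ∑ j, A i j • w j) = (Complex.normSq A.det : ℂ) * f (interleave w) := by
  classical
  let L : (Fin m → ℂ) →ₗ[ℂ] Model n := Fintype.linearCombination ℂ w
  let M : (Fin m → ℂ) →ₗ[ℂ] (Fin m → ℂ) := Matrix.toLin' A.transpose
  let e : Fin m → (Fin m → ℂ) := fun i => Pi.single i 1
  let g := f.toAlternatingMap.compLinearMap (L.restrictScalars ℝ)
  have hw : interleave w = L ∘ complexFrame e := by
    rw [comp_complexFrame, interleave_eq_complexFrame]
    congr 1
    funext i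
    simp [L, e, Fintype.linearCombination_apply, Pi.single_apply]
  have hAw : (interleave fun i => ∑ j, A i j • w j) = L ∘ (M ∘ complexFrame e) := by
    rw [comp_complexFrame, comp_complexFrame, interleave_eq_complexFrame]
    congr 1
    funext i
    simp [L, M, e, Fintype.linearCombination_apply]
  have hfr : Module.finrank ℝ (Fin m → ℂ) = 2 * m := by
    rw [Module.finrank_pi_fintype]; simp [Complex.finrank_real_complex, mul_comm]
  let b : Module.Basis (Fin (2 * m)) ℝ (Fin m → ℂ) := Module.finBasisOfFinrankEq ℝ _ hfr
  have h := map_comp_eq_det_smul b g (M.restrictScalars ℝ) (complexFrame e)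
  rw [LinearMap.det_restrictScalars, Algebra.norm_complex_apply, LinearMap.det_toLin',
    Matrix.det_transpose, Complex.real_smul] at h
  rw [hAw, hw]
  exact h

theorem map_interleave_comp_perm {m : ℕ} (f : Alt n (2 * m)) (τ : Equiv.Perm (Fin m))
    (w : Fin m → Model n) : f (interleave (w ∘ τ)) = f (interleave w) := by
  classical
  have h := map_interleave_matrix f (τ.permMatrix ℂ) w
  have h1 : (fun i => ∑ j, (τ.permMatrix ℂ) i j • w j) = w ∘ τ := by
    funext i
    simp [Equiv.Perm.permMatrix, PEquiv.toMatrix_apply, Equiv.toPEquiv_apply]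
  rw [h1, Matrix.det_permutation] at h
  rw [h]
  rcases Int.units_eq_one_or (Equiv.Perm.sign τ) with h1 | h1 <;> simp [h1]

/-- If the `v i` are linearly dependent over `ℂ`, forms vanish on the frame of `v`. -/
theorem map_interleave_eq_zero {m : ℕ} (f : Alt n (2 * m)) (v : Fin m → Model n)
    (hv : ¬ LinearIndependent ℂ v) : f (interleave v) = 0 := by
  classical
  rw [linearIndependent_iff_notMem_span] at hv
  push Not at hv
  obtain ⟨j, hj⟩ := hv
  rw [Finsupp.mem_span_image_iff_linearCombination] at hj
  obtain ⟨c, hc, hcj⟩ := hj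
  have hcj0 : c j = 0 := by
    by_contra hne
    have := (Finsupp.mem_supported ℂ c).1 hc (Finsupp.mem_support_iff.2 hne)
    simp at this
  let A : Matrix (Fin m) (Fin m) ℂ := fun i k => if i = j then c k else if i = k then 1 else 0
  have hA : (fun i => ∑ k, A i k • v k) = v := by
    funext i
    by_cases hi : i = j
    · subst hi
      simp only [A, if_true]
      rw [← hcj, Finsupp.linearCombination_apply, Finsupp.sum_fintype _ _ (by simp)]
    · simp [A, hi]
  have hdet : A.det = 0 := by
    refine Matrix.det_eq_zero_of_column_eq_zero j fun i => ?_
    by_cases hi : i = j <;> simp [A, hi, hcj0]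
  have := map_interleave_matrix f A v
  rwa [hA, hdet, map_zero, Complex.ofReal_zero, zero_mul] at this

theorem interleave_castAdd {m : ℕ} (v : Fin (m + 1) → Model n) (i : Fin (2 * m)) :
    interleave v (Fin.castAdd 2 i : Fin (2 * m + 2)) = interleave (fun j => v j.castSucc) i := by
  simp [interleave]

theorem interleave_natAdd {m : ℕ} (v : Fin (m + 1) → Model n) :
    (fun j : Fin 2 => interleave v (Fin.natAdd (2 * m) j : Fin (2 * m + 2))) =
      ![v (Fin.last m), Complex.I • v (Fin.last m)] := by
  funext j
  fin_cases j
  · simp [interleave, Fin.last]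
  · have h1 : (2 * m + 1) % 2 = 1 := by omega
    have h2 : (2 * m + 1) / 2 = m := by omega
    simp [interleave, Fin.last, h1, h2]

/-- Evaluation of `f ∧ g` on a complex frame, when the `2`-form `g` annihilates all complex lines
of the frame except the last one. -/
theorem wedge_interleave_last {m : ℕ} (f : Alt n (2 * m)) (g : Alt n 2)
    (v : Fin (m + 1) → Model n)
    (hg : ∀ i : Fin m, ∀ u : Model n, g ![v i.castSucc, u] = 0 ∧
      g ![Complex.I • v i.castSucc, u] = 0) :
    wedge f g (interleave v : Fin (2 * (m + 1)) → Model n) =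
      f (interleave fun j => v j.castSucc) * g ![v (Fin.last m), Complex.I • v (Fin.last m)] := by
  have h := wedge_apply_of_vanish f g (interleave v : Fin (2 * (m + 1)) → Model n) ?_
  · refine h.trans ?_
    exact congrArg₂ (· * ·) (congrArg f (funext fun i => interleave_castAdd v i))
      (congrArg g (interleave_natAdd v))
  · rintro s ⟨j, i, hji⟩
    have h0 : ∀ u, g ![(interleave v : Fin (2 * (m + 1)) → Model n) (s j), u] = 0 := by
      intro u
      rw [hji, interleave_castAdd]
      unfold interleave
      split_ifs
      · exact (hg _ u).1
      · exact (hg _ u).2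
    have h1 : ∀ a b : Model n, g ![a, b] = - g ![b, a] := by
      intro a b
      have := g.toAlternatingMap.map_swap ![b, a] (i := 0) (j := 1) (by decide)
      have e : (![b, a] ∘ Equiv.swap (0 : Fin 2) 1 : Fin 2 → Model n) = ![a, b] := by
        funext k; fin_cases k <;> simp
      rw [e] at this
      exact this
    have h2 : ((interleave v : Fin (2 * (m + 1)) → Model n) ∘ s) =
        ![(interleave v : Fin (2 * (m + 1)) → Model n) (s 0),
          (interleave v : Fin (2 * (m + 1)) → Model n) (s 1)] := by
      funext k; fin_cases k <;> rfl
    rw [h2]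
    fin_cases j
    · exact h0 _
    · rw [h1]; simpa using h0 _

end Frames

/-! ### Orthonormal bases for an abstract Hermitian inner product -/

section Orthonormal

variable {V : Type*} [AddCommGroup V] [Module ℂ V] [FiniteDimensional ℂ V]

/-- A linear form is killed by all vectors but the last of a suitable orthonormal basis. -/
theorem exists_orthonormal_adapted (c : InnerProductSpace.Core ℂ V) (l : V →ₗ[ℂ] ℂ) (n : ℕ)
    (hn : Module.finrank ℂ V = n + 1) :
    ∃ v : Fin (n + 1) → V, (∀ a b, c.inner (v a) (v b) = if a = b then 1 else 0) ∧
      (∀ a : Fin n, l (v a.castSucc) = 0) ∧ ∀ u, ∑ a, c.inner (v a) u • v a = u := by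
  classical
  let _ := c.toNormedAddCommGroup
  let _ : InnerProductSpace ℂ V := InnerProductSpace.ofCore c.toCore
  have hin : ∀ a b : V, c.inner a b = inner ℂ a b := fun _ _ => rfl
  simp only [hin]
  suffices h : ∃ b : OrthonormalBasis (Fin (n + 1)) ℂ V, ∀ a : Fin n, l (b a.castSucc) = 0 by
    obtain ⟨b, hb⟩ := h
    exact ⟨b, fun i j => orthonormal_iff_ite.1 b.orthonormal i j, hb, fun u => b.sum_repr' u⟩
  by_cases hl : l = 0
  · refine ⟨(stdOrthonormalBasis ℂ V).reindex (finCongr hn), fun a => by simp [hl]⟩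
  · have : CompleteSpace V := FiniteDimensional.complete ℂ V
    let w : V := (InnerProductSpace.toDual ℂ V).symm (LinearMap.toContinuousLinearMap l)
    have hw : ∀ u, inner ℂ w u = l u := fun u => by
      simp [w, InnerProductSpace.toDual_symm_apply]
    have hw0 : w ≠ 0 := by
      intro h0
      apply hl
      ext u
      rw [← hw u, h0, inner_zero_left, LinearMap.zero_apply]
    have hw1 : (‖w‖ : ℂ) ≠ 0 := by simpa using hw0
    have ho : Orthonormal ℂ (({Fin.last n} : Set (Fin (n + 1))).domRestrict
        (fun _ => (‖w‖ : ℂ)⁻¹ • w)) := by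
      refine ⟨fun i => ?_, fun i j hij => ?_⟩
      · change ‖(‖w‖ : ℂ)⁻¹ • w‖ = 1
        rw [norm_smul, norm_inv, Complex.norm_real, norm_norm]
        exact inv_mul_cancel₀ (by simpa using hw0)
      · exact absurd (Subtype.ext (i.2.trans j.2.symm)) hij
    obtain ⟨b, hb⟩ := ho.exists_orthonormalBasis_extension_of_card_eq (by simpa using hn)
    refine ⟨b, fun a => ?_⟩
    have hlast := hb (Fin.last n) rfl
    have h0 : inner ℂ (b (Fin.last n)) (b a.castSucc) = 0 := by
      rw [orthonormal_iff_ite.1 b.orthonormal, if_neg (Fin.castSucc_lt_last a).ne']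
    rw [hlast, inner_smul_left, hw] at h0
    rcases mul_eq_zero.1 h0 with h | h
    · simp [hw0] at h
    · exact h

/-- Linearly independent vectors are combinations of as many orthonormal ones. -/
theorem exists_orthonormal_span (c : InnerProductSpace.Core ℂ V) {m : ℕ} (v : Fin m → V)
    (hv : LinearIndependent ℂ v) :
    ∃ (w : Fin m → V) (A : Matrix (Fin m) (Fin m) ℂ),
      (∀ a b, c.inner (w a) (w b) = if a = b then 1 else 0) ∧ v = fun i => ∑ j, A i j • w j := by
  classical
  let _ := c.toNormedAddCommGroup
  let _ : InnerProductSpace ℂ V := InnerProductSpace.ofCore c.toCore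
  have hin : ∀ a b : V, c.inner a b = inner ℂ a b := fun _ _ => rfl
  simp only [hin]
  let S := Submodule.span ℂ (Set.range v)
  have hS : Module.finrank ℂ S = m := by
    rw [finrank_span_eq_card hv, Fintype.card_fin]
  let b := (stdOrthonormalBasis ℂ S).reindex (finCongr hS)
  let v' : Fin m → S := fun i => ⟨v i, Submodule.subset_span ⟨i, rfl⟩⟩
  refine ⟨fun i => (b i : V), fun i j => inner ℂ (b j) (v' i), fun i j => ?_, ?_⟩
  · exact orthonormal_iff_ite.1 b.orthonormal i j
  · funext i
    have := congrArg (Submodule.subtype S) (b.sum_repr' (v' i))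
    simpa [v'] using this.symm

end Orthonormal

/-! ### The form `i ∂φ ∧ ∂̄φ` at a point -/

section GradForm

variable {n : ℕ}

/-- The `(1,0)`-part of a real covector, as a complex linear form. -/
def lin10 (α : Model n →L[ℝ] ℝ) : Model n →ₗ[ℂ] ℂ where
  toFun := part10 α
  map_add' := (part10 α).map_add
  map_smul' := by
    intro c v
    have h1 : c • v = c.re • v + c.im • (Complex.I • v) := by
      conv_lhs => rw [← Complex.re_add_im c, add_smul, mul_smul]
      rfl
    have h2 : part10 α (Complex.I • v) = Complex.I * part10 α v := by
      have h3 : J n v = Complex.I • v := rfl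
      have h4 : J n (Complex.I • v) = -v := by
        change Complex.I • Complex.I • v = -v
        rw [smul_smul, Complex.I_mul_I, neg_one_smul]
      simp only [part10, smul_apply, sub_apply,
        ContinuousLinearMap.comp_apply, Complex.ofRealCLM_apply, h3, h4, map_neg, smul_eq_mul]
      linear_combination (1 / 2 * (α (Complex.I • v) : ℂ)) * Complex.I_sq
    rw [h1, map_add, map_smul, map_smul, h2, RingHom.id_apply, smul_eq_mul, Complex.real_smul,
      Complex.real_smul]
    conv_rhs => rw [← Complex.re_add_im c]
    ring

theorem lin10_apply (α : Model n →L[ℝ] ℝ) (v : Model n) : lin10 α v = part10 α v := rfl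

theorem part10_apply (α : Model n →L[ℝ] ℝ) (v : Model n) :
    part10 α v = (1 / 2 : ℂ) * (α v - Complex.I * α (Complex.I • v)) := rfl

theorem part01_apply (α : Model n →L[ℝ] ℝ) (v : Model n) :
    part01 α v = starRingEnd ℂ (lin10 α v) := by
  have : part01 α v = (1 / 2 : ℂ) * (α v + Complex.I * α (Complex.I • v)) := rfl
  have h2 : starRingEnd ℂ 2 = 2 := Complex.conj_ofNat 2
  rw [this, lin10_apply, part10_apply]
  simp [h2]

theorem covector_apply (α : Model n →L[ℝ] ℝ) (v : Model n) : α v = 2 * (lin10 α v).re := by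
  rw [lin10_apply, part10_apply]
  simp

theorem lin10_add (α β : Model n →L[ℝ] ℝ) (v : Model n) :
    lin10 (α + β) v = lin10 α v + lin10 β v := by
  simp only [lin10_apply, part10_apply, add_apply]; push_cast; ring

theorem lin10_smul (r : ℝ) (α : Model n →L[ℝ] ℝ) (v : Model n) :
    lin10 (r • α) v = r * lin10 α v := by
  simp only [lin10_apply, part10_apply, smul_apply, smul_eq_mul]
  push_cast; ring

theorem gradForm_apply (α : Model n →L[ℝ] ℝ) (v : Fin 2 → Model n) :
    gradForm α v = Complex.I * (lin10 α (v 0) * starRingEnd ℂ (lin10 α (v 1)) -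
      lin10 α (v 1) * starRingEnd ℂ (lin10 α (v 0))) := by
  have hu : (Finset.univ : Finset (Equiv.Perm (Fin (1 + 1)))) =
      {1, Equiv.swap (0 : Fin 2) 1} := by decide
  have hne : (1 : Equiv.Perm (Fin 2)) ≠ Equiv.swap (0 : Fin 2) 1 := by decide
  have h1 : ∀ (l : Model n →L[ℝ] ℂ) (w : Fin 1 → Model n), oneForm l w = l (w 0) :=
    fun l w => rfl
  rw [gradForm, ContinuousAlternatingMap.smul_apply, wedge_apply, hu, Finset.sum_pair hne]
  have hc : (Fin.castAdd 1 (0 : Fin 1) : Fin (1 + 1)) = (0 : Fin 2) := rfl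
  have hn : (Fin.natAdd 1 (0 : Fin 1) : Fin (1 + 1)) = (1 : Fin 2) := rfl
  have hs : Equiv.Perm.sign (Equiv.swap (0 : Fin 2) 1) = -1 := Equiv.Perm.sign_swap (by decide)
  simp only [h1, hc, hn, part01_apply, ← lin10_apply, Equiv.Perm.sign_one, Equiv.Perm.one_apply,
    hs, Equiv.swap_apply_left, Equiv.swap_apply_right]
  simp
  ring

theorem isOfType_gradForm (α : Model n →L[ℝ] ℝ) : IsOfType 1 1 (gradForm α) := by
  intro u v
  simp only [gradForm_apply, map_smul, smul_eq_mul, map_mul]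
  ring

/-- The Cauchy–Schwarz identity behind `i ∂(φ+ψ) ∧ ∂̄(φ+ψ) ≤ (1+s) i ∂φ∧∂̄φ + (1+1/s) i ∂ψ∧∂̄ψ`,
where `s = r²`. -/
theorem gradForm_add_add (α β : Model n →L[ℝ] ℝ) {r : ℝ} (hr : r ≠ 0) :
    gradForm (r • α + (-r⁻¹) • β) + gradForm (α + β) =
      (1 + r ^ 2) • gradForm α + (1 + (r ^ 2)⁻¹) • gradForm β := by
  have hr' : (r : ℂ) ≠ 0 := by exact_mod_cast hr
  ext v
  simp only [ContinuousAlternatingMap.add_apply, ContinuousAlternatingMap.smul_apply,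
    gradForm_apply, lin10_add, lin10_smul, map_add, map_mul, Complex.conj_ofReal,
    Complex.real_smul]
  push_cast
  field_simp
  ring

theorem gradForm_smul (c : ℝ) (α : Model n →L[ℝ] ℝ) :
    gradForm (c • α) = (c ^ 2) • gradForm α := by
  ext v
  simp only [ContinuousAlternatingMap.smul_apply,
    gradForm_apply, lin10_smul, map_mul, Complex.conj_ofReal, Complex.real_smul]
  push_cast
  ring

theorem gradForm_apply_self (α : Model n →L[ℝ] ℝ) (v : Model n) :
    gradForm α ![v, Complex.I • v] = ((2 * Complex.normSq (lin10 α v) : ℝ) : ℂ) := by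
  rw [gradForm_apply]
  simp only [Matrix.cons_val_zero, Matrix.cons_val_one, map_smul, smul_eq_mul, map_mul,
    Complex.conj_I]
  push_cast
  rw [Complex.normSq_eq_conj_mul_self]
  linear_combination (-2 * lin10 α v * starRingEnd ℂ (lin10 α v)) * Complex.I_sq

theorem gradForm_eq_zero_of_left (α : Model n →L[ℝ] ℝ) {u : Model n} (hu : lin10 α u = 0)
    (w : Model n) : gradForm α ![u, w] = 0 ∧ gradForm α ![Complex.I • u, w] = 0 := by
  simp [gradForm_apply, hu]

theorem lin10_compContinuousLinearMap (α : Model n →L[ℝ] ℝ) (A : Model n →L[ℝ] Model n)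
    (hA : ∀ v, A (Complex.I • v) = Complex.I • A v) (v : Model n) :
    lin10 (α.comp A) v = lin10 α (A v) := by
  simp [lin10_apply, part10_apply, hA]

theorem gradForm_compContinuousLinearMap (α : Model n →L[ℝ] ℝ) (A : Model n →L[ℝ] Model n)
    (hA : ∀ v, A (Complex.I • v) = Complex.I • A v) :
    (gradForm α).compContinuousLinearMap A = gradForm (α.comp A) := by
  ext v
  simp [gradForm_apply, lin10_compContinuousLinearMap α A hA]

end GradForm

/-! ### Positive forms -/

section Positive

variable {n m : ℕ}

theorem IsPositiveForm.add {f g : Alt n (2 * m)} (hf : IsPositiveForm f) (hg : IsPositiveForm g) :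
    IsPositiveForm (f + g) :=
  ⟨hf.1.add hg.1, fun v => by
    rw [ContinuousAlternatingMap.add_apply]; exact add_nonneg (hf.2 v) (hg.2 v)⟩

theorem isPositiveForm_zero : IsPositiveForm (0 : Alt n (2 * m)) :=
  ⟨isOfType_zero _ _, fun v => by simp⟩

theorem IsPositiveForm.smul {f : Alt n (2 * m)} (hf : IsPositiveForm f) {c : ℂ} (hc : 0 ≤ c) :
    IsPositiveForm (c • f) :=
  ⟨hf.1.smul c, fun v => by
    rw [ContinuousAlternatingMap.smul_apply, smul_eq_mul]; exact mul_nonneg hc (hf.2 v)⟩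

/-- Positivity is preserved by exterior multiplication with `i α^{1,0} ∧ α^{0,1}`: on a complex
subspace, choose a basis all of whose vectors but one lie in the kernel of `α^{1,0}`. -/
theorem IsPositiveForm.wedge_gradForm {f : Alt n (2 * m)} (hf : IsPositiveForm f)
    (α : Model n →L[ℝ] ℝ) : IsPositiveForm (m := m + 1) (wedge f (gradForm α)) := by
  refine ⟨hf.1.wedge (isOfType_gradForm α), fun v => ?_⟩
  by_cases hv : ∀ i, lin10 α (v i) = 0
  · have h := wedge_interleave_last f (gradForm α) v
      (fun i u => gradForm_eq_zero_of_left α (hv _) u)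
    rw [gradForm_apply_self, hv] at h
    rw [h]; simp
  · push Not at hv
    obtain ⟨j, hj⟩ := hv
    let c : Fin (m + 1) → ℂ := fun i => if i = j then 0 else lin10 α (v i) / lin10 α (v j)
    let w : Fin (m + 1) → Model n := fun i => v i - c i • v j
    have hwj : w j = v j := by simp [w, c]
    have hw : ∀ i, i ≠ j → lin10 α (w i) = 0 := by
      intro i hi
      simp only [w, c, if_neg hi, map_sub, map_smul, smul_eq_mul]
      field_simp
      ring
    let A : Matrix (Fin (m + 1)) (Fin (m + 1)) ℂ := fun i k =>
      (if i = k then 1 else 0) + (if k = j then c i else 0)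
    have hA : (fun i => ∑ k, A i k • w k) = v := by
      funext i
      simp only [A, add_smul, Finset.sum_add_distrib, ite_smul, one_smul, zero_smul]
      rw [Finset.sum_ite_eq, Finset.sum_ite_eq']
      simp only [Finset.mem_univ, if_true, hwj]
      simp [w]
    have h1 := map_interleave_matrix (m := m + 1) (wedge f (gradForm α)) A w
    rw [hA] at h1
    rw [h1]
    refine mul_nonneg (by exact_mod_cast Complex.normSq_nonneg _) ?_
    rw [← map_interleave_comp_perm (m := m + 1) (wedge f (gradForm α))
      (Equiv.swap j (Fin.last m)) w]
    have h2 := wedge_interleave_last f (gradForm α) (w ∘ Equiv.swap j (Fin.last m))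
      (fun i u => gradForm_eq_zero_of_left α (hw _ ?_) u)
    · rw [h2, gradForm_apply_self]
      refine mul_nonneg (hf.2 _) ?_
      have := Complex.normSq_nonneg
      exact_mod_cast mul_nonneg zero_le_two (this _)
    · intro h
      have h3 := (Equiv.swap j (Fin.last m)).injective (h.trans (Equiv.swap_apply_right _ _).symm)
      exact (Fin.castSucc_lt_last i).ne h3

end Positive

/-! ### Linear algebra of a positive definite `(1,1)`-form -/

section Hermitian

variable {n m : ℕ}

/-- A positive definite form of type `(1,1)` on `ℂᵏ`: the value of a Kähler form at a point. -/
structure IsMetricForm (β : Alt n 2) : Prop where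
  type11 : IsOfType 1 1 β
  pos : ∀ v : Model n, v ≠ 0 → 0 < β ![v, Complex.I • v]

/-- The squared length `β(v, iv)` of a vector. -/
def sqLen (β : Alt n 2) (v : Model n) : ℝ := (β ![v, Complex.I • v]).re

/-- The dual norm of a covector with respect to `β`. -/
def dualNorm (β : Alt n 2) (a : Model n →L[ℝ] ℝ) : ℝ≥0∞ :=
  ⨆ (v : Model n) (_ : sqLen β v ≤ 1), ‖a v‖ₑ

/-- The Hermitian inner product `β(u, iv) + i β(u, v)`, conjugate linear in `u`. -/
def herm (β : Alt n 2) (u v : Model n) : ℂ := β ![u, Complex.I • v] + Complex.I * β ![u, v]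

theorem pair_add_left (β : Alt n 2) (u u' v : Model n) :
    β ![u + u', v] = β ![u, v] + β ![u', v] := β.vecCons_add ![v] u u'

theorem pair_smul_left (β : Alt n 2) (c : ℝ) (u v : Model n) :
    β ![c • u, v] = c * β ![u, v] := by
  have := β.vecCons_smul ![v] c u
  simpa using this

theorem pair_swap (β : Alt n 2) (u v : Model n) : β ![u, v] = - β ![v, u] := by
  have := β.toAlternatingMap.map_swap ![v, u] (i := 0) (j := 1) (by decide)
  have e : (![v, u] ∘ Equiv.swap (0 : Fin 2) 1 : Fin 2 → Model n) = ![u, v] := by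
    funext k; fin_cases k <;> simp
  rw [e] at this
  exact this

theorem pair_neg_left (β : Alt n 2) (u v : Model n) : β ![-u, v] = - β ![u, v] := by
  have := pair_smul_left β (-1) u v
  simpa using this


namespace IsMetricForm

variable {β : Alt n 2}

theorem pair_I_I (hβ : IsMetricForm β) (u v : Model n) :
    β ![Complex.I • u, Complex.I • v] = β ![u, v] := by
  have h := hβ.type11 Complex.I ![u, v]
  have e : (fun i => Complex.I • (![u, v] : Fin 2 → Model n) i) =
      ![Complex.I • u, Complex.I • v] := by
    funext k; fin_cases k <;> rfl
  rw [e] at h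
  simpa using h

theorem I_smul_I_smul (u : Model n) : Complex.I • Complex.I • u = -u := by
  rw [smul_smul, Complex.I_mul_I, neg_one_smul]

theorem pair_I_left (hβ : IsMetricForm β) (u v : Model n) :
    β ![Complex.I • u, v] = - β ![u, Complex.I • v] := by
  rw [← hβ.pair_I_I (Complex.I • u) v, I_smul_I_smul, pair_neg_left]

theorem pair_I_symm (hβ : IsMetricForm β) (u v : Model n) :
    β ![u, Complex.I • v] = β ![v, Complex.I • u] := by
  rw [pair_swap, hβ.pair_I_left, neg_neg]

theorem self_im (hβ : IsMetricForm β) (u : Model n) : (β ![u, Complex.I • u]).im = 0 := by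
  by_cases hu : u = 0
  · have : β ![u, Complex.I • u] = 0 := by
      have := pair_smul_left β 0 u (Complex.I • u)
      simpa [hu] using this
    rw [this]; rfl
  · exact ((Complex.lt_def.1 (hβ.pos u hu)).2).symm

theorem self_eq (hβ : IsMetricForm β) (u : Model n) :
    β ![u, Complex.I • u] = (sqLen β u : ℂ) :=
  Complex.ext rfl (by rw [hβ.self_im, Complex.ofReal_im])

theorem pair_I_im (hβ : IsMetricForm β) (u v : Model n) : (β ![u, Complex.I • v]).im = 0 := by
  have h := hβ.self_im (u + v)
  rw [smul_add, pair_add_left, pair_swap, pair_swap _ v, pair_add_left, pair_add_left, neg_add,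
    neg_add, ← pair_swap, ← pair_swap, ← pair_swap, ← pair_swap] at h
  rw [hβ.pair_I_symm v u] at h
  simp only [Complex.add_im, hβ.self_im u, hβ.self_im v] at h
  linarith

theorem pair_im (hβ : IsMetricForm β) (u v : Model n) : (β ![u, v]).im = 0 := by
  have h := hβ.pair_I_im u (-(Complex.I • v))
  rwa [smul_neg, I_smul_I_smul, neg_neg] at h

theorem herm_re (hβ : IsMetricForm β) (u v : Model n) :
    (herm β u v).re = (β ![u, Complex.I • v]).re := by
  simp [herm, hβ.pair_im]

theorem herm_im (hβ : IsMetricForm β) (u v : Model n) :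
    (herm β u v).im = (β ![u, v]).re := by
  simp [herm, hβ.pair_I_im]

theorem herm_self (hβ : IsMetricForm β) (u : Model n) : herm β u u = (sqLen β u : ℂ) := by
  refine Complex.ext (hβ.herm_re u u) ?_
  rw [hβ.herm_im, Complex.ofReal_im]
  have h := pair_swap β u u
  have : β ![u, u] = 0 := by linear_combination (1 / 2 : ℂ) * h
  rw [this]; rfl

theorem sqLen_pos (hβ : IsMetricForm β) {u : Model n} (hu : u ≠ 0) : 0 < sqLen β u :=
  (Complex.lt_def.1 (hβ.pos u hu)).1

theorem sqLen_nonneg (hβ : IsMetricForm β) (u : Model n) : 0 ≤ sqLen β u := by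
  by_cases hu : u = 0
  · have := pair_smul_left β 0 u (Complex.I • u)
    have h0 : β ![u, Complex.I • u] = 0 := by simpa [hu] using this
    rw [sqLen, h0]; rfl
  · exact (hβ.sqLen_pos hu).le

/-- The Hermitian inner product attached to a metric form. -/
abbrev core (hβ : IsMetricForm β) : InnerProductSpace.Core ℂ (Model n) where
  inner := herm β
  conj_inner_symm u v := by
    refine Complex.ext ?_ ?_
    · rw [Complex.conj_re, hβ.herm_re, hβ.herm_re, hβ.pair_I_symm]
    · rw [Complex.conj_im, hβ.herm_im, hβ.herm_im, pair_swap, Complex.neg_re, neg_neg]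
  re_inner_nonneg u := by
    rw [hβ.herm_self]
    exact hβ.sqLen_nonneg u
  add_left u v w := by
    simp only [herm, pair_add_left]; ring
  smul_left u v c := by
    have h1 : c • u = c.re • u + c.im • (Complex.I • u) := by
      conv_lhs => rw [← Complex.re_add_im c, add_smul, mul_smul]
      rfl
    have h2 : β ![Complex.I • u, Complex.I • v] = β ![u, v] := hβ.pair_I_I u v
    simp only [herm]
    rw [h1]
    simp only [pair_add_left, pair_smul_left, h2, hβ.pair_I_left u v]
    conv_rhs => rw [← Complex.re_add_im c]
    simp only [map_add, map_mul, Complex.conj_ofReal, Complex.conj_I]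
    linear_combination (c.im * β ![u, v]) * Complex.I_sq
  definite u hu := by
    by_contra hne
    change herm β u u = 0 at hu
    rw [hβ.herm_self] at hu
    have h1 := hβ.sqLen_pos hne
    exact h1.ne' (by exact_mod_cast hu)

end IsMetricForm

/-- Families of vectors that are orthonormal for the Hermitian inner product of `β`. -/
def HermOrthonormal (β : Alt n 2) (v : Fin m → Model n) : Prop :=
  ∀ a b, herm β (v a) (v b) = if a = b then 1 else 0

/-- The Hermitian inner product with a fixed vector, as a linear form. -/
def hermL {β : Alt n 2} (hβ : IsMetricForm β) (v : Model n) : Model n →ₗ[ℂ] ℂ where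
  toFun := herm β v
  map_add' u w := by
    have h : ∀ a b, starRingEnd ℂ (herm β b a) = herm β a b := hβ.core.conj_inner_symm
    rw [← h v (u + w), ← h v u, ← h v w, ← map_add]
    exact congrArg _ (hβ.core.add_left u w v)
  map_smul' c u := by
    have h : ∀ a b, starRingEnd ℂ (herm β b a) = herm β a b := hβ.core.conj_inner_symm
    have h2 : herm β (c • u) v = starRingEnd ℂ c * herm β u v := hβ.core.smul_left u v c
    rw [← h v (c • u), h2, map_mul, Complex.conj_conj, h]
    rfl

/-- The real covector `2 Re l` of a complex linear form `l`; its `(1,0)`-part is `l`. -/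
def twiceRe (l : Model n →ₗ[ℂ] ℂ) : Model n →L[ℝ] ℝ :=
  LinearMap.toContinuousLinearMap ((2 : ℝ) • (Complex.reLm ∘ₗ l.restrictScalars ℝ))

theorem lin10_twiceRe (l : Model n →ₗ[ℂ] ℂ) (v : Model n) : lin10 (twiceRe l) v = l v := by
  have h : ∀ u, twiceRe l u = 2 * (l u).re := fun u => rfl
  rw [lin10_apply, part10_apply, h, h, map_smul, smul_eq_mul]
  refine Complex.ext ?_ ?_ <;> simp

theorem pair_eq_sum_gradForm {β : Alt n 2} (hβ : IsMetricForm β) {v : Fin m → Model n}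
    {u w : Model n} (hu : ∑ a, herm β (v a) u • v a = u) :
    β ![u, w] = ∑ a, ((1 / 2 : ℝ) • gradForm (twiceRe (hermL hβ (v a)))) ![u, w] := by
  have h1 : herm β u w = ∑ a, starRingEnd ℂ (herm β (v a) u) * herm β (v a) w := by
    have hc : ∀ a b, starRingEnd ℂ (herm β b a) = herm β a b := hβ.core.conj_inner_symm
    calc herm β u w = starRingEnd ℂ (hermL hβ w u) := (hc u w).symm
      _ = starRingEnd ℂ (hermL hβ w (∑ a, herm β (v a) u • v a)) := by rw [hu]
      _ = _ := by
        rw [map_sum, map_sum]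
        refine Finset.sum_congr rfl fun a _ => ?_
        rw [map_smul, smul_eq_mul, map_mul]
        exact congrArg _ (hc (v a) w)
  have h2 : β ![u, w] = Complex.I / 2 * (starRingEnd ℂ (herm β u w) - herm β u w) := by
    refine Complex.ext ?_ ?_
    · simp [hβ.herm_im]
      ring
    · simp [hβ.herm_im, hβ.pair_im]
  rw [h2, h1, map_sum, ← Finset.sum_sub_distrib, Finset.mul_sum]
  refine Finset.sum_congr rfl fun a _ => ?_
  rw [ContinuousAlternatingMap.smul_apply, gradForm_apply, lin10_twiceRe, lin10_twiceRe]
  change _ = (1 / 2 : ℝ) • (Complex.I * (herm β (v a) u * starRingEnd ℂ (herm β (v a) w) -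
    herm β (v a) w * starRingEnd ℂ (herm β (v a) u)))
  rw [Complex.real_smul, map_mul, Complex.conj_conj]
  push_cast
  ring

theorem HermOrthonormal.sum_smul {β : Alt n 2} (hβ : IsMetricForm β) {v : Fin m → Model n}
    (hv : HermOrthonormal β v) (c : ℂ) (b : Fin m) :
    ∑ a, herm β (v a) (c • v b) • v a = c • v b := by
  have : ∀ a, herm β (v a) (c • v b) = if a = b then c else 0 := by
    intro a
    have := (hermL hβ (v a)).map_smul c (v b)
    change herm β (v a) (c • v b) = c • herm β (v a) (v b) at this
    rw [this, hv a b]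
    split_ifs <;> simp
  simp [this]

/-- The value of `βᵐ` on the complex frame of an orthonormal family is `m!`. -/
theorem wedgePow_interleave {β : Alt n 2} (hβ : IsMetricForm β) :
    ∀ (m : ℕ) (v : Fin m → Model n), HermOrthonormal β v →
      wedgePow β m (interleave v) = m.factorial := by
  intro m
  induction m with
  | zero => intro v _; simp [wedgePow]
  | succ m ih =>
    intro v hv
    let γ : Fin (m + 1) → Alt n 2 := fun a => (1 / 2 : ℝ) • gradForm (twiceRe (hermL hβ (v a)))
    have h1 : wedgePow β (m + 1) (interleave v) =
        wedge (wedgePow β m) (∑ a, γ a) (interleave v : Fin (2 * m + 2) → Model n) := by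
      change wedge (wedgePow β m) β (interleave v : Fin (2 * m + 2) → Model n) = _
      rw [wedge_apply, wedge_apply]
      congr 1
      refine Finset.sum_congr rfl fun σ _ => ?_
      congr 2
      generalize σ (Fin.natAdd (2 * m) 0) = i0
      generalize hw : (fun j => (interleave v : Fin (2 * m + 2) → Model n)
        (σ (Fin.natAdd (2 * m) j))) = w
      have e : w = ![w 0, w 1] := by funext k; fin_cases k <;> rfl
      have hu : ∑ a, herm β (v a) (w 0) • v a = w 0 := by
        rw [← hw]
        simp only [interleave]
        split_ifs
        · simpa using hv.sum_smul hβ 1 _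
        · exact hv.sum_smul hβ _ _
      rw [e, pair_eq_sum_gradForm hβ hu, ContinuousAlternatingMap.sum_apply]
    rw [h1, wedge_sum_right, ContinuousAlternatingMap.sum_apply]
    have h2 : ∀ a, wedge (wedgePow β m) (γ a) (interleave v : Fin (2 * m + 2) → Model n) =
        m.factorial := by
      intro a
      have h3 := map_interleave_comp_perm (m := m + 1) (wedge (wedgePow β m) (γ a))
        (Equiv.swap a (Fin.last m)) v
      refine h3.symm.trans ?_
      have hne : ∀ i : Fin m, a ≠ Equiv.swap a (Fin.last m) i.castSucc := by
        intro i h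
        have h3 := (Equiv.swap a (Fin.last m)).injective
          (h.symm.trans (Equiv.swap_apply_right _ _).symm)
        exact (Fin.castSucc_lt_last i).ne h3
      have hl : ∀ b, lin10 (twiceRe (hermL hβ (v a))) (v b) = if a = b then 1 else 0 := by
        intro b; rw [lin10_twiceRe]; exact hv a b
      have h4 := wedge_interleave_last (wedgePow β m) (γ a)
        (v ∘ Equiv.swap a (Fin.last m)) (fun i u => ?_)
      · refine h4.trans ?_
        rw [ih]
        · simp only [γ, ContinuousAlternatingMap.smul_apply]
          rw [gradForm_apply_self, Function.comp_apply, Equiv.swap_apply_right, hl]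
          simp
        · intro b c
          simp only [Function.comp_apply]
          rw [hv]
          simp
      · have h5 : lin10 (twiceRe (hermL hβ (v a)))
            ((v ∘ Equiv.swap a (Fin.last m)) i.castSucc) = 0 := by
          rw [Function.comp_apply, hl, if_neg (hne i)]
        obtain ⟨h6, h7⟩ := gradForm_eq_zero_of_left (twiceRe (hermL hβ (v a))) h5 u
        simp only [γ, ContinuousAlternatingMap.smul_apply]
        rw [h6, h7]
        simp
    rw [Finset.sum_congr rfl fun a _ => h2 a]
    simp [Nat.factorial_succ]

/-- A metric form is a sum of forms `i α^{1,0} ∧ α^{0,1}`. -/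
theorem exists_eq_sum_gradForm {β : Alt n 2} (hβ : IsMetricForm β) :
    ∃ α : Fin (n + 1) → Model n →L[ℝ] ℝ, β = ∑ a, (1 / 2 : ℝ) • gradForm (α a) := by
  obtain ⟨v, -, -, h⟩ := exists_orthonormal_adapted hβ.core 0 n (by simp [Model])
  refine ⟨fun a => twiceRe (hermL hβ (v a)), ?_⟩
  ext w
  have e : w = ![w 0, w 1] := by funext k; fin_cases k <;> rfl
  rw [e, ContinuousAlternatingMap.sum_apply]
  exact pair_eq_sum_gradForm hβ (h _)

theorem ofReal_smul {p : ℕ} (c : ℝ) (f : Alt n p) : (c : ℂ) • f = c • f := by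
  ext v
  rw [ContinuousAlternatingMap.smul_apply, ContinuousAlternatingMap.smul_apply, Complex.real_smul,
    smul_eq_mul]

theorem isPositiveForm_wedgePow {β : Alt n 2} (hβ : IsMetricForm β) (m : ℕ) :
    IsPositiveForm (wedgePow β m) := by
  induction m with
  | zero =>
    refine ⟨fun u v => by simp [wedgePow], fun v => by simp [wedgePow]⟩
  | succ m ih =>
    obtain ⟨α, hα⟩ := exists_eq_sum_gradForm hβ
    have h : wedgePow β (m + 1) = ∑ a, (1 / 2 : ℝ) • wedge (wedgePow β m) (gradForm (α a)) := by
      refine (congrArg (wedge (wedgePow β m)) hα).trans ?_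
      rw [wedge_sum_right]
      exact Finset.sum_congr rfl fun a _ => wedge_real_smul_right _ _ _
    rw [h]
    refine Finset.sum_induction _ (fun f : Alt n (2 * (m + 1)) => IsPositiveForm (m := m + 1) f)
      (fun f g hf hg => hf.add hg) isPositiveForm_zero fun a _ => ?_
    have := (ih.wedge_gradForm (α a)).smul (c := ((1 / 2 : ℝ) : ℂ))
      (by exact_mod_cast (by norm_num : (0 : ℝ) ≤ 1 / 2))
    rwa [ofReal_smul] at this

/-- The quotient of a form of top degree by the volume form `βᵏ`, computed on the frame of an
orthonormal basis. -/
theorem div_wedgePow_stdFrame {β : Alt n 2} (hβ : IsMetricForm β) (f : Alt n (2 * (n + 1)))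
    (v : Fin (n + 1) → Model n) (hv : HermOrthonormal β v) :
    wedgePow β (n + 1) (stdFrame n) ≠ 0 ∧
    f (stdFrame n) / wedgePow β (n + 1) (stdFrame n) =
      f (interleave v) / (n + 1).factorial := by
  let A : Matrix (Fin (n + 1)) (Fin (n + 1)) ℂ := fun i j => v i j
  have hA : (fun i => ∑ j, A i j • (EuclideanSpace.single j (1 : ℂ) : Model n)) = v := by
    funext i
    ext k
    simp [A, Pi.single_apply]
  have h1 : ∀ g : Alt n (2 * (n + 1)), g (interleave v) =
      (Complex.normSq A.det : ℂ) * g (stdFrame n) := by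
    intro g
    have := map_interleave_matrix g A (fun j => EuclideanSpace.single j (1 : ℂ))
    rwa [hA] at this
  have h2 := wedgePow_interleave hβ (n + 1) v hv
  have h3 : ((n + 1).factorial : ℂ) ≠ 0 := by exact_mod_cast (n + 1).factorial_ne_zero
  have h4 := h1 (wedgePow β (n + 1))
  rw [h2] at h4
  have h5 : (Complex.normSq A.det : ℂ) ≠ 0 := by
    intro h; rw [h, zero_mul] at h4; exact h3 h4
  have h6 : wedgePow β (n + 1) (stdFrame n) ≠ 0 := by
    intro h; rw [h, mul_zero] at h4; exact h3 h4
  refine ⟨h6, ?_⟩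
  rw [h4, h1 f, mul_div_mul_left _ _ h5]

theorem exists_hermOrthonormal {β : Alt n 2} (hβ : IsMetricForm β) :
    ∃ v : Fin (n + 1) → Model n, HermOrthonormal β v := by
  obtain ⟨v, h, -, -⟩ := exists_orthonormal_adapted hβ.core 0 n (by simp [Model])
  exact ⟨v, h⟩

theorem wedgePow_stdFrame_pos {β : Alt n 2} (hβ : IsMetricForm β) :
    0 < wedgePow β (n + 1) (stdFrame n) := by
  obtain ⟨v, hv⟩ := exists_hermOrthonormal hβ
  exact lt_of_le_of_ne ((isPositiveForm_wedgePow hβ (n + 1)).2 _)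
    (div_wedgePow_stdFrame hβ 0 v hv).1.symm

theorem HermOrthonormal.sqLen_eq {β : Alt n 2} (hβ : IsMetricForm β) {v : Fin m → Model n}
    (hv : HermOrthonormal β v) (j : Fin (2 * m)) : sqLen β (interleave v j) = 1 := by
  have h : ∀ a, sqLen β (v a) = 1 := by
    intro a
    have := hv a a
    rw [hβ.herm_self, if_pos rfl] at this
    exact_mod_cast this
  unfold interleave
  split_ifs
  · exact h _
  · rw [sqLen, hβ.pair_I_I]
    exact h _

/-- The squared dual norm of a covector is `2 k` times the quotient of
`β^{k-1} ∧ i α^{1,0} ∧ α^{0,1}` by the volume form `βᵏ`. -/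
theorem dualNorm_sq {β : Alt n 2} (hβ : IsMetricForm β) (α : Model n →L[ℝ] ℝ) :
    dualNorm β α ^ 2 = ENNReal.ofReal (2 * (n + 1) *
      ((wedge (wedgePow β n) (gradForm α) : Alt n (2 * (n + 1))) (stdFrame n) /
        wedgePow β (n + 1) (stdFrame n)).re) := by
  obtain ⟨v, hv, hl, hspan⟩ := exists_orthonormal_adapted hβ.core (lin10 α) n (by simp [Model])
  have hv' : HermOrthonormal β v := hv
  have h1 := (div_wedgePow_stdFrame hβ (wedge (wedgePow β n) (gradForm α)) v hv').2
  have h2 := wedge_interleave_last (wedgePow β n) (gradForm α) v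
    (fun i u => gradForm_eq_zero_of_left α (hl i) u)
  have h3 := wedgePow_interleave hβ n (fun j => v j.castSucc) (fun a b => by simp [hv' _ _])
  rw [h1, h2, h3, gradForm_apply_self]
  set z := lin10 α (v (Fin.last n)) with hz
  have h4 : ((n.factorial : ℂ) * ((2 * Complex.normSq z : ℝ) : ℂ) / ((n + 1).factorial : ℂ)) =
      ((2 * Complex.normSq z / (n + 1) : ℝ) : ℂ) := by
    have h5 : (n.factorial : ℂ) ≠ 0 := by exact_mod_cast n.factorial_ne_zero
    have h6 : (n : ℂ) + 1 ≠ 0 := by exact_mod_cast n.succ_ne_zero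
    rw [Nat.factorial_succ]
    push_cast
    field_simp
  rw [h4, Complex.ofReal_re]
  have h7 : 2 * ((n : ℝ) + 1) * (2 * Complex.normSq z / (n + 1)) = (2 * ‖z‖) ^ 2 := by
    rw [Complex.normSq_eq_norm_sq]
    have : (n : ℝ) + 1 ≠ 0 := by positivity
    field_simp
  rw [h7]
  have hα : ∀ u, α u = 2 * (herm β (v (Fin.last n)) u * z).re := by
    intro u
    rw [covector_apply]
    congr 2
    conv_lhs => rw [← hspan u]
    rw [map_sum, Fin.sum_univ_castSucc]
    simp only [map_smul, hl, smul_zero, Finset.sum_const_zero, zero_add]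
    rfl
  have hD : dualNorm β α = ENNReal.ofReal (2 * ‖z‖) := by
    refine le_antisymm (iSup₂_le fun u hu => ?_) ?_
    · rw [← ofReal_norm]
      refine ENNReal.ofReal_le_ofReal ?_
      have hb : Complex.normSq (herm β (v (Fin.last n)) u) ≤ 1 := by
        have h8 : herm β u u = ∑ a, starRingEnd ℂ (herm β (v a) u) * herm β (v a) u := by
          have hc : ∀ a b, starRingEnd ℂ (herm β b a) = herm β a b := hβ.core.conj_inner_symm
          calc herm β u u = hermL hβ u u := rfl
            _ = hermL hβ u (∑ a, herm β (v a) u • v a) := by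
              congr 1; exact (hspan u).symm
            _ = _ := by
              rw [map_sum]
              refine Finset.sum_congr rfl fun a _ => ?_
              rw [map_smul, smul_eq_mul, mul_comm]
              exact congrArg (· * _) (hc u (v a)).symm
        rw [hβ.herm_self] at h8
        have h9 : sqLen β u = ∑ a, Complex.normSq (herm β (v a) u) := by
          apply Complex.ofReal_injective
          rw [h8]
          push_cast
          exact Finset.sum_congr rfl fun a _ => Complex.normSq_eq_conj_mul_self.symm
        calc _ ≤ ∑ a, Complex.normSq (herm β (v a) u) :=
              Finset.single_le_sum (f := fun a => Complex.normSq (herm β (v a) u))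
                (fun a _ => Complex.normSq_nonneg _) (Finset.mem_univ (Fin.last n))
          _ ≤ 1 := h9 ▸ hu
      have hb' : ‖herm β (v (Fin.last n)) u‖ ≤ 1 := by
        rw [Complex.normSq_eq_norm_sq] at hb
        nlinarith [norm_nonneg (herm β (v (Fin.last n)) u)]
      rw [hα, Real.norm_eq_abs, abs_mul, abs_two]
      refine mul_le_mul_of_nonneg_left ?_ zero_le_two
      refine (Complex.abs_re_le_norm _).trans ?_
      rw [norm_mul]
      exact mul_le_of_le_one_left (norm_nonneg _) hb'
    · by_cases hz0 : z = 0
      · simp [hz0]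
      -- The extremal vector is the last basis vector, rotated so that `α^{1,0}` is positive on it.
      let c : ℂ := starRingEnd ℂ z / ‖z‖
      have hn0 : (‖z‖ : ℂ) ≠ 0 := by simpa using hz0
      have hcc : starRingEnd ℂ c * c = 1 := by
        simp only [c, map_div₀, Complex.conj_conj, Complex.conj_ofReal]
        rw [div_mul_div_comm, Complex.mul_conj, Complex.normSq_eq_norm_sq]
        push_cast
        field_simp
      have hlen : sqLen β (c • v (Fin.last n)) ≤ 1 := by
        have h8 : herm β (c • v (Fin.last n)) (c • v (Fin.last n)) =
            starRingEnd ℂ c * (c * herm β (v (Fin.last n)) (v (Fin.last n))) := by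
          have e1 : herm β (c • v (Fin.last n)) (c • v (Fin.last n)) = _ :=
            hβ.core.smul_left (v (Fin.last n)) (c • v (Fin.last n)) c
          rw [e1]
          congr 1
          exact (hermL hβ (v (Fin.last n))).map_smul c (v (Fin.last n))
        rw [hβ.herm_self, hv', if_pos rfl, mul_one, hcc] at h8
        exact le_of_eq (by exact_mod_cast h8)
      have hval : α (c • v (Fin.last n)) = 2 * ‖z‖ := by
        rw [covector_apply, map_smul, smul_eq_mul, ← hz]
        congr 1
        have : c * z = (‖z‖ : ℂ) := by
          simp only [c]
          rw [div_mul_eq_mul_div, mul_comm, Complex.mul_conj, Complex.normSq_eq_norm_sq]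
          push_cast
          field_simp
        rw [this, Complex.ofReal_re]
      calc ENNReal.ofReal (2 * ‖z‖) = ‖α (c • v (Fin.last n))‖ₑ := by
            rw [hval, ← ofReal_norm, Real.norm_of_nonneg (by positivity)]
        _ ≤ _ := le_iSup₂ (f := fun u (_ : sqLen β u ≤ 1) => ‖α u‖ₑ) _ hlen
  rw [hD, ENNReal.ofReal_pow (by positivity)]

theorem dualNorm_lt_top {β : Alt n 2} (hβ : IsMetricForm β) (α : Model n →L[ℝ] ℝ) :
    dualNorm β α < ⊤ := by
  have h := dualNorm_sq hβ α
  by_contra hcon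
  rw [not_lt, top_le_iff] at hcon
  rw [hcon] at h
  simp at h

theorem dualNorm_add_le (β : Alt n 2) (a b : Model n →L[ℝ] ℝ) :
    dualNorm β (a + b) ≤ dualNorm β a + dualNorm β b := by
  refine iSup₂_le fun v hv => (enorm_add_le (a v) (b v)).trans (add_le_add ?_ ?_)
  · exact le_iSup₂ (f := fun u (_ : sqLen β u ≤ 1) => ‖a u‖ₑ) v hv
  · exact le_iSup₂ (f := fun u (_ : sqLen β u ≤ 1) => ‖b u‖ₑ) v hv

theorem enorm_apply_le_dualNorm {β : Alt n 2} (hβ : IsMetricForm β) (a : Model n →L[ℝ] ℝ)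
    (v : Model n) : ‖a v‖ₑ ≤ ENNReal.ofReal (Real.sqrt (sqLen β v)) * dualNorm β a := by
  by_cases hv : v = 0
  · simp [hv]
  have h1 := hβ.sqLen_pos hv
  set s := Real.sqrt (sqLen β v) with hs
  have hs0 : 0 < s := Real.sqrt_pos.2 h1
  have hlen : sqLen β (s⁻¹ • v) ≤ 1 := by
    have e : Complex.I • (s⁻¹ • v) = s⁻¹ • (Complex.I • v) := smul_comm _ _ _
    rw [sqLen, e, pair_smul_left, pair_swap, pair_smul_left, pair_swap, hβ.self_eq]
    simp only [mul_neg, neg_neg]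
    rw [← Complex.ofReal_mul, ← Complex.ofReal_mul, Complex.ofReal_re]
    have : sqLen β v = s * s := (Real.mul_self_sqrt h1.le).symm
    rw [this]
    field_simp
    exact le_refl _
  have h2 : ‖a (s⁻¹ • v)‖ₑ ≤ dualNorm β a :=
    le_iSup₂ (f := fun u (_ : sqLen β u ≤ 1) => ‖a u‖ₑ) _ hlen
  have h3 : a v = s * a (s⁻¹ • v) := by
    rw [map_smul, smul_eq_mul, mul_inv_cancel_left₀ hs0.ne']
  rw [h3, enorm_mul]
  refine mul_le_mul' (le_of_eq ?_) h2
  rw [← ofReal_norm, Real.norm_of_nonneg hs0.le]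

/-- A form of degree `2m` is bounded on complex frames by `βᵐ`. -/
theorem norm_interleave_le {β : Alt n 2} (hβ : IsMetricForm β) (f : Alt n (2 * m)) {ε : ℝ}
    (hε : 0 ≤ ε) (hf : ∀ w, ‖f w‖ ≤ ε * ∏ i, Real.sqrt (sqLen β (w i))) (v : Fin m → Model n) :
    ‖f (interleave v)‖ ≤ ε * (wedgePow β m (interleave v)).re := by
  by_cases hv : LinearIndependent ℂ v
  · obtain ⟨w, A, hw, rfl⟩ := exists_orthonormal_span hβ.core v hv
    have hw' : HermOrthonormal β w := hw
    rw [map_interleave_matrix, map_interleave_matrix, wedgePow_interleave hβ m w hw', norm_mul,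
      Complex.norm_of_nonneg (Complex.normSq_nonneg _)]
    have h1 : ‖f (interleave w)‖ ≤ ε := by
      refine (hf _).trans (le_of_eq ?_)
      simp [hw'.sqLen_eq hβ]
    have h2 : ((Complex.normSq A.det : ℂ) * (m.factorial : ℂ)).re =
        Complex.normSq A.det * m.factorial := by
      rw [← Complex.ofReal_natCast, ← Complex.ofReal_mul, Complex.ofReal_re]
    rw [h2]
    have h3 : (1 : ℝ) ≤ m.factorial := by exact_mod_cast m.factorial_pos
    calc _ ≤ Complex.normSq A.det * ε := mul_le_mul_of_nonneg_left h1 (Complex.normSq_nonneg _)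
      _ ≤ Complex.normSq A.det * ε * m.factorial :=
        le_mul_of_one_le_right (mul_nonneg (Complex.normSq_nonneg _) hε) h3
      _ = _ := by ring
  · rw [map_interleave_eq_zero f v hv, norm_zero]
    exact mul_nonneg hε (Complex.le_def.1 ((isPositiveForm_wedgePow hβ m).2 v)).1

theorem castDeg_apply {p q : ℕ} (h : p = q) (f : Alt n p) (v : Fin q → Model n) :
    castDeg h f v = f (fun i => v (Fin.cast h i)) := by
  subst h; rfl

/-- The exterior product of a covector with a form of degree `2k - 1` is controlled by the dual
norm. -/
theorem norm_wedge_oneForm_div_le {β : Alt n 2} (hβ : IsMetricForm β) (α : Model n →L[ℝ] ℝ)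
    (f : Alt n (2 * n + 1)) (h : 1 + (2 * n + 1) = 2 * (n + 1)) {ε : ℝ} (hε : 0 ≤ ε)
    (hf : ∀ w, ‖f w‖ ≤ ε * ∏ i, Real.sqrt (sqLen β (w i))) :
    ‖castDeg h (wedge (oneForm (Complex.ofRealCLM.comp α)) f) (stdFrame n) /
      wedgePow β (n + 1) (stdFrame n)‖ ≤
      (1 + (2 * n + 1)).factorial * ε * (dualNorm β α).toReal := by
  obtain ⟨v, hv⟩ := exists_hermOrthonormal hβ
  rw [(div_wedgePow_stdFrame hβ _ v hv).2, castDeg_apply, wedge_apply, norm_div, norm_mul,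
    Complex.norm_natCast]
  have h3 : (1 : ℝ) ≤ (n + 1).factorial := by exact_mod_cast (n + 1).factorial_pos
  have h4 : ‖(((1).factorial * (2 * n + 1).factorial : ℝ)⁻¹ : ℂ)‖ ≤ 1 := by
    have h5 : (1 : ℝ) ≤ (2 * n + 1).factorial := by exact_mod_cast (2 * n + 1).factorial_pos
    rw [norm_inv]
    refine inv_le_one_of_one_le₀ ?_
    simpa using h5
  have hd : ∀ j, |α (interleave v j)| ≤ (dualNorm β α).toReal := by
    intro j
    have h1 : ‖α (interleave v j)‖ₑ ≤ dualNorm β α :=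
      le_iSup₂ (f := fun u (_ : sqLen β u ≤ 1) => ‖α u‖ₑ) _ (hv.sqLen_eq hβ j).le
    have h2 := ENNReal.toReal_mono (dualNorm_lt_top hβ α).ne h1
    simpa using h2
  refine (div_le_self (by positivity) h3).trans ?_
  refine (mul_le_of_le_one_left (norm_nonneg _) h4).trans ?_
  refine (norm_sum_le _ _).trans ?_
  have h6 : ∀ σ ∈ (Finset.univ : Finset (Equiv.Perm (Fin (1 + (2 * n + 1))))),
      ‖((Equiv.Perm.sign σ : ℤ) : ℂ) *
        (oneForm (Complex.ofRealCLM.comp α)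
          (fun i => interleave v (Fin.cast h (σ (Fin.castAdd (2 * n + 1) i)))) *
          f (fun j => interleave v (Fin.cast h (σ (Fin.natAdd 1 j)))))‖ ≤
        ε * (dualNorm β α).toReal := by
    intro σ _
    have h3 : ‖((Equiv.Perm.sign σ : ℤ) : ℂ)‖ = 1 := by
      rcases Int.units_eq_one_or (Equiv.Perm.sign σ) with h | h <;> simp [h]
    rw [norm_mul, h3, one_mul, norm_mul, mul_comm]
    refine mul_le_mul ?_ ?_ (norm_nonneg _) hε
    · refine (hf _).trans (le_of_eq ?_)
      simp [hv.sqLen_eq hβ]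
    · change ‖((α (interleave v (Fin.cast h (σ (Fin.castAdd (2 * n + 1) 0)))) : ℝ) : ℂ)‖ ≤ _
      rw [Complex.norm_real]
      exact hd _
  refine (Finset.sum_le_sum h6).trans (le_of_eq ?_)
  rw [Finset.sum_const, Finset.card_univ, Fintype.card_perm, Fintype.card_fin, nsmul_eq_mul]
  ring

end Hermitian

/-! ### Decomposition of forms into types -/

section Types

variable {n p : ℕ}

/-- Functions `u ↦ ∑ c_r uʳ ū^{p-r}`: homogeneous polynomials of degree `p` in `u` and `ū`. -/
def IsBihomogeneous (p : ℕ) (g : ℂ → ℂ) : Prop :=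
  ∃ c : ℕ → ℂ, ∀ u, g u = ∑ r ∈ Finset.range (p + 1), c r * (u ^ r * (starRingEnd ℂ u) ^ (p - r))

theorem IsBihomogeneous.linear_mul {g : ℂ → ℂ} (hg : IsBihomogeneous p g) (a b : ℂ) :
    IsBihomogeneous (p + 1) (fun u => (a * u + b * starRingEnd ℂ u) * g u) := by
  obtain ⟨c, hc⟩ := hg
  refine ⟨fun r => a * (if r = 0 then 0 else c (r - 1)) + b * (if r ≤ p then c r else 0),
    fun u => ?_⟩
  simp only [add_mul, Finset.sum_add_distrib]
  congr 1
  · rw [Finset.sum_range_succ', hc, Finset.mul_sum]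
    simp only [if_true, mul_zero, zero_mul, add_zero, Nat.add_eq_zero_iff, one_ne_zero, and_false,
      if_false, Nat.add_sub_cancel, Nat.add_sub_add_right]
    refine Finset.sum_congr rfl fun r _ => ?_
    ring
  · rw [Finset.sum_range_succ, hc, Finset.mul_sum]
    simp only [Nat.not_succ_le_self, if_false, mul_zero, zero_mul, add_zero]
    refine Finset.sum_congr rfl fun r hr => ?_
    have hr' : r ≤ p := Nat.lt_succ_iff.1 (Finset.mem_range.1 hr)
    rw [if_pos hr', Nat.sub_add_comm hr']
    ring

theorem IsBihomogeneous.sum {ι : Type*} (s : Finset ι) (g : ι → ℂ → ℂ) (d : ι → ℂ)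
    (hg : ∀ i ∈ s, IsBihomogeneous p (g i)) :
    IsBihomogeneous p (fun u => ∑ i ∈ s, g i u * d i) := by
  choose! c hc using hg
  refine ⟨fun r => ∑ i ∈ s, c i r * d i, fun u => ?_⟩
  simp only [Finset.sum_mul]
  rw [Finset.sum_comm]
  refine Finset.sum_congr rfl fun i hi => ?_
  rw [hc i hi, Finset.sum_mul]
  refine Finset.sum_congr rfl fun r _ => ?_
  ring

theorem isBihomogeneous_prod (a b : Fin p → ℂ) :
    IsBihomogeneous p (fun u => ∏ i, (a i * u + b i * starRingEnd ℂ u)) := by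
  induction p with
  | zero => exact ⟨fun _ => 1, fun u => by simp⟩
  | succ p ih =>
    have := (ih (fun i => a i.succ) (fun i => b i.succ)).linear_mul (a 0) (b 0)
    simpa only [Fin.prod_univ_succ] using this

theorem isBihomogeneous_form (f : Alt n p) (v : Fin p → Model n) :
    IsBihomogeneous p (fun u => f (fun i => u • v i)) := by
  classical
  let a : Finset (Fin p) → Fin p → ℂ := fun s i => if i ∈ s then 1 / 2 else -Complex.I / 2
  let b : Finset (Fin p) → Fin p → ℂ := fun s i => if i ∈ s then 1 / 2 else Complex.I / 2
  let w : Finset (Fin p) → Fin p → Model n := fun s =>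
    s.piecewise v (fun i => Complex.I • v i)
  have h := IsBihomogeneous.sum (p := p) (Finset.univ : Finset (Finset (Fin p)))
    (fun s u => ∏ i, (a s i * u + b s i * starRingEnd ℂ u)) (fun s => f (w s))
    (fun s _ => isBihomogeneous_prod (a s) (b s))
  convert h using 2 with u
  have h1 : (fun i => u • v i) = (fun i => u.re • v i) + fun i => u.im • (Complex.I • v i) := by
    funext i
    conv_lhs => rw [← Complex.re_add_im u, add_smul, mul_smul]
    rfl
  rw [h1, f.map_add_univ]
  refine Finset.sum_congr rfl fun s _ => ?_
  have h2 : s.piecewise (fun i => u.re • v i) (fun i => u.im • (Complex.I • v i)) =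
      fun i => (if i ∈ s then u.re else u.im) • w s i := by
    funext i
    by_cases hi : i ∈ s <;> simp [w, hi]
  rw [h2, f.map_smul_univ, Complex.real_smul, Complex.ofReal_prod]
  congr 1
  refine Finset.prod_congr rfl fun i _ => ?_
  by_cases hi : i ∈ s
  · simp only [a, b, hi, if_true]
    rw [Complex.re_eq_add_conj]; ring
  · simp only [a, b, hi, if_false]
    rw [Complex.im_eq_sub_conj]
    field_simp
    linear_combination (u - starRingEnd ℂ u) * Complex.I_sq

/-- The pull-back of a form by multiplication with the complex number `u`. -/
def rot (u : ℂ) (f : Alt n p) : Alt n p :=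
  f.compContinuousLinearMap ((u • ContinuousLinearMap.id ℂ (Model n)).restrictScalars ℝ)

theorem rot_apply (u : ℂ) (f : Alt n p) (v : Fin p → Model n) :
    rot u f v = f (fun i => u • v i) := rfl

/-- The `(2 n + 1)`-st roots of unity, over which forms are averaged. A form of type `(r, 2 n - r)`
is multiplied by `u^{2 (r - n)}` under rotation by `u` with `|u| = 1`; since the order is odd and
larger than `2 n`, these roots of unity separate the exponents `2 (r - n)`, `0 ≤ r ≤ 2 n`. -/
def unityRoot (n : ℕ) (k : ℕ) : ℂ := Complex.exp (2 * Real.pi * Complex.I / (2 * n + 1 : ℕ)) ^ k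

theorem isPrimitiveRoot_unityRoot (n : ℕ) :
    IsPrimitiveRoot (Complex.exp (2 * Real.pi * Complex.I / (2 * n + 1 : ℕ))) (2 * n + 1) :=
  Complex.isPrimitiveRoot_exp _ (by omega)

theorem norm_unityRoot (n k : ℕ) : ‖unityRoot n k‖ = 1 := by
  rw [unityRoot, norm_pow, (isPrimitiveRoot_unityRoot n).norm'_eq_one (by omega), one_pow]

/-- The component of type `(r, s)` of a form of degree `2 n = r + s`, obtained by averaging
`u ↦ u^{-r} ū^{-s} f(u ·)` over the roots of unity of the odd order `2 n + 1`. -/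
def typePart (r s : ℕ) (f : Alt n (2 * n)) : Alt n (2 * n) :=
  ∑ k ∈ Finset.range (2 * n + 1), ((2 * n + 1 : ℂ)⁻¹ *
    (unityRoot n k ^ s * (starRingEnd ℂ (unityRoot n k)) ^ r)) • rot (unityRoot n k) f

theorem sum_unityRoot (n r r' : ℕ) (hr : r ≤ 2 * n) (hr' : r' ≤ 2 * n) :
    ∑ k ∈ Finset.range (2 * n + 1), unityRoot n k ^ (2 * n - r + r') *
      (starRingEnd ℂ (unityRoot n k)) ^ (r + (2 * n - r')) =
      if r = r' then (2 * n + 1 : ℂ) else 0 := by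
  set ζ := Complex.exp (2 * Real.pi * Complex.I / (2 * n + 1 : ℕ)) with hζ
  have hprim : IsPrimitiveRoot ζ (2 * n + 1) := isPrimitiveRoot_unityRoot n
  have hnorm : ‖ζ‖ = 1 := hprim.norm'_eq_one (by omega)
  have hζ0 : ζ ≠ 0 := by intro h; rw [h] at hnorm; simp at hnorm
  have hconj : starRingEnd ℂ ζ = ζ⁻¹ := (Complex.inv_eq_conj hnorm).symm
  have h1 : ∀ k, unityRoot n k ^ (2 * n - r + r') *
      (starRingEnd ℂ (unityRoot n k)) ^ (r + (2 * n - r')) =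
      (ζ ^ (2 * ((r' : ℤ) - r))) ^ k := by
    intro k
    have e : unityRoot n k = ζ ^ k := rfl
    rw [e, map_pow, hconj, ← zpow_natCast, ← zpow_natCast, ← zpow_natCast, ← zpow_natCast,
      ← zpow_natCast, inv_zpow', ← zpow_mul, ← zpow_mul, ← zpow_mul, ← zpow_add₀ hζ0]
    congr 1
    push_cast [hr, hr']
    ring
  rw [Finset.sum_congr rfl fun k _ => h1 k]
  split_ifs with h
  · subst h
    simp
  · -- the order `2 n + 1` is odd, so it cannot divide `2 (r' - r)` unless it divides `r' - r`
    have hne : ζ ^ (2 * ((r' : ℤ) - r)) ≠ 1 := by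
      intro h2
      rw [hprim.zpow_eq_one_iff_dvd] at h2
      have h3 : ((2 * n + 1 : ℕ) : ℤ) ∣ (r' : ℤ) - r := by
        refine IsCoprime.dvd_of_dvd_mul_left ?_ h2
        refine ⟨1, -n, ?_⟩
        push_cast; ring
      have h4 := Int.eq_zero_of_abs_lt_dvd h3 (by rw [abs_lt]; push_cast; constructor <;> omega)
      omega
    have h5 : (ζ ^ (2 * ((r' : ℤ) - r))) ^ (2 * n + 1) = 1 := by
      rw [← zpow_natCast, ← zpow_mul, mul_comm, zpow_mul, zpow_natCast, hprim.pow_eq_one, one_zpow]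
    rw [geom_sum_eq hne, h5, sub_self, zero_div]

/-- Averaging picks the coefficient of `uʳ ūˢ` in the polynomial `u ↦ f(u v₁, …, u v_{2n})`. -/
theorem isOfType_typePart {r s : ℕ} (hrs : r + s = 2 * n) (f : Alt n (2 * n)) :
    IsOfType r s (typePart r s f) := by
  have hs : s = 2 * n - r := by omega
  have key : ∀ (v : Fin (2 * n) → Model n) (c : ℕ → ℂ) (_ : ∀ u : ℂ, f (fun i => u • v i) =
      ∑ r ∈ Finset.range (2 * n + 1), c r * (u ^ r * (starRingEnd ℂ u) ^ (2 * n - r))) (u : ℂ),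
      typePart r s f (fun i => u • v i) = c r * (u ^ r * (starRingEnd ℂ u) ^ s) := by
    intro v c hc u
    rw [typePart, ContinuousAlternatingMap.sum_apply]
    have h1 : ∀ k ∈ Finset.range (2 * n + 1), (((2 * n + 1 : ℂ)⁻¹ *
        (unityRoot n k ^ s * (starRingEnd ℂ (unityRoot n k)) ^ r)) •
          rot (unityRoot n k) f) (fun i => u • v i) =
        ∑ r' ∈ Finset.range (2 * n + 1), (2 * n + 1 : ℂ)⁻¹ *
          (c r' * (u ^ r' * (starRingEnd ℂ u) ^ (2 * n - r'))) *
          (unityRoot n k ^ (2 * n - r + r') *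
          (starRingEnd ℂ (unityRoot n k)) ^ (r + (2 * n - r'))) := by
      intro k _
      rw [ContinuousAlternatingMap.smul_apply, rot_apply]
      simp only [smul_smul]
      rw [hc, smul_eq_mul, Finset.mul_sum]
      refine Finset.sum_congr rfl fun r' _ => ?_
      rw [map_mul, hs]
      ring
    rw [Finset.sum_congr rfl h1, Finset.sum_comm]
    have h2 : ∀ r' ∈ Finset.range (2 * n + 1), ∑ k ∈ Finset.range (2 * n + 1), (2 * n + 1 : ℂ)⁻¹ *
          (c r' * (u ^ r' * (starRingEnd ℂ u) ^ (2 * n - r'))) *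
          (unityRoot n k ^ (2 * n - r + r') *
          (starRingEnd ℂ (unityRoot n k)) ^ (r + (2 * n - r'))) =
        if r = r' then c r' * (u ^ r' * (starRingEnd ℂ u) ^ (2 * n - r')) else 0 := by
      intro r' hr'
      rw [← Finset.mul_sum, sum_unityRoot n r r' (by omega)
        (Nat.lt_succ_iff.1 (Finset.mem_range.1 hr'))]
      have h3 : (2 * n + 1 : ℂ) ≠ 0 := by exact_mod_cast (2 * n).succ_ne_zero
      split_ifs
      · field_simp
      · simp
    rw [Finset.sum_congr rfl h2, Finset.sum_ite_eq, if_pos (Finset.mem_range.2 (by omega)), hs]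
  intro u v
  obtain ⟨c, hc⟩ := isBihomogeneous_form f v
  rw [key v c hc u]
  have h := key v c hc 1
  simp only [one_smul, one_pow, map_one, mul_one] at h
  rw [h]
  ring

/-- Summing the averages over all types leaves only the rotation by `1`. -/
theorem sum_typePart (f : Alt n (2 * n)) :
    ∑ r ∈ Finset.range (2 * n + 1), typePart r (2 * n - r) f = f := by
  ext v
  obtain ⟨c, hc⟩ := isBihomogeneous_form f v
  have h0 : f v = ∑ k ∈ Finset.range (2 * n + 1), if k = 0 then f v else 0 := by
    rw [Finset.sum_ite_eq', if_pos (Finset.mem_range.2 (by omega))]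
  rw [ContinuousAlternatingMap.sum_apply]
  simp only [typePart, ContinuousAlternatingMap.sum_apply, ContinuousAlternatingMap.smul_apply]
  rw [Finset.sum_comm, h0]
  refine Finset.sum_congr rfl fun k hk => ?_
  rw [← Finset.sum_smul, ← Finset.mul_sum]
  have h3 : (2 * n + 1 : ℂ) ≠ 0 := by exact_mod_cast (2 * n).succ_ne_zero
  split_ifs with hk0
  · subst hk0
    have : unityRoot n 0 = 1 := pow_zero _
    simp [this, rot_apply, h3]
  · set ζ := Complex.exp (2 * Real.pi * Complex.I / (2 * n + 1 : ℕ)) with hζ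
    have hprim : IsPrimitiveRoot ζ (2 * n + 1) := isPrimitiveRoot_unityRoot n
    set x := starRingEnd ℂ (unityRoot n k) with hx
    have hxu : unityRoot n k * x = 1 := by
      rw [Complex.mul_conj, Complex.normSq_eq_norm_sq, norm_unityRoot]; simp
    have h4 : ∀ r ∈ Finset.range (2 * n + 1), unityRoot n k ^ (2 * n - r) * x ^ r =
        unityRoot n k ^ (2 * n) * (x ^ 2) ^ r := by
      intro r hr
      have hr' : r ≤ 2 * n := Nat.lt_succ_iff.1 (Finset.mem_range.1 hr)
      have e1 : unityRoot n k ^ (2 * n) = unityRoot n k ^ (2 * n - r) * unityRoot n k ^ r := by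
        rw [← pow_add, Nat.sub_add_cancel hr']
      have e2 : unityRoot n k ^ r * x ^ r = 1 := by rw [← mul_pow, hxu, one_pow]
      rw [e1]
      linear_combination (-(unityRoot n k ^ (2 * n - r) * x ^ r)) * e2
    have hu1 : unityRoot n k ^ (2 * n + 1) = 1 := by
      change (ζ ^ k) ^ (2 * n + 1) = 1
      rw [← pow_mul, mul_comm, pow_mul, hprim.pow_eq_one, one_pow]
    have hx1 : (x ^ 2) ^ (2 * n + 1) = 1 := by
      rw [← pow_mul, mul_comm, pow_mul, hx, ← map_pow, hu1, map_one, one_pow]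
    have hne : x ^ 2 ≠ 1 := by
      intro h5
      have h6 : unityRoot n k ^ 2 = 1 := by
        have : (unityRoot n k * x) ^ 2 = 1 := by rw [hxu, one_pow]
        rwa [mul_pow, h5, mul_one] at this
      have h7 : ζ ^ (k * 2) = 1 := by rw [pow_mul]; exact h6
      have h8 := (hprim.pow_eq_one_iff_dvd _).1 h7
      have h9 : 2 * n + 1 ∣ k := by
        refine Nat.Coprime.dvd_of_dvd_mul_right ?_ h8
        simp
      have := Nat.le_of_dvd (Nat.pos_of_ne_zero hk0) h9
      have := Finset.mem_range.1 hk
      omega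
    rw [Finset.sum_congr rfl h4, ← Finset.mul_sum, geom_sum_eq hne, hx1, sub_self, zero_div,
      mul_zero, mul_zero, zero_smul]

/-- The complex conjugate of a form. -/
def conjForm (f : Alt n p) : Alt n p :=
  (Complex.conjCLE : ℂ →L[ℝ] ℂ).compContinuousAlternatingMap f

theorem conjForm_apply (f : Alt n p) (v : Fin p → Model n) :
    conjForm f v = starRingEnd ℂ (f v) := rfl

/-- The real part of a form. -/
def reForm (f : Alt n p) : Alt n p := (1 / 2 : ℂ) • (f + conjForm f)

/-- The imaginary part of a form. -/
def imForm (f : Alt n p) : Alt n p := (-Complex.I / 2 : ℂ) • (f + (-1 : ℂ) • conjForm f)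

theorem reForm_apply (f : Alt n p) (v : Fin p → Model n) : reForm f v = ((f v).re : ℂ) := by
  simp only [reForm, ContinuousAlternatingMap.smul_apply, ContinuousAlternatingMap.add_apply,
    conjForm_apply, smul_eq_mul, Complex.re_eq_add_conj]
  ring

theorem imForm_apply (f : Alt n p) (v : Fin p → Model n) : imForm f v = ((f v).im : ℂ) := by
  simp only [imForm, ContinuousAlternatingMap.smul_apply, ContinuousAlternatingMap.add_apply,
    conjForm_apply, smul_eq_mul, Complex.im_eq_sub_conj]
  field_simp
  linear_combination (- (f v - starRingEnd ℂ (f v))) * Complex.I_sq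

theorem reForm_add_imForm (f : Alt n p) : f = reForm f + Complex.I • imForm f := by
  ext v
  rw [ContinuousAlternatingMap.add_apply, ContinuousAlternatingMap.smul_apply, reForm_apply,
    imForm_apply, smul_eq_mul, mul_comm, Complex.re_add_im]

theorem IsOfType.conjForm {r s : ℕ} {f : Alt n p} (hf : IsOfType r s f) :
    IsOfType s r (conjForm f) := by
  intro u v
  rw [conjForm_apply, conjForm_apply, hf u v, map_mul, map_mul, map_pow, map_pow, Complex.conj_conj]
  ring

theorem IsOfType.reForm {r : ℕ} {f : Alt n p} (hf : IsOfType r r f) : IsOfType r r (reForm f) :=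
  (hf.add hf.conjForm).smul _

theorem IsOfType.imForm {r : ℕ} {f : Alt n p} (hf : IsOfType r r f) : IsOfType r r (imForm f) :=
  (hf.add (hf.conjForm.smul _)).smul _

/-- The bound `|f(w₁, …, w_p)| ≤ ε |w₁| ⋯ |w_p|`, where lengths are measured by the metric
form `β`. -/
def FormBound (β : Alt n 2) (ε : ℝ) (f : Alt n p) : Prop :=
  ∀ w, ‖f w‖ ≤ ε * ∏ i, Real.sqrt (sqLen β (w i))

theorem IsMetricForm.sqLen_smul {β : Alt n 2} (hβ : IsMetricForm β) (u : ℂ) (v : Model n) :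
    sqLen β (u • v) = ‖u‖ ^ 2 * sqLen β v := by
  have h := hβ.type11 u ![v, Complex.I • v]
  have e : (fun i => u • (![v, Complex.I • v] : Fin 2 → Model n) i) =
      ![u • v, Complex.I • (u • v)] := by
    funext k
    fin_cases k
    · rfl
    · exact smul_comm _ _ _
  rw [e, hβ.self_eq, hβ.self_eq, pow_one, pow_one, Complex.mul_conj, ← Complex.ofReal_mul,
    Complex.normSq_eq_norm_sq] at h
  exact_mod_cast h

theorem FormBound.rot {β : Alt n 2} (hβ : IsMetricForm β) {ε : ℝ} {f : Alt n p}
    (hf : FormBound β ε f) {u : ℂ} (hu : ‖u‖ = 1) : FormBound β ε (rot u f) := by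
  intro w
  rw [rot_apply]
  refine (hf _).trans (le_of_eq ?_)
  simp [hβ.sqLen_smul, hu]

theorem FormBound.typePart {β : Alt n 2} (hβ : IsMetricForm β) {ε : ℝ} {f : Alt n (2 * n)}
    (hf : FormBound β ε f) (r s : ℕ) : FormBound β ε (typePart r s f) := by
  intro w
  rw [KahlerSobolev.typePart, ContinuousAlternatingMap.sum_apply]
  have h1 : ∀ k ∈ Finset.range (2 * n + 1), ‖(((2 * n + 1 : ℂ)⁻¹ *
      (unityRoot n k ^ s * (starRingEnd ℂ (unityRoot n k)) ^ r)) •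
        KahlerSobolev.rot (unityRoot n k) f) w‖ ≤
      (2 * n + 1 : ℝ)⁻¹ * (ε * ∏ i, Real.sqrt (sqLen β (w i))) := by
    intro k _
    rw [ContinuousAlternatingMap.smul_apply, norm_smul, norm_mul, norm_mul, norm_pow, norm_pow,
      RCLike.norm_conj, norm_unityRoot, one_pow, one_pow, mul_one, mul_one]
    have h2 : ‖(2 * n + 1 : ℂ)⁻¹‖ = (2 * n + 1 : ℝ)⁻¹ := by
      have : (2 * n + 1 : ℂ) = ((2 * n + 1 : ℕ) : ℂ) := by push_cast; rfl
      rw [norm_inv, this, Complex.norm_natCast]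
      push_cast; rfl
    rw [h2]
    exact mul_le_mul_of_nonneg_left (hf.rot hβ (norm_unityRoot n k) w) (by positivity)
  refine (norm_sum_le _ _).trans ((Finset.sum_le_sum h1).trans (le_of_eq ?_))
  rw [Finset.sum_const, Finset.card_range, nsmul_eq_mul]
  have : (2 * n + 1 : ℝ) ≠ 0 := by positivity
  push_cast
  field_simp

theorem FormBound.reForm {β : Alt n 2} {ε : ℝ} {f : Alt n p}
    (hf : FormBound β ε f) : FormBound β ε (reForm f) := by
  intro w
  rw [reForm_apply, Complex.norm_real]
  exact (Complex.abs_re_le_norm _).trans (hf w)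

theorem FormBound.imForm {β : Alt n 2} {ε : ℝ} {f : Alt n p}
    (hf : FormBound β ε f) : FormBound β ε (imForm f) := by
  intro w
  rw [imForm_apply, Complex.norm_real]
  exact (Complex.abs_im_le_norm _).trans (hf w)

/-- A real form of type `(m, m)` that is bounded by `ε` lies below `ε βᵐ`. -/
theorem isPositiveForm_smul_wedgePow_add {m : ℕ} {β : Alt n 2} (hβ : IsMetricForm β) {ε : ℝ}
    (hε : 0 ≤ ε) {f : Alt n (2 * m)} (hf : FormBound β ε f) (ht : IsOfType m m f)
    (hr : ∀ v : Fin m → Model n, (f (interleave v)).im = 0) :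
    IsPositiveForm ((ε : ℂ) • wedgePow β m + f) := by
  refine ⟨((isPositiveForm_wedgePow hβ m).1.smul _).add ht, fun v => ?_⟩
  have h1 := (isPositiveForm_wedgePow hβ m).2 v
  have h2 := norm_interleave_le hβ f hε hf v
  rw [ContinuousAlternatingMap.add_apply, ContinuousAlternatingMap.smul_apply, smul_eq_mul]
  rw [Complex.le_def] at h1 ⊢
  have h3 := (abs_le.1 ((Complex.abs_re_le_norm (f (interleave v))).trans h2)).1
  have h4 : (wedgePow β m (interleave v)).im = 0 := h1.2.symm
  constructor
  · simp
    linarith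
  · simp [h4, hr]

end Types

/-! ### Coordinate changes -/

section Charts

variable {n : ℕ} {X : Type*} [TopologicalSpace X] [ChartedSpace (Model n) X]

theorem contDiffOn_transition [IsManifold 𝓘(ℂ, Model n) ω X]
    {e e' : OpenPartialHomeomorph X (Model n)}
    (he : e ∈ atlas (Model n) X) (he' : e' ∈ atlas (Model n) X) :
    ContDiffOn ℂ ω (e' ∘ e.symm) (e.symm ≫ₕ e').source := by
  have h := (contDiffGroupoid ω 𝓘(ℂ, Model n)).compatible he he'
  rw [contDiffGroupoid, mem_groupoid_of_pregroupoid] at h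
  have h2 := h.1
  simpa [contDiffPregroupoid] using h2

theorem contDiffAt_transition [IsManifold 𝓘(ℂ, Model n) ω X]
    {e e' : OpenPartialHomeomorph X (Model n)}
    (he : e ∈ atlas (Model n) X) (he' : e' ∈ atlas (Model n) X) {y : Model n}
    (hy : y ∈ e.target) (hy' : e.symm y ∈ e'.source) :
    ContDiffAt ℂ ω (fun z => e' (e.symm z)) y := by
  refine (contDiffOn_transition he he').contDiffAt ((e.symm ≫ₕ e').open_source.mem_nhds ?_)
  simp [hy, hy']

variable (n X) in
theorem isManifold_real [IsManifold 𝓘(ℂ, Model n) ω X] : IsManifold 𝓘(ℝ, Model n) ∞ X := by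
  refine isManifold_of_contDiffOn _ _ _ fun e e' he he' => ?_
  have h : ContDiffOn ℝ ω (e' ∘ e.symm) (e.symm ≫ₕ e').source :=
    (contDiffOn_transition he he').restrict_scalars ℝ
  simpa using h.of_le le_top

/-- Real-linear endomorphisms of `ℂᵏ` that commute with multiplication by `i`. -/
def CommutesI (A : Model n →L[ℝ] Model n) : Prop := ∀ v, A (Complex.I • v) = Complex.I • A v

theorem CommutesI.smul {A : Model n →L[ℝ] Model n} (hA : CommutesI A) (u : ℂ) (v : Model n) :
    A (u • v) = u • A v := by
  have h1 : ∀ w : Model n, u • w = u.re • w + u.im • (Complex.I • w) := by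
    intro w
    conv_lhs => rw [← Complex.re_add_im u, add_smul, mul_smul]
    rfl
  rw [h1, h1, map_add, map_smul, map_smul, hA]

theorem extD_eq_zero {p : ℕ} {η : DForm n X p} {x : X} (hx : x ∉ tsupport η) : extD η x = 0 := by
  set c := chartAt (Model n) x with hc
  have hcx : x ∈ c.source := mem_chart_source _ x
  have h0 : ∀ᶠ z in 𝓝 x, η z = 0 := by
    rw [notMem_tsupport_iff_eventuallyEq] at hx
    exact hx
  have h1 : inChart c η =ᶠ[𝓝 (c x)] fun _ => 0 := by
    have h2 : ∀ᶠ y in 𝓝 (c x), η (c.symm y) = 0 := by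
      have := c.symm.continuousAt (c.map_source hcx)
      rw [ContinuousAt, c.left_inv hcx] at this
      exact this.eventually h0
    filter_upwards [h2] with y hy
    ext v
    simp [inChart, hy]
  unfold extD
  rw [← hc, h1.extDeriv_eq, extDeriv, fderiv_const_apply]
  exact map_zero (ContinuousAlternatingMap.alternatizeUncurryFinCLM ℝ (Model n) ℂ)

theorem tsupport_extD_subset {p : ℕ} (η : DForm n X p) : tsupport (extD η) ⊆ tsupport η := by
  refine closure_minimal (fun x hx => ?_) (isClosed_tsupport η)
  by_contra h
  exact hx (extD_eq_zero h)

variable [IsManifold 𝓘(ℂ, Model n) ω X] {e e' : OpenPartialHomeomorph X (Model n)}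

theorem commutesI_fderiv_transition (he : e ∈ atlas (Model n) X) (he' : e' ∈ atlas (Model n) X)
    {y : Model n} (hy : y ∈ e.target) (hy' : e.symm y ∈ e'.source) :
    CommutesI (fderiv ℝ (fun z => e' (e.symm z)) y) := by
  intro v
  have h : DifferentiableAt ℂ (fun z => e' (e.symm z)) y :=
    (contDiffAt_transition he he' hy hy').differentiableAt (by simp)
  rw [h.fderiv_restrictScalars (𝕜 := ℝ)]
  exact (fderiv ℂ (fun z => e' (e.symm z)) y).map_smul Complex.I v

theorem differentiableAt_transition (he : e ∈ atlas (Model n) X) (he' : e' ∈ atlas (Model n) X)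
    {y : Model n} (hy : y ∈ e.target) (hy' : e.symm y ∈ e'.source) :
    DifferentiableAt ℝ (fun z => e' (e.symm z)) y :=
  ((contDiffAt_transition he he' hy hy').differentiableAt (by simp)).restrictScalars ℝ

theorem fderiv_transition_comp (he : e ∈ atlas (Model n) X) (he' : e' ∈ atlas (Model n) X)
    {e'' : OpenPartialHomeomorph X (Model n)} (he'' : e'' ∈ atlas (Model n) X)
    {y : Model n} (hy : y ∈ e.target) (hy' : e.symm y ∈ e'.source)
    (hy'' : e.symm y ∈ e''.source) :
    fderiv ℝ (fun z => e'' (e.symm z)) y =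
      (fderiv ℝ (fun z => e'' (e'.symm z)) (e' (e.symm y))).comp
        (fderiv ℝ (fun z => e' (e.symm z)) y) := by
  have h1 : (fun z => e'' (e.symm z)) =ᶠ[𝓝 y]
      (fun z => e'' (e'.symm z)) ∘ (fun z => e' (e.symm z)) := by
    have : ∀ᶠ z in 𝓝 y, e.symm z ∈ e'.source :=
      (e.symm.continuousAt hy).eventually (e'.open_source.mem_nhds hy')
    filter_upwards [this] with z hz
    simp [e'.left_inv hz]
  rw [h1.fderiv_eq, fderiv_comp]
  · refine differentiableAt_transition he' he'' (e'.map_source hy') ?_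
    rwa [e'.left_inv hy']
  · exact differentiableAt_transition he he' hy hy'

theorem fderiv_transition_inverse (he : e ∈ atlas (Model n) X) (he' : e' ∈ atlas (Model n) X)
    {y : Model n} (hy : y ∈ e.target) (hy' : e.symm y ∈ e'.source) :
    (fderiv ℝ (fun z => e (e'.symm z)) (e' (e.symm y))).comp
        (fderiv ℝ (fun z => e' (e.symm z)) y) = ContinuousLinearMap.id ℝ (Model n) := by
  rw [← fderiv_transition_comp he he' he hy hy' (e.map_target hy)]
  have h1 : (fun z => e (e.symm z)) =ᶠ[𝓝 y] id := by
    filter_upwards [e.open_target.mem_nhds hy] with z hz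
    exact e.right_inv hz
  rw [h1.fderiv_eq, fderiv_id]

theorem fderiv_transition_injective (he : e ∈ atlas (Model n) X) (he' : e' ∈ atlas (Model n) X)
    {y : Model n} (hy : y ∈ e.target) (hy' : e.symm y ∈ e'.source) :
    Function.Injective (fderiv ℝ (fun z => e' (e.symm z)) y) := by
  have h := fderiv_transition_inverse he he' hy hy'
  refine Function.LeftInverse.injective
    (g := fderiv ℝ (fun z => e (e'.symm z)) (e' (e.symm y))) fun v => ?_
  exact DFunLike.congr_fun h v

theorem commutesI_invDiff (he : e ∈ atlas (Model n) X) {y : Model n} (hy : y ∈ e.target) :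
    CommutesI (invDiff e y) :=
  commutesI_fderiv_transition he (chart_mem_atlas _ _) hy (mem_chart_source _ _)

theorem invDiff_injective (he : e ∈ atlas (Model n) X) {y : Model n} (hy : y ∈ e.target) :
    Function.Injective (invDiff e y) :=
  fderiv_transition_injective he (chart_mem_atlas _ _) hy (mem_chart_source _ _)

theorem invDiff_surjective (he : e ∈ atlas (Model n) X) {y : Model n} (hy : y ∈ e.target) :
    Function.Surjective (invDiff e y) :=
  (LinearMap.injective_iff_surjective (f := (invDiff e y : Model n →ₗ[ℝ] Model n))).1
    (invDiff_injective he hy)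

theorem invDiff_eq_comp (he : e ∈ atlas (Model n) X) (he' : e' ∈ atlas (Model n) X)
    {y : Model n} (hy : y ∈ e.target) (hy' : e.symm y ∈ e'.source) :
    invDiff e y = (invDiff e' (e' (e.symm y))).comp (fderiv ℝ (fun z => e' (e.symm z)) y) := by
  unfold invDiff
  rw [e'.left_inv hy']
  exact fderiv_transition_comp he he' (chart_mem_atlas _ _) hy hy' (mem_chart_source _ _)

/-- The transformation rule of coordinate expressions under a change of chart. -/
theorem inChart_transition {p : ℕ} (he : e ∈ atlas (Model n) X) (he' : e' ∈ atlas (Model n) X)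
    (η : DForm n X p) {y : Model n} (hy : y ∈ e.target) (hy' : e.symm y ∈ e'.source) :
    inChart e η y = (inChart e' η (e' (e.symm y))).compContinuousLinearMap
      (fderiv ℝ (fun z => e' (e.symm z)) y) := by
  unfold inChart
  rw [e'.left_inv hy', invDiff_eq_comp he he' hy hy']
  rfl

theorem inChart_extD {p : ℕ} (he : e ∈ atlas (Model n) X) {η : DForm n X p} (hη : SmoothForm η)
    {y : Model n} (hy : y ∈ e.target) :
    inChart e (extD η) y = extDeriv (inChart e η) y := by
  set x := e.symm y with hx
  set c := chartAt (Model n) x with hc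
  have hcx : x ∈ c.source := mem_chart_source _ x
  have hcat : c ∈ atlas (Model n) X := chart_mem_atlas _ _
  have h1 : inChart e η =ᶠ[𝓝 y] fun z => (inChart c η (c (e.symm z))).compContinuousLinearMap
      (fderiv ℝ (fun z => c (e.symm z)) z) := by
    have : ∀ᶠ z in 𝓝 y, e.symm z ∈ c.source :=
      (e.symm.continuousAt hy).eventually (c.open_source.mem_nhds hcx)
    filter_upwards [this, e.open_target.mem_nhds hy] with z hz hz'
    exact inChart_transition he hcat η hz' hz
  rw [h1.extDeriv_eq]
  have h2 : DifferentiableAt ℝ (inChart c η) (c (e.symm y)) :=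
    ((hη c hcat).contDiffAt (c.open_target.mem_nhds (c.map_source hcx))).differentiableAt (by simp)
  have h3 : ContDiffAt ℝ ω (fun z => c (e.symm z)) y :=
    (contDiffAt_transition he hcat hy hcx).restrict_scalars ℝ
  have h4 : extDeriv (fun z => (inChart c η (c (e.symm z))).compContinuousLinearMap
      (fderiv ℝ (fun z => c (e.symm z)) z)) y =
      (extDeriv (inChart c η) (c (e.symm y))).compContinuousLinearMap
        (fderiv ℝ (fun z => c (e.symm z)) y) :=
    extDeriv_pullback (f := fun z => c (e.symm z)) (x := y) h2 h3 le_top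
  rw [h4]
  rfl

theorem SmoothForm.extD {p : ℕ} {η : DForm n X p} (hη : SmoothForm η) : SmoothForm (extD η) := by
  intro e he
  have h : ContDiffOn ℝ ∞ (fun y => ContinuousAlternatingMap.alternatizeUncurryFinCLM ℝ (Model n) ℂ
      (fderiv ℝ (inChart e η) y)) e.target :=
    (ContinuousLinearMap.contDiff _).comp_contDiffOn
      ((hη e he).fderiv_of_isOpen e.open_target (by simp))
  exact h.congr fun y hy => inChart_extD he hη hy


end Charts

/-! ### Smooth operations on forms -/

section Smooth

variable {n : ℕ} {X : Type*} [TopologicalSpace X] [ChartedSpace (Model n) X]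

theorem contDiffOn_wedge {p q : ℕ} {f : Model n → Alt n p} {g : Model n → Alt n q}
    {s : Set (Model n)} (hf : ContDiffOn ℝ ∞ f s) (hg : ContDiffOn ℝ ∞ g s) :
    ContDiffOn ℝ ∞ (fun y => wedge (f y) (g y)) s := by
  have h := ((wedgeL n p q).contDiff.comp_contDiffOn hf).clm_apply hg
  exact h

theorem contDiffOn_wedgePow {f : Model n → Alt n 2} {s : Set (Model n)} (hf : ContDiffOn ℝ ∞ f s)
    (m : ℕ) : ContDiffOn ℝ ∞ (fun y => wedgePow (f y) m) s := by
  induction m with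
  | zero => exact contDiffOn_const
  | succ m ih => exact contDiffOn_wedge ih hf

theorem inChart_pow (κ : KahlerForm n X) (m : ℕ) (e : OpenPartialHomeomorph X (Model n))
    (y : Model n) : inChart e (κ.pow m) y = wedgePow (inChart e κ.form y) m :=
  wedgePow_compContinuousLinearMap _ _ _

theorem inChart_rot [IsManifold 𝓘(ℂ, Model n) ω X] {p : ℕ} (u : ℂ) (η : DForm n X p)
    {e : OpenPartialHomeomorph X (Model n)}
    (he : e ∈ atlas (Model n) X) {y : Model n} (hy : y ∈ e.target) :
    inChart e (fun x => rot u (η x)) y = rot u (inChart e η y) := by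
  ext v
  simp only [inChart, rot_apply, ContinuousAlternatingMap.compContinuousLinearMap_apply,
    Function.comp_def, (commutesI_invDiff he hy).smul]

theorem smoothForm_rot [IsManifold 𝓘(ℂ, Model n) ω X] {p : ℕ} (u : ℂ) {η : DForm n X p}
    (hη : SmoothForm η) : SmoothForm (fun x => rot u (η x)) := by
  intro e he
  have h : ContDiffOn ℝ ∞ (fun y => ContinuousAlternatingMap.compContinuousLinearMapCLM
      ((u • ContinuousLinearMap.id ℂ (Model n)).restrictScalars ℝ) (inChart e η y)) e.target :=
    (ContinuousLinearMap.contDiff _).comp_contDiffOn (hη e he)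
  exact h.congr fun y hy => inChart_rot u η he hy

theorem smoothForm_conjForm {p : ℕ} {η : DForm n X p}
    (hη : SmoothForm η) : SmoothForm (fun x => conjForm (η x)) := by
  intro e he
  have h : ContDiffOn ℝ ∞ (fun y => ContinuousLinearMap.compContinuousAlternatingMapCLM
      ℝ (Model n) ℂ ℂ (Fin p) (Complex.conjCLE : ℂ →L[ℝ] ℂ) (inChart e η y)) e.target :=
    (ContinuousLinearMap.contDiff _).comp_contDiffOn (hη e he)
  exact h.congr fun y hy => rfl

theorem rot_zero {p : ℕ} (u : ℂ) : rot u (0 : Alt n p) = 0 := by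
  ext v; simp [rot_apply]

theorem conjForm_zero {p : ℕ} : conjForm (0 : Alt n p) = 0 := by
  ext v; simp [conjForm_apply]

/-- The pull-back of a test form by multiplication with `u` on tangent spaces. -/
def rotTest [IsManifold 𝓘(ℂ, Model n) ω X] {p : ℕ} (u : ℂ) (Ψ : TestForm n X p) :
    TestForm n X p :=
  ⟨fun x => rot u ((Ψ : DForm n X p) x), smoothForm_rot u Ψ.2.1,
    Ψ.2.2.comp_left (rot_zero u)⟩

/-- The complex conjugate of a test form. -/
def conjTest {p : ℕ} (Ψ : TestForm n X p) : TestForm n X p :=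
  ⟨fun x => conjForm ((Ψ : DForm n X p) x), smoothForm_conjForm Ψ.2.1,
    Ψ.2.2.comp_left conjForm_zero⟩

/-- The real part of a test form. -/
def reTest {p : ℕ} (Ψ : TestForm n X p) : TestForm n X p := (1 / 2 : ℂ) • (Ψ + conjTest Ψ)

/-- The imaginary part of a test form. -/
def imTest {p : ℕ} (Ψ : TestForm n X p) : TestForm n X p :=
  (-Complex.I / 2 : ℂ) • (Ψ + (-1 : ℂ) • conjTest Ψ)

theorem reTest_apply {p : ℕ} (Ψ : TestForm n X p) (x : X) :
    (reTest Ψ : DForm n X p) x = reForm ((Ψ : DForm n X p) x) := rfl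

theorem imTest_apply {p : ℕ} (Ψ : TestForm n X p) (x : X) :
    (imTest Ψ : DForm n X p) x = imForm ((Ψ : DForm n X p) x) := rfl

theorem reTest_add_imTest {p : ℕ} (Ψ : TestForm n X p) :
    Ψ = reTest Ψ + Complex.I • imTest Ψ := by
  apply Subtype.ext
  funext x
  exact reForm_add_imForm _

/-- The component of type `(r, s)` of a test form. -/
def typeTest [IsManifold 𝓘(ℂ, Model n) ω X] (r s : ℕ) (Ψ : TestForm n X (2 * n)) :
    TestForm n X (2 * n) :=
  ∑ k ∈ Finset.range (2 * n + 1), ((2 * n + 1 : ℂ)⁻¹ *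
    (unityRoot n k ^ s * (starRingEnd ℂ (unityRoot n k)) ^ r)) • rotTest (unityRoot n k) Ψ

theorem typeTest_apply [IsManifold 𝓘(ℂ, Model n) ω X] (r s : ℕ) (Ψ : TestForm n X (2 * n))
    (x : X) : (typeTest r s Ψ : DForm n X (2 * n)) x =
      typePart r s ((Ψ : DForm n X (2 * n)) x) := by
  rw [typeTest, typePart, Submodule.coe_sum, Finset.sum_apply]
  rfl

theorem sum_typeTest [IsManifold 𝓘(ℂ, Model n) ω X] (Ψ : TestForm n X (2 * n)) :
    ∑ r ∈ Finset.range (2 * n + 1), typeTest r (2 * n - r) Ψ = Ψ := by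
  apply Subtype.ext
  funext x
  rw [Submodule.coe_sum, Finset.sum_apply]
  simp only [typeTest_apply]
  exact sum_typePart _

/-- A smooth cut-off of the form `κᵐ`. -/
def cutPow [IsManifold 𝓘(ℂ, Model n) ω X] (κ : KahlerForm n X) (m : ℕ) (χ : X → ℝ)
    (hχ : ContMDiff 𝓘(ℝ, Model n) 𝓘(ℝ, ℝ) ∞ χ) (hc : HasCompactSupport χ) :
    TestForm n X (2 * m) :=
  ⟨fun x => (χ x : ℂ) • κ.pow m x, by
    constructor
    · intro e he
      have := isManifold_real n X
      have h1 : ContDiffOn ℝ ∞ (fun y => χ (e.symm y)) e.target := by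
        have h2 : ContMDiffOn 𝓘(ℝ, Model n) 𝓘(ℝ, Model n) ∞ e.symm e.target :=
          contMDiffOn_symm_of_mem_maximalAtlas
            (IsManifold.subset_maximalAtlas he)
        have h3 := hχ.comp_contMDiffOn h2
        exact h3.contDiffOn
      have h2 : ContDiffOn ℝ ∞ (fun y => χ (e.symm y) • wedgePow (inChart e κ.form y) m)
        e.target := h1.smul (contDiffOn_wedgePow (κ.smooth e he) m)
      refine h2.congr fun y _ => ?_
      rw [← inChart_pow, ← ofReal_smul]
      rfl
    · refine hc.mono ?_
      intro x hx hx'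
      apply hx
      simp only [hx', Complex.ofReal_zero]
      exact zero_smul ℂ (κ.pow m x)⟩

theorem cutPow_apply [IsManifold 𝓘(ℂ, Model n) ω X] (κ : KahlerForm n X) (m : ℕ) (χ : X → ℝ)
    (hχ : ContMDiff 𝓘(ℝ, Model n) 𝓘(ℝ, ℝ) ∞ χ) (hc : HasCompactSupport χ) (x : X) :
    (cutPow κ m χ hχ hc : DForm n X (2 * m)) x = (χ x : ℂ) • κ.pow m x := rfl

variable (n) in
/-- Smooth cut-off functions. -/
theorem exists_cutoff [T2Space X] [SecondCountableTopology X]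
    [IsManifold 𝓘(ℂ, Model n) ω X] {K : Set X} (hK : IsCompact K) :
    ∃ χ : X → ℝ, ContMDiff 𝓘(ℝ, Model n) 𝓘(ℝ, ℝ) ∞ χ ∧ HasCompactSupport χ ∧
      (∀ x, 0 ≤ χ x ∧ χ x ≤ 1) ∧ ∀ x ∈ K, χ x = 1 := by
  have := isManifold_real n X
  have : LocallyCompactSpace X := ChartedSpace.locallyCompactSpace (Model n) X
  obtain ⟨K', hK', hKK'⟩ := exists_compact_superset hK
  obtain ⟨f, h1, h0, hf⟩ := exists_contMDiffMap_one_nhds_of_subset_interior 𝓘(ℝ, Model n)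
    (n := (⊤ : ℕ∞)) hK.isClosed hKK'
  refine ⟨f, f.contMDiff, ?_, hf, fun x hx => h1.self_of_nhdsSet x hx⟩
  refine HasCompactSupport.of_support_subset_isCompact hK' fun x hx => ?_
  by_contra h
  exact hx (h0 x h)

end Smooth

/-! ### Comparison of forms with the Kähler form -/

section Bounds

variable {n : ℕ} {X : Type*} [TopologicalSpace X] [ChartedSpace (Model n) X]

theorem KahlerForm.isMetricForm (κ : KahlerForm n X) (x : X) : IsMetricForm (κ.form x) :=
  ⟨κ.type11 x, κ.pos x⟩

theorem sqLen_compContinuousLinearMap (β : Alt n 2) {A : Model n →L[ℝ] Model n}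
    (hA : CommutesI A) (v : Model n) :
    sqLen (β.compContinuousLinearMap A) v = sqLen β (A v) := by
  have : (A ∘ ![v, Complex.I • v] : Fin 2 → Model n) = ![A v, Complex.I • A v] := by
    funext k; fin_cases k
    · rfl
    · exact hA v
  rw [sqLen, ContinuousAlternatingMap.compContinuousLinearMap_apply, this, sqLen]

theorem IsMetricForm.compContinuousLinearMap {β : Alt n 2} (hβ : IsMetricForm β)
    {A : Model n →L[ℝ] Model n} (hA : CommutesI A) (hi : Function.Injective A) :
    IsMetricForm (β.compContinuousLinearMap A) := by
  refine ⟨fun u v => ?_, fun v hv => ?_⟩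
  · have := hβ.type11 u (A ∘ v)
    simp only [ContinuousAlternatingMap.compContinuousLinearMap_apply, Function.comp_def,
      hA.smul] at this ⊢
    exact this
  · have h1 : (A ∘ ![v, Complex.I • v] : Fin 2 → Model n) = ![A v, Complex.I • A v] := by
      funext k; fin_cases k
      · rfl
      · exact hA v
    rw [ContinuousAlternatingMap.compContinuousLinearMap_apply, h1]
    refine hβ.pos _ fun h => hv (hi ?_)
    rw [h, map_zero]

theorem KahlerForm.isMetricForm_inChart [IsManifold 𝓘(ℂ, Model n) ω X] (κ : KahlerForm n X)
    {e : OpenPartialHomeomorph X (Model n)}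
    (he : e ∈ atlas (Model n) X) {y : Model n} (hy : y ∈ e.target) :
    IsMetricForm (inChart e κ.form y) :=
  (κ.isMetricForm _).compContinuousLinearMap (commutesI_invDiff he hy) (invDiff_injective he hy)

theorem FormBound.mono {p : ℕ} {β : Alt n 2} {ε ε' : ℝ} {f : Alt n p}
    (hf : FormBound β ε f) (h : ε ≤ ε') : FormBound β ε' f := fun w =>
  (hf w).trans (mul_le_mul_of_nonneg_right h (Finset.prod_nonneg fun _ _ => Real.sqrt_nonneg _))

theorem formBound_zero {p : ℕ} (β : Alt n 2) {ε : ℝ} (hε : 0 ≤ ε) :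
    FormBound β ε (0 : Alt n p) := fun w => by
  rw [ContinuousAlternatingMap.coe_zero, Pi.zero_apply, norm_zero]
  exact mul_nonneg hε (Finset.prod_nonneg fun _ _ => Real.sqrt_nonneg _)

/-- On compact subsets of a chart, the metric of `κ` dominates a multiple of the euclidean
metric. -/
theorem exists_formBound_chart [IsManifold 𝓘(ℂ, Model n) ω X] (κ : KahlerForm n X)
    {e : OpenPartialHomeomorph X (Model n)} (he : e ∈ atlas (Model n) X) {L : Set (Model n)}
    (hL : IsCompact L) (hLe : L ⊆ e.target) :
    ∃ A : ℝ, 0 ≤ A ∧ ∀ (p : ℕ) (η : DForm n X p), ∀ y ∈ L,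
      FormBound (κ.form (e.symm y)) (‖inChart e η y‖ * A ^ p) (η (e.symm y)) := by
  let g : Model n × Model n → ℝ := fun z => sqLen (inChart e κ.form z.1) z.2
  have hg : ContinuousOn g (L ×ˢ Metric.sphere 0 1) := by
    have h1 : ContinuousOn (fun z : Model n × Model n => inChart e κ.form z.1)
        (L ×ˢ Metric.sphere 0 1) :=
      ((κ.smooth e he).continuousOn.mono hLe).comp continuousOn_fst fun z hz => hz.1
    have h2 : ContinuousOn (fun z : Model n × Model n =>
        (![z.2, Complex.I • z.2] : Fin 2 → Model n)) (L ×ˢ Metric.sphere 0 1) := by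
      refine Continuous.continuousOn ?_
      refine continuous_pi fun i => ?_
      fin_cases i
      · exact continuous_snd
      · exact continuous_snd.const_smul Complex.I
    exact Complex.continuous_re.comp_continuousOn (h1.eval h2)
  -- on the unit sphere over `L` the squared length has a positive lower bound `c`
  obtain ⟨c, hc0, hc⟩ := (hL.prod (isCompact_sphere (0 : Model n) 1)).exists_forall_le' hg
    (a := 0) (fun z hz => by
      refine (κ.isMetricForm_inChart he (hLe hz.1)).sqLen_pos ?_
      rintro h0
      have := hz.2
      simp [h0] at this)
  have hsq : ∀ y ∈ L, ∀ v, ‖v‖ ≤ (Real.sqrt c)⁻¹ * Real.sqrt (sqLen (inChart e κ.form y) v) := by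
    intro y hy v
    by_cases hv : v = 0
    · subst hv
      simp only [norm_zero]
      positivity
    have hm := κ.isMetricForm_inChart he (hLe hy)
    have hv0 : 0 < ‖v‖ := norm_pos_iff.2 hv
    have h1 := hc (y, (‖v‖⁻¹ : ℂ) • v) ⟨hy, by
      simp [norm_smul, hv0.ne']⟩
    simp only [g] at h1
    rw [hm.sqLen_smul, norm_inv, Complex.norm_real, norm_norm] at h1
    have h2 : c * ‖v‖ ^ 2 ≤ sqLen (inChart e κ.form y) v := by
      calc c * ‖v‖ ^ 2 ≤ (‖v‖⁻¹ ^ 2 * sqLen (inChart e κ.form y) v) * ‖v‖ ^ 2 :=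
            mul_le_mul_of_nonneg_right h1 (by positivity)
        _ = _ := by field_simp
    have h3 := Real.sqrt_le_sqrt h2
    rw [Real.sqrt_mul hc0.le, Real.sqrt_sq hv0.le] at h3
    rw [inv_mul_eq_div, le_div_iff₀ (Real.sqrt_pos.2 hc0), mul_comm]
    exact h3
  refine ⟨(Real.sqrt c)⁻¹, by positivity, fun p η y hy w => ?_⟩
  choose w' hw' using fun i => invDiff_surjective he (hLe hy) (w i)
  have h1 : η (e.symm y) w = inChart e η y w' := by
    rw [inChart, ContinuousAlternatingMap.compContinuousLinearMap_apply]
    congr 1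
    funext i
    exact (hw' i).symm
  rw [h1, mul_assoc]
  refine ((inChart e η y).le_opNorm w').trans (mul_le_mul_of_nonneg_left ?_ (norm_nonneg _))
  calc ∏ i, ‖w' i‖ ≤ ∏ i, ((Real.sqrt c)⁻¹ * Real.sqrt (sqLen (κ.form (e.symm y)) (w i))) := by
        refine Finset.prod_le_prod (fun _ _ => norm_nonneg _) fun i _ => ?_
        refine (hsq y hy (w' i)).trans (le_of_eq ?_)
        rw [inChart, sqLen_compContinuousLinearMap _ (commutesI_invDiff he (hLe hy)), hw']
    _ = _ := by simp [Finset.prod_mul_distrib]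

/-- Every point has a compact coordinate neighbourhood. -/
theorem exists_compact_chart_nhds (x : X) : ∃ L : Set (Model n), IsCompact L ∧
    L ⊆ (chartAt (Model n) x).target ∧
    ∃ U ∈ 𝓝 x, U ⊆ (chartAt (Model n) x).source ∧ ∀ z ∈ U, chartAt (Model n) x z ∈ L := by
  set c := chartAt (Model n) x
  obtain ⟨L, hL, hLc, hLt⟩ := local_compact_nhds
    (c.open_target.mem_nhds (mem_chart_target (Model n) x))
  refine ⟨L, hLt, hLc, c.source ∩ c ⁻¹' L, ?_, Set.inter_subset_left, fun z hz => hz.2⟩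
  exact inter_mem (c.open_source.mem_nhds (mem_chart_source _ x))
    ((c.continuousAt (mem_chart_source _ x)).preimage_mem_nhds hL)

/-- Continuous forms with compact support are bounded with respect to `κ`. -/
theorem exists_formBound [IsManifold 𝓘(ℂ, Model n) ω X] (κ : KahlerForm n X) {p : ℕ}
    {η : DForm n X p} (hη : ∀ e ∈ atlas (Model n) X, ContinuousOn (inChart e η) e.target)
    (hc : HasCompactSupport η) :
    ∃ C : ℝ, 0 ≤ C ∧ ∀ x, FormBound (κ.form x) C (η x) := by
  suffices h : ∃ C : ℝ, 0 ≤ C ∧ ∀ x ∈ tsupport η, FormBound (κ.form x) C (η x) by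
    obtain ⟨C, hC, h⟩ := h
    refine ⟨C, hC, fun x => ?_⟩
    by_cases hx : x ∈ tsupport η
    · exact h x hx
    · rw [image_eq_zero_of_notMem_tsupport hx]
      exact formBound_zero _ hC
  refine hc.induction_on (p := fun s => ∃ C : ℝ, 0 ≤ C ∧ ∀ x ∈ s, FormBound (κ.form x) C (η x))
    ⟨0, le_rfl, by simp⟩ ?_ ?_ ?_
  · rintro s t hst ⟨C, hC, h⟩
    exact ⟨C, hC, fun x hx => h x (hst hx)⟩
  · rintro s t ⟨C, hC, h⟩ ⟨C', hC', h'⟩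
    refine ⟨max C C', le_max_of_le_left hC, ?_⟩
    rintro x (hx | hx)
    · exact (h x hx).mono (le_max_left _ _)
    · exact (h' x hx).mono (le_max_right _ _)
  · intro x _
    obtain ⟨L, hL, hLc, U, hU, hUs, hUL⟩ := exists_compact_chart_nhds (n := n) x
    obtain ⟨A, hA, h⟩ := exists_formBound_chart κ (chart_mem_atlas _ x) hL hLc
    obtain ⟨M, hM⟩ := hL.exists_bound_of_continuousOn
      ((hη _ (chart_mem_atlas _ x)).mono hLc)
    refine ⟨U, mem_nhdsWithin_of_mem_nhds hU, max M 0 * A ^ p, by positivity, fun z hz => ?_⟩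
    have h1 := h p η _ (hUL z hz)
    rw [(chartAt (Model n) x).left_inv (hUs hz)] at h1
    exact h1.mono (mul_le_mul_of_nonneg_right
      ((hM _ (hUL z hz)).trans (le_max_left _ _)) (by positivity))

/-- A sequence of test forms that tends to zero does so uniformly with respect to `κ`. -/
theorem TestTendsToZero.eventually_formBound [IsManifold 𝓘(ℂ, Model n) ω X] (κ : KahlerForm n X)
    {p : ℕ} {Ψ : ℕ → TestForm n X p} (hΨ : TestTendsToZero Ψ) {ε : ℝ} (hε : 0 < ε) :
    ∀ᶠ j in atTop, ∀ x, FormBound (κ.form x) ε ((Ψ j : DForm n X p) x) := by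
  obtain ⟨⟨K, hK, hsupp⟩, hconv⟩ := hΨ
  suffices h : ∀ᶠ j in atTop, ∀ x ∈ K, FormBound (κ.form x) ε ((Ψ j : DForm n X p) x) by
    filter_upwards [h] with j hj x
    by_cases hx : x ∈ tsupport (Ψ j : DForm n X p)
    · exact hj x (hsupp j hx)
    · rw [image_eq_zero_of_notMem_tsupport hx]
      exact formBound_zero _ hε.le
  refine hK.induction_on (p := fun s => ∀ᶠ j in atTop, ∀ x ∈ s,
    FormBound (κ.form x) ε ((Ψ j : DForm n X p) x)) (by simp) ?_ ?_ ?_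
  · intro s t hst h
    filter_upwards [h] with j hj x hx using hj x (hst hx)
  · intro s t h h'
    filter_upwards [h, h'] with j hj hj' x hx
    exact hx.elim (hj x) (hj' x)
  · intro x _
    obtain ⟨L, hL, hLc, U, hU, hUs, hUL⟩ := exists_compact_chart_nhds (n := n) x
    obtain ⟨A, hA, h⟩ := exists_formBound_chart κ (chart_mem_atlas _ x) hL hLc
    refine ⟨U, mem_nhdsWithin_of_mem_nhds hU, ?_⟩
    have h1 := hconv _ (chart_mem_atlas _ x) 0 L hL hLc
    rw [Metric.tendstoUniformlyOn_iff] at h1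
    filter_upwards [h1 (ε / (A ^ p + 1)) (by positivity)] with j hj z hz
    have h2 := hj _ (hUL z hz)
    rw [dist_zero_left, norm_iteratedFDeriv_zero] at h2
    have h3 := h p (Ψ j : DForm n X p) _ (hUL z hz)
    rw [(chartAt (Model n) x).left_inv (hUs hz)] at h3
    refine h3.mono ?_
    rw [lt_div_iff₀ (by positivity)] at h2
    refine le_trans (mul_le_mul_of_nonneg_left (by linarith) (norm_nonneg _)) h2.le

end Bounds

/-! ### The volume measure -/

section Volume

theorem _root_.ContinuousOn.measurableSet_inter_preimage {α β : Type*} [TopologicalSpace α]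
    [MeasurableSpace α] [OpensMeasurableSpace α] [TopologicalSpace β] [MeasurableSpace β]
    [BorelSpace β] {f : α → β} {s : Set α} (hf : ContinuousOn f s) (hs : MeasurableSet s)
    {t : Set β} (ht : MeasurableSet t) : MeasurableSet (s ∩ f ⁻¹' t) := by
  have h1 : Measurable (fun x : s => f x) :=
    (continuousOn_iff_continuous_domRestrict.1 hf).measurable
  have h2 := hs.subtype_image (h1 ht)
  convert h2 using 1
  ext x
  simp [and_comm]

theorem restrict_iSup_le {α ι : Type*} [MeasurableSpace α] (μ : ι → Measure α) {t : Set α}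
    (ht : MeasurableSet t) : (⨆ i, μ i).restrict t ≤ ⨆ i, (μ i).restrict t := by
  have h1 : (⨆ i, μ i) ≤ (⨆ i, (μ i).restrict t) + (⨆ i, μ i).restrict tᶜ := by
    refine iSup_le fun i => ?_
    conv_lhs => rw [← Measure.restrict_add_restrict_compl (μ := μ i) ht]
    exact add_le_add (le_iSup (fun i => (μ i).restrict t) i)
      (Measure.restrict_mono le_rfl (le_iSup μ i))
  calc (⨆ i, μ i).restrict t
      ≤ ((⨆ i, (μ i).restrict t) + (⨆ i, μ i).restrict tᶜ).restrict t :=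
        Measure.restrict_mono le_rfl h1
    _ = (⨆ i, (μ i).restrict t).restrict t := by
      rw [Measure.restrict_add, Measure.restrict_restrict ht]
      simp
    _ ≤ _ := Measure.restrict_le_self

variable {n : ℕ} {X : Type*} [TopologicalSpace X]

section MeasurableCharts

variable [MeasurableSpace X] [BorelSpace X]

theorem measurableSet_target_inter_preimage (e : OpenPartialHomeomorph X (Model n)) {s : Set X}
    (hs : MeasurableSet s) : MeasurableSet (e.target ∩ e.symm ⁻¹' s) :=
  e.continuousOn_symm.measurableSet_inter_preimage e.open_target.measurableSet hs

theorem aemeasurable_symm (e : OpenPartialHomeomorph X (Model n)) :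
    AEMeasurable e.symm (volume.restrict e.target) :=
  e.continuousOn_symm.aemeasurable e.open_target.measurableSet

theorem aemeasurable_symm_withDensity (e : OpenPartialHomeomorph X (Model n))
    (f : Model n → ℝ≥0∞) : AEMeasurable e.symm ((volume.restrict e.target).withDensity f) :=
  (aemeasurable_symm e).mono_ac (withDensity_absolutelyContinuous _ _)

end MeasurableCharts

variable [ChartedSpace (Model n) X]

variable (n X) in
theorem exists_countable_charts [SecondCountableTopology X] : ∃ S : Set X, S.Countable ∧
    ⋃ x : S, (chartAt (Model n) (x : X)).source = Set.univ := by
  obtain ⟨S, hS, h⟩ := TopologicalSpace.countable_cover_nhds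
    (f := fun x : X => (chartAt (Model n) x).source)
    (fun x => (chartAt (Model n) x).open_source.mem_nhds (mem_chart_source _ x))
  exact ⟨S, hS, by rwa [Set.iUnion_subtype]⟩

variable (κ : KahlerForm n X) {e e' : OpenPartialHomeomorph X (Model n)}

/-- The density of the volume form in a chart. -/
def KahlerForm.density (e : OpenPartialHomeomorph X (Model n)) (y : Model n) : ℝ :=
  (inChart e (κ.pow (n + 1)) y (stdFrame n)).re

theorem KahlerForm.continuousOn_density (he : e ∈ atlas (Model n) X) :
    ContinuousOn (κ.density e) e.target := by
  have h1 : ContinuousOn (inChart e (κ.pow (n + 1))) e.target :=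
    ((contDiffOn_wedgePow (κ.smooth e he) (n + 1)).continuousOn).congr
      fun y _ => inChart_pow κ (n + 1) e y
  exact Complex.continuous_re.comp_continuousOn (h1.eval continuousOn_const)

theorem KahlerForm.inChart_pow_stdFrame_pos [IsManifold 𝓘(ℂ, Model n) ω X]
    (he : e ∈ atlas (Model n) X) {y : Model n}
    (hy : y ∈ e.target) : 0 < inChart e (κ.pow (n + 1)) y (stdFrame n) := by
  rw [inChart_pow]
  exact wedgePow_stdFrame_pos (κ.isMetricForm_inChart he hy)

theorem KahlerForm.density_pos [IsManifold 𝓘(ℂ, Model n) ω X]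
    (he : e ∈ atlas (Model n) X) {y : Model n}
    (hy : y ∈ e.target) : 0 < κ.density e y :=
  (Complex.lt_def.1 (κ.inChart_pow_stdFrame_pos he hy)).1

theorem compContinuousLinearMap_stdFrame (f : Alt n (2 * (n + 1))) (A : Model n →L[ℝ] Model n) :
    f.compContinuousLinearMap A (stdFrame n) = A.det • f (stdFrame n) := by
  have hfr : Module.finrank ℝ (Model n) = 2 * (n + 1) := by
    rw [← Module.finrank_mul_finrank ℝ ℂ (Model n), Complex.finrank_real_complex]
    simp [Model]
  exact map_comp_eq_det_smul (Module.finBasisOfFinrankEq ℝ _ hfr) f.toAlternatingMap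
    (A : Model n →ₗ[ℝ] Model n) (stdFrame n)

/-- Coordinate changes commute with `i`, so that they preserve the orientation: the densities of
both sides are positive, and the Jacobian determinant may be replaced by its absolute value. -/
theorem KahlerForm.density_transition [IsManifold 𝓘(ℂ, Model n) ω X]
    (he : e ∈ atlas (Model n) X) (he' : e' ∈ atlas (Model n) X)
    {y : Model n} (hy : y ∈ e.target) (hy' : e.symm y ∈ e'.source) :
    κ.density e y = |(fderiv ℝ (fun z => e' (e.symm z)) y).det| * κ.density e' (e' (e.symm y)) := by
  have h1 := inChart_transition he he' (κ.pow (n + 1)) hy hy'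
  have h2 : κ.density e y = (fderiv ℝ (fun z => e' (e.symm z)) y).det *
      κ.density e' (e' (e.symm y)) := by
    rw [density, h1, compContinuousLinearMap_stdFrame, Complex.real_smul, Complex.re_ofReal_mul]
    rfl
  have h3 := κ.density_pos he hy
  have h4 := κ.density_pos he' (e'.map_source hy')
  rw [← abs_of_pos h3, h2, abs_mul, abs_of_pos h4]

variable [MeasurableSpace X] [BorelSpace X]

theorem KahlerForm.chartMeasure_apply (e : OpenPartialHomeomorph X (Model n)) {s : Set X}
    (hs : MeasurableSet s) :
    κ.chartMeasure e s = ∫⁻ y in e.target ∩ e.symm ⁻¹' s, ENNReal.ofReal (κ.density e y) := by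
  rw [chartMeasure, Measure.map_apply_of_aemeasurable (aemeasurable_symm_withDensity e _) hs,
    withDensity_apply', Measure.restrict_restrict' e.open_target.measurableSet, Set.inter_comm]
  rfl

variable [IsManifold 𝓘(ℂ, Model n) ω X]

/-- The measures attached to two charts agree on the intersection of the domains. -/
theorem KahlerForm.chartMeasure_eq (he : e ∈ atlas (Model n) X) (he' : e' ∈ atlas (Model n) X)
    {s : Set X} (hs : MeasurableSet s) (hse : s ⊆ e.source) (hse' : s ⊆ e'.source) :
    κ.chartMeasure e s = κ.chartMeasure e' s := by
  rw [κ.chartMeasure_apply e hs, κ.chartMeasure_apply e' hs]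
  have him : e'.target ∩ e'.symm ⁻¹' s = (fun z => e' (e.symm z)) '' (e.target ∩ e.symm ⁻¹' s) := by
    ext z
    constructor
    · rintro ⟨hz, hzs⟩
      refine ⟨e (e'.symm z), ⟨e.map_source (hse hzs), ?_⟩, ?_⟩
      · simpa [e.left_inv (hse hzs)] using hzs
      · simp [e.left_inv (hse hzs), e'.right_inv hz]
    · rintro ⟨y, ⟨hy, hys⟩, rfl⟩
      refine ⟨e'.map_source (hse' hys), ?_⟩
      simpa [e'.left_inv (hse' hys)] using hys
  have hm := measurableSet_target_inter_preimage e hs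
  rw [him, lintegral_image_eq_lintegral_abs_det_fderiv_mul volume hm
    (f' := fun y => fderiv ℝ (fun z => e' (e.symm z)) y)]
  · refine setLIntegral_congr_fun hm fun y hy => ?_
    rw [κ.density_transition he he' hy.1 (hse' hy.2), ENNReal.ofReal_mul (abs_nonneg _)]
  · intro y hy
    exact (differentiableAt_transition he he' hy.1 (hse' hy.2)).hasFDerivAt.hasFDerivWithinAt
  · intro y hy z hz h
    have h1 : e.symm y = e.symm z := e'.injOn (hse' hy.2) (hse' hz.2) h
    rw [← e.right_inv hy.1, ← e.right_inv hz.1, h1]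

theorem KahlerForm.chartMeasure_restrict_le (he : e ∈ atlas (Model n) X)
    (he' : e' ∈ atlas (Model n) X) :
    (κ.chartMeasure e').restrict e.source ≤ κ.chartMeasure e := by
  refine Measure.le_iff.2 fun s hs => ?_
  rw [Measure.restrict_apply hs]
  have h1 : κ.chartMeasure e' (s ∩ e.source) = κ.chartMeasure e' (s ∩ e.source ∩ e'.source) := by
    rw [κ.chartMeasure_apply e' (hs.inter e.open_source.measurableSet),
      κ.chartMeasure_apply e' ((hs.inter e.open_source.measurableSet).inter
        e'.open_source.measurableSet)]
    congr 2
    ext y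
    simp only [Set.mem_inter_iff, Set.mem_preimage]
    constructor
    · rintro ⟨h1, h2⟩; exact ⟨h1, h2, e'.map_target h1⟩
    · rintro ⟨h1, h2, -⟩; exact ⟨h1, h2⟩
  rw [h1, ← κ.chartMeasure_eq he he' ((hs.inter e.open_source.measurableSet).inter
    e'.open_source.measurableSet) (fun x hx => hx.1.2) (fun x hx => hx.2)]
  exact measure_mono fun x hx => hx.1.1

/-- On the domain of a chart, the volume measure is the measure attached to the chart. For the
inequality `≥`, `X` is covered by countably many of the charts in the supremum. -/
theorem KahlerForm.vol_restrict_source [SecondCountableTopology X] (he : e ∈ atlas (Model n) X) :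
    κ.vol.restrict e.source = κ.chartMeasure e := by
  have hle : κ.vol.restrict e.source ≤ κ.chartMeasure e :=
    (restrict_iSup_le _ e.open_source.measurableSet).trans
      (iSup_le fun x => κ.chartMeasure_restrict_le he (chart_mem_atlas _ x))
  obtain ⟨S, hS, hcov⟩ := exists_countable_charts n X
  have := hS.to_subtype
  refine (Measure.ext_iff_of_iUnion_eq_univ hcov).2 fun x => le_antisymm
    (Measure.restrict_mono le_rfl hle) ?_
  set c := chartAt (Model n) (x : X) with hc
  have h1 : (κ.chartMeasure e).restrict c.source ≤ κ.vol :=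
    (κ.chartMeasure_restrict_le (chart_mem_atlas _ _) he).trans
      (le_iSup (fun x => κ.chartMeasure (chartAt (Model n) x)) (x : X))
  have h2 : (κ.chartMeasure e).restrict e.source = κ.chartMeasure e := by
    refine Measure.ext fun s hs => ?_
    rw [Measure.restrict_apply hs, κ.chartMeasure_apply e hs,
      κ.chartMeasure_apply e (hs.inter e.open_source.measurableSet)]
    congr 2
    ext y
    simp only [Set.mem_inter_iff, Set.mem_preimage]
    constructor
    · rintro ⟨h1, h2, -⟩; exact ⟨h1, h2⟩
    · rintro ⟨h1, h2⟩; exact ⟨h1, h2, e.map_target h1⟩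
  have hm := c.open_source.measurableSet
  have hm' := e.open_source.measurableSet
  calc (κ.chartMeasure e).restrict c.source
      = (((κ.chartMeasure e).restrict c.source).restrict e.source).restrict c.source := by
        conv_lhs => rw [← h2]
        rw [Measure.restrict_restrict hm, Measure.restrict_restrict hm',
          Measure.restrict_restrict hm]
        congr 1
        ext z; simp; tauto
    _ ≤ _ := Measure.restrict_mono le_rfl (Measure.restrict_mono le_rfl h1)

theorem KahlerForm.isLocallyFiniteMeasure_vol [SecondCountableTopology X] :
    IsLocallyFiniteMeasure κ.vol := by
  refine ⟨fun x => ?_⟩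
  obtain ⟨L, hL, hLc, U, hU, hUs, hUL⟩ := exists_compact_chart_nhds (n := n) x
  set c := chartAt (Model n) x
  have hc : c ∈ atlas (Model n) X := chart_mem_atlas _ x
  obtain ⟨V, hVU, hV, hxV⟩ := mem_nhds_iff.1 hU
  refine ⟨V, hV.mem_nhds hxV, ?_⟩
  have h1 : κ.vol V = κ.chartMeasure c V := by
    rw [← κ.vol_restrict_source hc, Measure.restrict_apply hV.measurableSet,
      Set.inter_eq_left.2 (hVU.trans hUs)]
  obtain ⟨M, hM⟩ := hL.exists_bound_of_continuousOn ((κ.continuousOn_density hc).mono hLc)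
  rw [h1, κ.chartMeasure_apply c hV.measurableSet]
  have hsub : c.target ∩ c.symm ⁻¹' V ⊆ L := by
    rintro y ⟨hy, hyV⟩
    have := hUL _ (hVU hyV)
    rwa [c.right_inv hy] at this
  calc ∫⁻ y in c.target ∩ c.symm ⁻¹' V, ENNReal.ofReal (κ.density c y)
      ≤ ∫⁻ y in L, ENNReal.ofReal (κ.density c y) := lintegral_mono_set hsub
    _ ≤ ∫⁻ _ in L, ENNReal.ofReal M := by
      refine setLIntegral_mono' hL.measurableSet fun y hy => ENNReal.ofReal_le_ofReal ?_
      exact (le_abs_self _).trans (hM y hy)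
    _ < ⊤ := by
      rw [setLIntegral_const]
      exact ENNReal.mul_lt_top ENNReal.ofReal_lt_top hL.measure_lt_top

/-- As the density is positive, null sets for the volume measure are Lebesgue null sets in
charts. -/
theorem KahlerForm.ae_chart [SecondCountableTopology X] {P : X → Prop} (h : ∀ᵐ x ∂κ.vol, P x)
    (he : e ∈ atlas (Model n) X) : ∀ᵐ y ∂volume.restrict e.target, P (e.symm y) := by
  have h1 : ∀ᵐ x ∂κ.chartMeasure e, P x := by
    rw [← κ.vol_restrict_source he]
    exact ae_restrict_of_ae h
  have h2 := ae_of_ae_map (aemeasurable_symm_withDensity e _) h1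
  have h3 : AEMeasurable (fun y => ENNReal.ofReal (inChart e (κ.pow (n + 1)) y (stdFrame n)).re)
      (volume.restrict e.target) := (((κ.continuousOn_density he).aemeasurable
    e.open_target.measurableSet).ennreal_ofReal)
  rw [ae_withDensity_iff' h3] at h2
  filter_upwards [h2, ae_restrict_mem e.open_target.measurableSet] with y hy hye
  refine hy ?_
  have := κ.density_pos he hye
  exact (ENNReal.ofReal_pos.2 this).ne'

theorem KahlerForm.aestronglyMeasurable_of_charts [SecondCountableTopology X] {E : Type*}
    [TopologicalSpace E] [TopologicalSpace.PseudoMetrizableSpace E] {f : X → E}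
    (h : ∀ e ∈ atlas (Model n) X,
      AEStronglyMeasurable (fun y => f (e.symm y)) (volume.restrict e.target)) :
    AEStronglyMeasurable f κ.vol := by
  obtain ⟨S, hS, hcov⟩ := exists_countable_charts n X
  have := hS.to_subtype
  rw [← Measure.restrict_univ (μ := κ.vol), ← hcov, aestronglyMeasurable_iUnion_iff]
  intro x
  set c := chartAt (Model n) (x : X)
  have hc : c ∈ atlas (Model n) X := chart_mem_atlas _ _
  have hm : AEMeasurable c (κ.vol.restrict c.source) :=
    c.continuousOn.aemeasurable c.open_source.measurableSet
  have hmap : Measure.map c (κ.vol.restrict c.source) =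
      (volume.restrict c.target).withDensity
        (fun y => ENNReal.ofReal (inChart c (κ.pow (n + 1)) y (stdFrame n)).re) := by
    rw [κ.vol_restrict_source hc] at hm ⊢
    rw [chartMeasure, AEMeasurable.map_map_of_aemeasurable hm (aemeasurable_symm_withDensity c _)]
    refine (Measure.map_congr ?_).trans Measure.map_id
    refine (withDensity_absolutelyContinuous _ _).ae_le ?_
    filter_upwards [ae_restrict_mem c.open_target.measurableSet] with y hy
    exact c.right_inv hy
  have h1 : AEStronglyMeasurable ((fun y => f (c.symm y)) ∘ c) (κ.vol.restrict c.source) := by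
    refine AEStronglyMeasurable.comp_aemeasurable ?_ hm
    rw [hmap]
    exact (h c hc).mono_ac (withDensity_absolutelyContinuous _ _)
  refine h1.congr ?_
  filter_upwards [ae_restrict_mem c.open_source.measurableSet] with z hz
  simp [c.left_inv hz]

end Volume

/-! ### Pointwise estimates -/

section Pointwise

variable {n m : ℕ} {β : Alt n 2}

theorem wedge_gradForm_div_nonneg (hβ : IsMetricForm β) {f : Alt n (2 * n)}
    (hf : IsPositiveForm f) (α : Model n →L[ℝ] ℝ) :
    0 ≤ (wedge f (gradForm α) : Alt n (2 * (n + 1))) (stdFrame n) /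
      wedgePow β (n + 1) (stdFrame n) := by
  have h1 : 0 ≤ (wedge f (gradForm α) : Alt n (2 * (n + 1))) (stdFrame n) :=
    (hf.wedge_gradForm α).2 _
  have h2 := wedgePow_stdFrame_pos hβ
  rw [Complex.le_def] at h1
  rw [Complex.lt_def] at h2
  have e1 : ((wedge f (gradForm α) : Alt n (2 * (n + 1))) (stdFrame n)) =
      (((wedge f (gradForm α) : Alt n (2 * (n + 1))) (stdFrame n)).re : ℂ) :=
    Complex.ext rfl (by rw [← h1.2]; rfl)
  have e2 : wedgePow β (n + 1) (stdFrame n) = ((wedgePow β (n + 1) (stdFrame n)).re : ℂ) :=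
    Complex.ext rfl (by rw [← h2.2]; rfl)
  rw [e1, e2, ← Complex.ofReal_div]
  exact_mod_cast div_nonneg h1.1 h2.1.le

/-- Positive forms that are bounded by `C` satisfy `f ∧ i α^{1,0} ∧ α^{0,1} ≤ C |α|² βᵏ`. -/
theorem wedge_gradForm_div_le (hβ : IsMetricForm β) {f : Alt n (2 * n)}
    (hf : IsPositiveForm f) {C : ℝ} (hC : 0 ≤ C) (hb : FormBound β C f) (α : Model n →L[ℝ] ℝ) :
    ((wedge f (gradForm α) : Alt n (2 * (n + 1))) (stdFrame n) /
      wedgePow β (n + 1) (stdFrame n)).re ≤ C * (dualNorm β α).toReal ^ 2 := by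
  have hneg : FormBound β C ((-1 : ℂ) • f) := fun w => by
    have := hb w
    simpa using this
  have h1 := isPositiveForm_smul_wedgePow_add hβ hC hneg (hf.1.smul _) (fun v => by
    have := (Complex.le_def.1 (hf.2 v)).2
    simp [← this])
  have h2 := wedge_gradForm_div_nonneg hβ h1 α
  have h3 : wedge ((C : ℂ) • wedgePow β n + (-1 : ℂ) • f) (gradForm α) =
      (C : ℂ) • wedge (wedgePow β n) (gradForm α) + (-1 : ℂ) • wedge f (gradForm α) := by
    rw [wedge_add_left, wedge_smul_left, wedge_smul_left]
  rw [h3] at h2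
  have h4 := dualNorm_sq hβ α
  have h5 := wedge_gradForm_div_nonneg hβ (isPositiveForm_wedgePow hβ n) α
  set q := (wedge (wedgePow β n) (gradForm α) : Alt n (2 * (n + 1))) (stdFrame n) /
      wedgePow β (n + 1) (stdFrame n) with hq
  have h6 : ((C : ℂ) • wedge (wedgePow β n) (gradForm α) + (-1 : ℂ) • wedge f (gradForm α) :
      Alt n (2 * (n + 1))) (stdFrame n) / wedgePow β (n + 1) (stdFrame n) =
      C * q - (wedge f (gradForm α) : Alt n (2 * (n + 1))) (stdFrame n) /
        wedgePow β (n + 1) (stdFrame n) := by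
    change ((C : ℂ) • (wedge (wedgePow β n) (gradForm α) : Alt n (2 * (n + 1))) (stdFrame n) +
      (-1 : ℂ) • (wedge f (gradForm α) : Alt n (2 * (n + 1))) (stdFrame n)) / _ = _
    rw [hq, smul_eq_mul, smul_eq_mul]
    ring
  have h7 : 0 ≤ (C * q - (wedge f (gradForm α) : Alt n (2 * (n + 1))) (stdFrame n) /
        wedgePow β (n + 1) (stdFrame n)).re := by
    have := (Complex.le_def.1 h2).1
    rw [← h6]; exact this
  rw [Complex.sub_re, Complex.re_ofReal_mul] at h7
  have h8 : 0 ≤ q.re := (Complex.le_def.1 h5).1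
  have h9 : (dualNorm β α).toReal ^ 2 = 2 * (n + 1) * q.re := by
    rw [← ENNReal.toReal_pow, h4, ENNReal.toReal_ofReal (by positivity)]
  rw [h9]
  have h10 : q.re ≤ 2 * (n + 1) * q.re := by
    have : (0 : ℝ) ≤ n := n.cast_nonneg
    nlinarith
  nlinarith [mul_le_mul_of_nonneg_left h10 hC]

theorem norm_div_wedgePow_le (hβ : IsMetricForm β) {f : Alt n (2 * (n + 1))} {C : ℝ}
    (hb : FormBound β C f) :
    ‖f (stdFrame n) / wedgePow β (n + 1) (stdFrame n)‖ ≤ C := by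
  obtain ⟨v, hv⟩ := exists_hermOrthonormal hβ
  rw [(div_wedgePow_stdFrame hβ f v hv).2, norm_div, Complex.norm_natCast]
  have h3 : (1 : ℝ) ≤ (n + 1).factorial := by exact_mod_cast (n + 1).factorial_pos
  refine (div_le_self (norm_nonneg _) h3).trans ((hb _).trans (le_of_eq ?_))
  simp [hv.sqLen_eq hβ]

/-- The Cauchy–Schwarz inequality for the wedge product with a positive form. -/
theorem wedge_gradForm_add_le (hβ : IsMetricForm β) {f : Alt n (2 * n)}
    (hf : IsPositiveForm f) (α γ : Model n →L[ℝ] ℝ) {r : ℝ} (hr : r ≠ 0) :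
    ((wedge f (gradForm (α + γ)) : Alt n (2 * (n + 1))) (stdFrame n) /
      wedgePow β (n + 1) (stdFrame n)).re ≤
    (1 + r ^ 2) * ((wedge f (gradForm α) : Alt n (2 * (n + 1))) (stdFrame n) /
      wedgePow β (n + 1) (stdFrame n)).re +
    (1 + (r ^ 2)⁻¹) * ((wedge f (gradForm γ) : Alt n (2 * (n + 1))) (stdFrame n) /
      wedgePow β (n + 1) (stdFrame n)).re := by
  have h0 := (Complex.le_def.1 (wedge_gradForm_div_nonneg hβ hf (r • α + (-r⁻¹) • γ))).1
  have h1 : wedge f (gradForm (r • α + (-r⁻¹) • γ)) + wedge f (gradForm (α + γ)) =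
      (1 + r ^ 2) • wedge f (gradForm α) + (1 + (r ^ 2)⁻¹) • wedge f (gradForm γ) := by
    rw [← wedge_add_right, gradForm_add_add α γ hr, wedge_add_right, wedge_real_smul_right,
      wedge_real_smul_right]
  have h2 := DFunLike.congr_fun h1 (stdFrame n : Fin (2 * n + 2) → Model n)
  rw [ContinuousAlternatingMap.add_apply, ContinuousAlternatingMap.add_apply,
    ContinuousAlternatingMap.smul_apply, ContinuousAlternatingMap.smul_apply,
    Complex.real_smul, Complex.real_smul] at h2
  have h3 : ∀ a b c d D : ℂ, ∀ s t : ℝ, a + b = s * c + t * d → 0 ≤ (a / D).re →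
      (b / D).re ≤ s * (c / D).re + t * (d / D).re := by
    intro a b c d D s t h h'
    have h4 : a / D + b / D = s * (c / D) + t * (d / D) := by
      rw [← add_div, h]; ring
    have h5 := congrArg Complex.re h4
    rw [Complex.add_re, Complex.add_re, Complex.re_ofReal_mul, Complex.re_ofReal_mul] at h5
    linarith
  exact h3 _ _ _ _ _ _ _ h2 h0

theorem norm_le_dualNorm (hβ : IsMetricForm β) (a : Model n →L[ℝ] ℝ) :
    ‖a‖ ≤ Real.sqrt ‖β‖ * (dualNorm β a).toReal := by
  refine a.opNorm_le_bound (by positivity) fun v => ?_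
  have h1 := enorm_apply_le_dualNorm hβ a v
  have h2 := ENNReal.toReal_mono
    (ENNReal.mul_ne_top ENNReal.ofReal_ne_top (dualNorm_lt_top hβ a).ne) h1
  rw [toReal_enorm, ENNReal.toReal_mul, ENNReal.toReal_ofReal (Real.sqrt_nonneg _)] at h2
  have h3 : sqLen β v ≤ ‖β‖ * ‖v‖ ^ 2 := by
    refine (le_abs_self _).trans ((Complex.abs_re_le_norm _).trans ?_)
    refine (β.le_opNorm _).trans (le_of_eq ?_)
    rw [Fin.prod_univ_two]
    simp [norm_smul, pow_two]
  have h4 : Real.sqrt (sqLen β v) ≤ Real.sqrt ‖β‖ * ‖v‖ := by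
    refine (Real.sqrt_le_sqrt h3).trans (le_of_eq ?_)
    rw [Real.sqrt_mul (norm_nonneg _), Real.sqrt_sq (norm_nonneg _)]
  calc ‖a v‖ ≤ _ := h2
    _ ≤ (Real.sqrt ‖β‖ * ‖v‖) * (dualNorm β a).toReal :=
      mul_le_mul_of_nonneg_right h4 ENNReal.toReal_nonneg
    _ = _ := by ring

theorem dualNorm_smul (c : ℝ) (a : Model n →L[ℝ] ℝ) :
    dualNorm β (c • a) = ‖c‖ₑ * dualNorm β a := by
  unfold dualNorm
  rw [ENNReal.mul_iSup]
  refine iSup_congr fun v => ?_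
  rw [ENNReal.mul_iSup]
  refine iSup_congr fun hv => ?_
  rw [smul_apply, smul_eq_mul, enorm_mul]

theorem dualNorm_zero : dualNorm β 0 = 0 := by
  simp [dualNorm]

theorem dualNorm_sum_le (s : Finset ℕ) (a : ℕ → Model n →L[ℝ] ℝ) :
    dualNorm β (∑ j ∈ s, a j) ≤ ∑ j ∈ s, dualNorm β (a j) := by
  classical
  induction s using Finset.induction_on with
  | empty => simp [dualNorm_zero]
  | insert j s hj ih =>
    rw [Finset.sum_insert hj, Finset.sum_insert hj]
    exact (dualNorm_add_le _ _ _).trans (add_le_add_right ih _)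

/-- The dual norm is lower semicontinuous. -/
theorem dualNorm_le_of_tendsto {a : ℕ → Model n →L[ℝ] ℝ} {b : Model n →L[ℝ] ℝ}
    (h : Tendsto a atTop (𝓝 b)) {S : ℝ≥0∞} (hS : ∀ j, dualNorm β (a j) ≤ S) :
    dualNorm β b ≤ S := by
  refine iSup₂_le fun v hv => ?_
  have h1 : Tendsto (fun j => ‖a j v‖ₑ) atTop (𝓝 ‖b v‖ₑ) :=
    ((ContinuousLinearMap.apply ℝ ℝ v).continuous.tendsto b |>.comp h).enorm
  refine le_of_tendsto' h1 fun j => (le_trans ?_ (hS j))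
  exact le_iSup₂ (f := fun u (_ : sqLen β u ≤ 1) => ‖a j u‖ₑ) v hv

theorem continuous_gradForm_apply (v : Fin 2 → Model n) :
    Continuous fun a : Model n →L[ℝ] ℝ => gradForm a v := by
  have h : ∀ u : Model n, Continuous fun a : Model n →L[ℝ] ℝ => lin10 a u := by
    intro u
    simp only [lin10_apply, part10_apply]
    fun_prop
  simp only [gradForm_apply]
  exact continuous_const.mul (((h _).mul (Complex.continuous_conj.comp (h _))).sub
    ((h _).mul (Complex.continuous_conj.comp (h _))))

theorem continuous_wedge_gradForm_apply (v : Fin (2 * n + 2) → Model n) :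
    Continuous fun z : Alt n (2 * n) × (Model n →L[ℝ] ℝ) => wedge z.1 (gradForm z.2) v := by
  simp only [wedge_apply]
  refine continuous_const.mul (continuous_finsetSum _ fun σ _ => continuous_const.mul ?_)
  refine Continuous.mul ?_ ((continuous_gradForm_apply _).comp continuous_snd)
  exact continuous_fst.eval continuous_const

theorem continuous_wedge_oneForm_apply (h : 1 + (2 * n + 1) = 2 * (n + 1))
    (v : Fin (2 * (n + 1)) → Model n) :
    Continuous fun z : Alt n (2 * n + 1) × (Model n →L[ℝ] ℝ) =>
      castDeg h (wedge (oneForm (Complex.ofRealCLM.comp z.2)) z.1) v := by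
  simp only [castDeg_apply, wedge_apply]
  refine continuous_const.mul (continuous_finsetSum _ fun σ _ => continuous_const.mul ?_)
  refine Continuous.mul ?_ (continuous_fst.eval continuous_const)
  change Continuous fun z : Alt n (2 * n + 1) × (Model n →L[ℝ] ℝ) => ((z.2 _ : ℝ) : ℂ)
  exact Complex.continuous_ofReal.comp (continuous_snd.clm_apply continuous_const)

end Pointwise

/-! ### Integrals of forms -/

section Integrals

variable {n : ℕ} {X : Type*} [TopologicalSpace X] [ChartedSpace (Model n) X]

theorem covNorm_eq [MeasurableSpace X] (κ : KahlerForm n X) (x : X) (a : Model n →L[ℝ] ℝ) :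
    κ.covNorm x a = dualNorm (κ.form x) a := rfl

/-- The density of `η ∧ i α^{1,0} ∧ α^{0,1}` with respect to the volume form. -/
def KahlerForm.gradPair (κ : KahlerForm n X) (η : DForm n X (2 * n))
    (α : X → Model n →L[ℝ] ℝ) : X → ℂ :=
  κ.ratio fun x => wedge (η x) (gradForm (α x))

/-- The density of `α ∧ η` with respect to the volume form. -/
def KahlerForm.covPair (κ : KahlerForm n X) (α : X → Model n →L[ℝ] ℝ)
    (η : DForm n X (2 * n + 1)) : X → ℂ :=
  κ.ratio fun x => castDeg (show 1 + (2 * n + 1) = 2 * (n + 1) by omega)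
    (wedge (oneForm (Complex.ofRealCLM.comp (α x))) (η x))

/-- Real `1`-forms with measurable coefficients in every chart. -/
def MeasurableOneForm (α : X → Model n →L[ℝ] ℝ) : Prop :=
  ∀ e ∈ atlas (Model n) X,
    AEStronglyMeasurable (fun y => (α (e.symm y)).comp (invDiff e y)) (volume.restrict e.target)

/-- Forms with continuous coefficients in every chart. -/
def ContForm {p : ℕ} (η : DForm n X p) : Prop :=
  ∀ e ∈ atlas (Model n) X, ContinuousOn (inChart e η) e.target

theorem SmoothForm.contForm {p : ℕ} {η : DForm n X p} (hη : SmoothForm η) : ContForm η :=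
  fun e he => (hη e he).continuousOn

theorem KahlerForm.contForm_pow (κ : KahlerForm n X) (m : ℕ) : ContForm (κ.pow m) := fun e he =>
  ((contDiffOn_wedgePow (κ.smooth e he) m).continuousOn).congr fun y _ => inChart_pow κ m e y

/-- The squared norm of a `1`-form is the density of its product with `κ^{k-1}`. -/
theorem KahlerForm.covNorm_sq (κ : KahlerForm n X) (α : X → Model n →L[ℝ] ℝ) (x : X) :
    κ.covNorm x (α x) ^ 2 =
      ENNReal.ofReal (2 * (n + 1) * (κ.gradPair (κ.pow n) α x).re) :=
  dualNorm_sq (κ.isMetricForm x) (α x)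

theorem KahlerForm.covNorm_lt_top (κ : KahlerForm n X) (x : X) (a : Model n →L[ℝ] ℝ) :
    κ.covNorm x a < ⊤ :=
  dualNorm_lt_top (κ.isMetricForm x) a

theorem KahlerForm.gradPair_nonneg (κ : KahlerForm n X) {η : DForm n X (2 * n)}
    (hη : ∀ x, IsPositiveForm (η x))
    (α : X → Model n →L[ℝ] ℝ) (x : X) : 0 ≤ κ.gradPair η α x :=
  wedge_gradForm_div_nonneg (κ.isMetricForm x) (hη x) (α x)

theorem KahlerForm.gradPair_eq (κ : KahlerForm n X) {η : DForm n X (2 * n)}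
    (hη : ∀ x, IsPositiveForm (η x))
    (α : X → Model n →L[ℝ] ℝ) (x : X) :
    κ.gradPair η α x = ((κ.gradPair η α x).re : ℂ) := by
  have := (Complex.le_def.1 (κ.gradPair_nonneg hη α x)).2
  exact Complex.ext rfl (by rw [← this]; rfl)

theorem KahlerForm.integral_wedge_gradForm [MeasurableSpace X] (κ : KahlerForm n X)
    {Ψ : TestForm n X (2 * n)}
    (hΨ : ∀ x, IsPositiveForm ((Ψ : DForm n X (2 * n)) x)) (α : X → Model n →L[ℝ] ℝ) :
    κ.integral (fun x => wedge ((Ψ : DForm n X (2 * n)) x) (gradForm (α x))) =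
      ((∫ x, (κ.gradPair Ψ α x).re ∂κ.vol : ℝ) : ℂ) := by
  rw [← integral_complex_ofReal]
  exact integral_congr_ae (Eventually.of_forall fun x => κ.gradPair_eq hΨ α x)

theorem KahlerForm.integral_smul_extD [MeasurableSpace X] (κ : KahlerForm n X) (φ : X → ℝ)
    (η : TestForm n X (2 * n + 1)) :
    κ.integral (fun x => (φ x : ℂ) • extD (η : DForm n X (2 * n + 1)) x) =
      ∫ x, φ x • κ.ratio (extD (η : DForm n X (2 * n + 1))) x ∂κ.vol := by
  refine integral_congr_ae (Eventually.of_forall fun x => ?_)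
  have : ((φ x : ℂ) • extD (η : DForm n X (2 * n + 1)) x) (stdFrame n) =
    (φ x : ℂ) * extD (η : DForm n X (2 * n + 1)) x (stdFrame n) := rfl
  simp only [ratio, Complex.real_smul]
  rw [← mul_div_assoc]
  rfl

variable [IsManifold 𝓘(ℂ, Model n) ω X]

theorem KahlerForm.ratio_chart (κ : KahlerForm n X) (η : DForm n X (2 * (n + 1)))
    {e : OpenPartialHomeomorph X (Model n)} (he : e ∈ atlas (Model n) X) {y : Model n}
    (hy : y ∈ e.target) : κ.ratio η (e.symm y) =
      inChart e η y (stdFrame n) / inChart e (κ.pow (n + 1)) y (stdFrame n) := by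
  have h0 := (κ.inChart_pow_stdFrame_pos he hy).ne'
  rw [ratio, inChart, inChart, compContinuousLinearMap_stdFrame, compContinuousLinearMap_stdFrame,
    Complex.real_smul, Complex.real_smul]
  rw [inChart, compContinuousLinearMap_stdFrame, Complex.real_smul] at h0
  rw [mul_div_mul_left _ _ (left_ne_zero_of_mul h0)]

/-- For positive test forms the density of `Ψ ∧ i α^{1,0} ∧ α^{0,1}` is dominated by `|α|²`. -/
theorem KahlerForm.exists_gradPair_le (κ : KahlerForm n X) (Ψ : TestForm n X (2 * n))
    (hΨ : ∀ x, IsPositiveForm ((Ψ : DForm n X (2 * n)) x)) :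
    ∃ C : ℝ, 0 ≤ C ∧ ∀ (α : X → Model n →L[ℝ] ℝ) (x : X),
      (κ.gradPair Ψ α x).re ≤ C * (κ.covNorm x (α x)).toReal ^ 2 := by
  obtain ⟨C, hC, h⟩ := exists_formBound κ (SmoothForm.contForm Ψ.2.1) Ψ.2.2
  exact ⟨C, hC, fun α x => wedge_gradForm_div_le (κ.isMetricForm x) (hΨ x) hC (h x) (α x)⟩

/-- The density of `α ∧ η` is dominated by `|α|` on the support of `η`. -/
theorem KahlerForm.exists_covPair_le (κ : KahlerForm n X) (η : TestForm n X (2 * n + 1)) :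
    ∃ C : ℝ, 0 ≤ C ∧ ∀ (α : X → Model n →L[ℝ] ℝ) (x : X), ‖κ.covPair α η x‖ ≤
      (tsupport (η : DForm n X (2 * n + 1))).indicator (fun _ => C) x *
        (κ.covNorm x (α x)).toReal := by
  obtain ⟨C, hC, h⟩ := exists_formBound κ (SmoothForm.contForm η.2.1) η.2.2
  refine ⟨(1 + (2 * n + 1)).factorial * C, by positivity, fun α x => ?_⟩
  by_cases hx : x ∈ tsupport (η : DForm n X (2 * n + 1))
  · rw [Set.indicator_of_mem hx]
    exact norm_wedge_oneForm_div_le (κ.isMetricForm x) (α x) _ _ hC (h x)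
  · rw [Set.indicator_of_notMem hx, zero_mul]
    have h0 := norm_wedge_oneForm_div_le (κ.isMetricForm x) (α x) ((η : DForm n X (2 * n + 1)) x)
      (by omega) le_rfl (ε := 0) (by
        intro w
        rw [image_eq_zero_of_notMem_tsupport hx]
        simp)
    rw [mul_zero, zero_mul] at h0
    exact h0

variable [MeasurableSpace X] [BorelSpace X] [SecondCountableTopology X] (κ : KahlerForm n X)

theorem KahlerForm.aestronglyMeasurable_ratio {η : DForm n X (2 * (n + 1))}
    (hη : ∀ e ∈ atlas (Model n) X, AEStronglyMeasurable (fun y => inChart e η y (stdFrame n))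
      (volume.restrict e.target)) : AEStronglyMeasurable (κ.ratio η) κ.vol := by
  refine κ.aestronglyMeasurable_of_charts fun e he => ?_
  have h1 : AEStronglyMeasurable (fun y => inChart e (κ.pow (n + 1)) y (stdFrame n))
      (volume.restrict e.target) :=
    ((κ.contForm_pow (n + 1) e he).eval continuousOn_const).aestronglyMeasurable
      e.open_target.measurableSet
  refine (((hη e he).aemeasurable.div h1.aemeasurable).aestronglyMeasurable).congr ?_
  filter_upwards [ae_restrict_mem e.open_target.measurableSet] with y hy
  exact (κ.ratio_chart η he hy).symm

theorem KahlerForm.aestronglyMeasurable_ratio_of_contForm {η : DForm n X (2 * (n + 1))}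
    (hη : ContForm η) : AEStronglyMeasurable (κ.ratio η) κ.vol :=
  κ.aestronglyMeasurable_ratio fun e he =>
    ((hη e he).eval continuousOn_const).aestronglyMeasurable e.open_target.measurableSet

theorem KahlerForm.aestronglyMeasurable_gradPair {η : DForm n X (2 * n)} (hη : ContForm η)
    {α : X → Model n →L[ℝ] ℝ} (hα : MeasurableOneForm α) :
    AEStronglyMeasurable (κ.gradPair η α) κ.vol := by
  refine κ.aestronglyMeasurable_ratio fun e he => ?_
  have h1 := (continuous_wedge_gradForm_apply (n := n) (stdFrame n)).comp_aestronglyMeasurable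
    (((hη e he).aestronglyMeasurable e.open_target.measurableSet).prodMk (hα e he))
  refine h1.congr ?_
  filter_upwards [ae_restrict_mem e.open_target.measurableSet] with y hy
  have h2 := wedge_compContinuousLinearMap (η (e.symm y)) (gradForm (α (e.symm y))) (invDiff e y)
  rw [gradForm_compContinuousLinearMap _ _ (commutesI_invDiff he hy)] at h2
  exact congrArg (fun f : Alt n (2 * n + 2) => f (stdFrame n)) h2.symm

theorem KahlerForm.aestronglyMeasurable_covPair {η : DForm n X (2 * n + 1)} (hη : ContForm η)
    {α : X → Model n →L[ℝ] ℝ} (hα : MeasurableOneForm α) :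
    AEStronglyMeasurable (κ.covPair α η) κ.vol := by
  refine κ.aestronglyMeasurable_ratio fun e he => ?_
  have h1 := (continuous_wedge_oneForm_apply (n := n) (by omega)
    (stdFrame n)).comp_aestronglyMeasurable
    (((hη e he).aestronglyMeasurable e.open_target.measurableSet).prodMk (hα e he))
  refine h1.congr (Eventually.of_forall fun y => ?_)
  have h2 := wedge_compContinuousLinearMap (oneForm (Complex.ofRealCLM.comp (α (e.symm y))))
    (η (e.symm y)) (invDiff e y)
  simp only [castDeg_apply, inChart, ContinuousAlternatingMap.compContinuousLinearMap_apply,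
    Function.comp_def]
  exact (congrArg (fun f : Alt n (1 + (2 * n + 1)) =>
    f (fun i => stdFrame n (Fin.cast (by omega) i))) h2.symm)

theorem KahlerForm.aemeasurable_covNorm {α : X → Model n →L[ℝ] ℝ} (hα : MeasurableOneForm α) :
    AEMeasurable (fun x => κ.covNorm x (α x)) κ.vol := by
  have h1 : AEMeasurable (fun x => κ.covNorm x (α x) ^ 2) κ.vol := by
    simp only [κ.covNorm_sq]
    exact ((Complex.measurable_re.comp_aemeasurable
      (κ.aestronglyMeasurable_gradPair (κ.contForm_pow n) hα).aemeasurable).const_mul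
        _).ennreal_ofReal
  have h2 := h1.pow_const (1 / 2 : ℝ)
  refine h2.congr (Eventually.of_forall fun x => ?_)
  simp only
  rw [← ENNReal.rpow_natCast, ← ENNReal.rpow_mul]
  norm_num

/-- The pointwise norm of a form with `L²` coefficients is in `L²`. -/
theorem KahlerForm.IsL2OneForm.memLp {α : X → Model n →L[ℝ] ℝ} (hα : κ.IsL2OneForm α) :
    MemLp (fun x => (κ.covNorm x (α x)).toReal) 2 κ.vol := by
  refine ⟨(κ.aemeasurable_covNorm hα.1).ennreal_toReal.aestronglyMeasurable, ?_⟩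
  rw [eLpNorm_lt_top_iff_lintegral_rpow_enorm_lt_top (by norm_num) (by norm_num)]
  refine lt_of_le_of_lt (lintegral_mono fun x => ?_) hα.2
  simp only [ENNReal.toReal_ofNat]
  rw [Real.enorm_of_nonneg ENNReal.toReal_nonneg, ENNReal.ofReal_toReal (κ.covNorm_lt_top x _).ne]
  norm_num

theorem KahlerForm.integrable_gradPair {Ψ : TestForm n X (2 * n)}
    (hΨ : ∀ x, IsPositiveForm ((Ψ : DForm n X (2 * n)) x)) {α : X → Model n →L[ℝ] ℝ}
    (hα : κ.IsL2OneForm α) : Integrable (fun x => (κ.gradPair Ψ α x).re) κ.vol := by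
  obtain ⟨C, hC, h⟩ := κ.exists_gradPair_le Ψ hΨ
  have h1 : Integrable (fun x => C * (κ.covNorm x (α x)).toReal ^ 2) κ.vol :=
    (hα.memLp.integrable_sq).const_mul C
  refine h1.mono' (Complex.continuous_re.comp_aestronglyMeasurable
    (κ.aestronglyMeasurable_gradPair (SmoothForm.contForm Ψ.2.1) hα.1))
    (Eventually.of_forall fun x => ?_)
  rw [Real.norm_of_nonneg (Complex.le_def.1 (κ.gradPair_nonneg hΨ α x)).1]
  exact h α x

theorem KahlerForm.memLp_indicator {K : Set X} (hK : IsCompact K) (hKc : IsClosed K) (C : ℝ) :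
    MemLp (K.indicator fun _ => C) 2 κ.vol := by
  have := κ.isLocallyFiniteMeasure_vol
  exact memLp_indicator_const 2 hKc.measurableSet C (Or.inr hK.measure_lt_top.ne)

theorem KahlerForm.integrable_covPair (η : TestForm n X (2 * n + 1)) {α : X → Model n →L[ℝ] ℝ}
    (hα : κ.IsL2OneForm α) : Integrable (κ.covPair α η) κ.vol := by
  obtain ⟨C, hC, h⟩ := κ.exists_covPair_le η
  have h1 := (κ.memLp_indicator η.2.2 (isClosed_tsupport _) C).integrable_mul hα.memLp
  refine h1.mono' (κ.aestronglyMeasurable_covPair (SmoothForm.contForm η.2.1) hα.1)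
    (Eventually.of_forall fun x => h α x)

variable [T2Space X]

/-- The density of `dη` is a bounded function with compact support. -/
theorem KahlerForm.memLp_ratio_extD (η : TestForm n X (2 * n + 1)) :
    MemLp (κ.ratio (extD (η : DForm n X (2 * n + 1)))) 2 κ.vol := by
  have hs : SmoothForm (extD (η : DForm n X (2 * n + 1))) := SmoothForm.extD η.2.1
  have hsupp : HasCompactSupport (extD (η : DForm n X (2 * n + 1))) :=
    HasCompactSupport.of_support_subset_isCompact η.2.2
      ((subset_tsupport _).trans (tsupport_extD_subset _))
  obtain ⟨C, hC, h⟩ := exists_formBound κ hs.contForm hsupp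
  refine (κ.memLp_indicator hsupp (isClosed_tsupport _) C).mono
    (κ.aestronglyMeasurable_ratio_of_contForm hs.contForm) (Eventually.of_forall fun x => ?_)
  by_cases hx : x ∈ tsupport (extD (η : DForm n X (2 * n + 1)))
  · rw [Set.indicator_of_mem hx, Real.norm_of_nonneg hC]
    exact norm_div_wedgePow_le (κ.isMetricForm x) (h x)
  · rw [Set.indicator_of_notMem hx, ratio, image_eq_zero_of_notMem_tsupport hx]
    simp

theorem KahlerForm.integrable_smul_extD {φ : X → ℝ} (hφ : MemLp φ 2 κ.vol)
    (η : TestForm n X (2 * n + 1)) :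
    Integrable (fun x => φ x • κ.ratio (extD (η : DForm n X (2 * n + 1))) x) κ.vol := by
  have h1 : MemLp (fun x => (φ x : ℂ)) 2 κ.vol := hφ.ofReal
  refine (h1.integrable_mul (κ.memLp_ratio_extD η)).congr (Eventually.of_forall fun x => ?_)
  exact Complex.real_smul.symm

end Integrals

/-! ### Positive currents and their mass -/

section PositiveCurrents

variable {n : ℕ} {X : Type*} [TopologicalSpace X] [ChartedSpace (Model n) X]

/-- A current is positive if it is nonnegative on positive test forms. -/
def IsPositiveCurrent (T : TestForm n X (2 * n) →ₗ[ℂ] ℂ) : Prop :=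
  ∀ Ψ : TestForm n X (2 * n), (∀ x, IsPositiveForm ((Ψ : DForm n X (2 * n)) x)) → 0 ≤ T Ψ

variable [IsManifold 𝓘(ℂ, Model n) ω X]

/-- A current of bidegree `(1, 1)` only sees the component of type `(n, n)` of a test form. -/
theorem HasBidegree11.apply_typeTest {T : TestForm n X (2 * n) →ₗ[ℂ] ℂ} (hT : HasBidegree11 T)
    (Ψ : TestForm n X (2 * n)) : T (typeTest n n Ψ) = T Ψ := by
  conv_rhs => rw [← sum_typeTest Ψ, map_sum]
  rw [Finset.sum_eq_single n]
  · rw [show 2 * n - n = n by omega]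
  · intro r hr hrn
    have hr' : r < 2 * n + 1 := Finset.mem_range.1 hr
    refine hT r (2 * n - r) (by omega) (fun h => hrn (Prod.mk.inj h).1) _ fun x => ?_
    rw [typeTest_apply]
    exact isOfType_typePart (by omega) _
  · intro h
    exact absurd (Finset.mem_range.2 (by omega)) h

variable (κ : KahlerForm n X)

theorem KahlerForm.isPositiveForm_cutPow (m : ℕ) {χ : X → ℝ}
    (hχ : ContMDiff 𝓘(ℝ, Model n) 𝓘(ℝ, ℝ) ∞ χ) (hc : HasCompactSupport χ) (h0 : ∀ x, 0 ≤ χ x)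
    (x : X) : IsPositiveForm ((cutPow κ m χ hχ hc : DForm n X (2 * m)) x) := by
  rw [cutPow_apply]
  exact (isPositiveForm_wedgePow (κ.isMetricForm x) m).smul (by exact_mod_cast h0 x)

theorem KahlerForm.ofReal_re_le_mass (T : TestForm n X (2 * n) →ₗ[ℂ] ℂ) {χ : X → ℝ}
    (hχ : ContMDiff 𝓘(ℝ, Model n) 𝓘(ℝ, ℝ) ∞ χ) (hc : HasCompactSupport χ)
    (h0 : ∀ x, 0 ≤ χ x ∧ χ x ≤ 1) : ENNReal.ofReal (T (cutPow κ n χ hχ hc)).re ≤ κ.mass T :=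
  le_iSup₂_of_le (cutPow κ n χ hχ hc) ⟨χ, hχ, hc, h0, cutPow_apply κ n χ hχ hc⟩ le_rfl

theorem KahlerForm.re_le_mass {T : TestForm n X (2 * n) →ₗ[ℂ] ℂ} (hm : κ.mass T ≠ ⊤) {χ : X → ℝ}
    (hχ : ContMDiff 𝓘(ℝ, Model n) 𝓘(ℝ, ℝ) ∞ χ) (hc : HasCompactSupport χ)
    (h0 : ∀ x, 0 ≤ χ x ∧ χ x ≤ 1) : (T (cutPow κ n χ hχ hc)).re ≤ (κ.mass T).toReal :=
  (ENNReal.ofReal_le_iff_le_toReal hm).1 (κ.ofReal_re_le_mass T hχ hc h0)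

theorem KahlerForm.mass_le (T : TestForm n X (2 * n) →ₗ[ℂ] ℂ) {c : ℝ≥0∞}
    (h : ∀ (χ : X → ℝ) (hχ : ContMDiff 𝓘(ℝ, Model n) 𝓘(ℝ, ℝ) ∞ χ) (hc : HasCompactSupport χ),
      (∀ x, 0 ≤ χ x ∧ χ x ≤ 1) → ENNReal.ofReal (T (cutPow κ n χ hχ hc)).re ≤ c) :
    κ.mass T ≤ c := by
  refine iSup₂_le fun Ψ hΨ => ?_
  obtain ⟨χ, hχ, hc, h0, hΨ⟩ := hΨ
  have : Ψ = cutPow κ n χ hχ hc := Subtype.ext (funext fun x => by rw [hΨ x, cutPow_apply])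
  rw [this]
  exact h χ hχ hc h0

variable [T2Space X] [SecondCountableTopology X]

theorem KahlerForm.norm_apply_le_of_real {T : TestForm n X (2 * n) →ₗ[ℂ] ℂ}
    (hp : IsPositiveCurrent T) (hm : κ.mass T ≠ ⊤) {ε : ℝ} (hε : 0 ≤ ε)
    {Ψ : TestForm n X (2 * n)} (hb : ∀ x, FormBound (κ.form x) ε ((Ψ : DForm n X (2 * n)) x))
    (ht : ∀ x, IsOfType n n ((Ψ : DForm n X (2 * n)) x))
    (hr : ∀ x (v : Fin n → Model n), ((Ψ : DForm n X (2 * n)) x (interleave v)).im = 0) :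
    ‖T Ψ‖ ≤ ε * (κ.mass T).toReal := by
  obtain ⟨χ, hχ, hc, h01, h1⟩ := exists_cutoff n (K := tsupport (Ψ : DForm n X (2 * n))) Ψ.2.2
  -- `ε χ κⁿ ± Ψ` is positive, where `χ = 1` on the support of `Ψ`
  have key : ∀ s : ℂ, ‖s‖ = 1 → s.im = 0 → 0 ≤ T ((ε : ℂ) • cutPow κ n χ hχ hc + s • Ψ) := by
    intro s hs hs'
    refine hp _ fun x => ?_
    have e1 : (((ε : ℂ) • cutPow κ n χ hχ hc + s • Ψ : TestForm n X (2 * n)) : DForm n X (2 * n)) x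
      = (ε : ℂ) • ((χ x : ℂ) • κ.pow n x) + s • (Ψ : DForm n X (2 * n)) x := by
      rw [← cutPow_apply κ n χ hχ hc]; rfl
    rw [e1]
    by_cases hx : x ∈ tsupport (Ψ : DForm n X (2 * n))
    · rw [h1 x hx, Complex.ofReal_one, one_smul]
      refine isPositiveForm_smul_wedgePow_add (κ.isMetricForm x) hε (fun w => ?_) ((ht x).smul _)
        fun v => ?_
      · rw [ContinuousAlternatingMap.smul_apply, norm_smul, hs, one_mul]
        exact hb x w
      · rw [ContinuousAlternatingMap.smul_apply, smul_eq_mul, Complex.mul_im, hr x v, hs']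
        ring
    · have e2 : s • (Ψ : DForm n X (2 * n)) x = 0 := by
        rw [image_eq_zero_of_notMem_tsupport hx]
        ext v
        simp
      rw [e2, add_zero]
      exact ((isPositiveForm_wedgePow (κ.isMetricForm x) n).smul
        (by exact_mod_cast (h01 x).1)).smul (by exact_mod_cast hε)
  have h2 := key 1 (by simp) (by simp)
  have h3 := key (-1) (by simp) (by simp)
  have h4 := κ.re_le_mass hm hχ hc h01
  rw [map_add, map_smul, map_smul, smul_eq_mul, smul_eq_mul, Complex.le_def] at h2 h3
  simp only [Complex.zero_re, Complex.zero_im, Complex.add_re, Complex.add_im,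
    Complex.re_ofReal_mul, Complex.im_ofReal_mul, one_mul, neg_mul, Complex.neg_re,
    Complex.neg_im] at h2 h3
  have h5 : T Ψ = ((T Ψ).re : ℂ) := Complex.ext rfl (by
    rw [Complex.ofReal_im]; linarith [h2.2, h3.2])
  rw [h5, Complex.norm_real, Real.norm_eq_abs, abs_le]
  have h6 := mul_le_mul_of_nonneg_left h4 hε
  exact ⟨by linarith [h2.1], by linarith [h3.1]⟩

/-- A positive current of finite mass has measure coefficients: it is bounded by its mass times
the supremum of the test form. -/
theorem KahlerForm.norm_apply_le {T : TestForm n X (2 * n) →ₗ[ℂ] ℂ} (h11 : HasBidegree11 T)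
    (hp : IsPositiveCurrent T) (hm : κ.mass T ≠ ⊤) {ε : ℝ} (hε : 0 ≤ ε)
    {Ψ : TestForm n X (2 * n)} (hb : ∀ x, FormBound (κ.form x) ε ((Ψ : DForm n X (2 * n)) x)) :
    ‖T Ψ‖ ≤ 2 * ε * (κ.mass T).toReal := by
  rw [← h11.apply_typeTest, reTest_add_imTest (typeTest n n Ψ), map_add, map_smul]
  have hb' : ∀ x, FormBound (κ.form x) ε ((typeTest n n Ψ : DForm n X (2 * n)) x) := fun x => by
    rw [typeTest_apply]
    exact (hb x).typePart (κ.isMetricForm x) n n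
  have ht : ∀ x, IsOfType n n ((typeTest n n Ψ : DForm n X (2 * n)) x) := fun x => by
    rw [typeTest_apply]
    exact isOfType_typePart (by omega) _
  have h1 := κ.norm_apply_le_of_real hp hm hε (Ψ := reTest (typeTest n n Ψ))
    (fun x => (hb' x).reForm) (fun x => (ht x).reForm) fun x v => by
      rw [reTest_apply, reForm_apply, Complex.ofReal_im]
  have h2 := κ.norm_apply_le_of_real hp hm hε (Ψ := imTest (typeTest n n Ψ))
    (fun x => (hb' x).imForm) (fun x => (ht x).imForm) fun x v => by
      rw [imTest_apply, imForm_apply, Complex.ofReal_im]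
  refine (norm_add_le _ _).trans ?_
  rw [norm_smul, Complex.norm_I, one_mul]
  linarith

end PositiveCurrents

/-! ### Currents that dominate `i ∂φ ∧ ∂̄φ` -/

section Domination

variable {n : ℕ} {X : Type*} [TopologicalSpace X] [ChartedSpace (Model n) X] [MeasurableSpace X]

theorem KahlerForm.Dominates.isPositiveCurrent {κ : KahlerForm n X} {φ : Lp ℝ 2 κ.vol}
    {T : TestForm n X (2 * n) →ₗ[ℂ] ℂ} (h : κ.Dominates φ T) : IsPositiveCurrent T := by
  obtain ⟨α, -, h⟩ := h
  intro Ψ hΨ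
  refine le_trans ?_ (h Ψ hΨ)
  rw [κ.integral_wedge_gradForm hΨ]
  have : 0 ≤ ∫ x, (κ.gradPair Ψ α x).re ∂κ.vol :=
    integral_nonneg fun x => (Complex.le_def.1 (κ.gradPair_nonneg hΨ α x)).1
  exact_mod_cast this

/-- Positive currents take real values on positive forms, so that the domination is an inequality
between real numbers. -/
theorem KahlerForm.integral_le_iff (κ : KahlerForm n X) {T : TestForm n X (2 * n) →ₗ[ℂ] ℂ}
    (hT : IsPositiveCurrent T) {Ψ : TestForm n X (2 * n)}
    (hΨ : ∀ x, IsPositiveForm ((Ψ : DForm n X (2 * n)) x)) (α : X → Model n →L[ℝ] ℝ) :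
    κ.integral (fun x => wedge ((Ψ : DForm n X (2 * n)) x) (gradForm (α x))) ≤ T Ψ ↔
      ∫ x, (κ.gradPair Ψ α x).re ∂κ.vol ≤ (T Ψ).re := by
  rw [κ.integral_wedge_gradForm hΨ, Complex.le_def, Complex.ofReal_re, Complex.ofReal_im]
  exact ⟨fun h => h.1, fun h => ⟨h, (Complex.le_def.1 (hT Ψ hΨ)).2⟩⟩

variable [IsManifold 𝓘(ℂ, Model n) ω X] [BorelSpace X] [SecondCountableTopology X] [T2Space X]
  (κ : KahlerForm n X)

/-- If `i α^{1,0} ∧ α^{0,1} ≤ T`, then the energy of `α` is bounded by the mass of `T`. -/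
theorem KahlerForm.lintegral_covNorm_sq_le {T : TestForm n X (2 * n) →ₗ[ℂ] ℂ}
    {α : X → Model n →L[ℝ] ℝ} (hα : κ.IsL2OneForm α)
    (h : ∀ Ψ : TestForm n X (2 * n), (∀ x, IsPositiveForm ((Ψ : DForm n X (2 * n)) x)) →
      ∫ x, (κ.gradPair Ψ α x).re ∂κ.vol ≤ (T Ψ).re) :
    ∫⁻ x, κ.covNorm x (α x) ^ 2 ∂κ.vol ≤ ENNReal.ofReal (2 * (n + 1)) * κ.mass T := by
  have key : ∀ K : Set X, IsCompact K →
      ∫⁻ x in K, κ.covNorm x (α x) ^ 2 ∂κ.vol ≤ ENNReal.ofReal (2 * (n + 1)) * κ.mass T := by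
    intro K hK
    obtain ⟨χ, hχ, hc, h01, h1⟩ := exists_cutoff n hK
    have hpos := fun x => κ.isPositiveForm_cutPow n hχ hc (fun x => (h01 x).1) x
    have h2 := h (cutPow κ n χ hχ hc) hpos
    have h3 : ∀ x ∈ K, κ.covNorm x (α x) ^ 2 = ENNReal.ofReal (2 * (n + 1)) *
        ENNReal.ofReal (κ.gradPair (cutPow κ n χ hχ hc) α x).re := by
      intro x hx
      have h4 : (cutPow κ n χ hχ hc : DForm n X (2 * n)) x = κ.pow n x := by
        rw [cutPow_apply, h1 x hx, Complex.ofReal_one, one_smul]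
      rw [κ.covNorm_sq, ENNReal.ofReal_mul (by positivity), gradPair, gradPair, ratio, ratio, h4]
    calc ∫⁻ x in K, κ.covNorm x (α x) ^ 2 ∂κ.vol
        = ∫⁻ x in K, ENNReal.ofReal (2 * (n + 1)) *
          ENNReal.ofReal (κ.gradPair (cutPow κ n χ hχ hc) α x).re ∂κ.vol :=
          setLIntegral_congr_fun hK.measurableSet h3
      _ ≤ ∫⁻ x, ENNReal.ofReal (2 * (n + 1)) *
          ENNReal.ofReal (κ.gradPair (cutPow κ n χ hχ hc) α x).re ∂κ.vol :=
          setLIntegral_le_lintegral _ _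
      _ = ENNReal.ofReal (2 * (n + 1)) *
          ENNReal.ofReal (∫ x, (κ.gradPair (cutPow κ n χ hχ hc) α x).re ∂κ.vol) := by
          rw [lintegral_const_mul' _ _ ENNReal.ofReal_ne_top,
            ofReal_integral_eq_lintegral_ofReal (κ.integrable_gradPair hpos hα)
            (Eventually.of_forall fun x => (Complex.le_def.1 (κ.gradPair_nonneg hpos α x)).1)]
      _ ≤ _ := mul_le_mul_right
          ((ENNReal.ofReal_le_ofReal h2).trans (κ.ofReal_re_le_mass T hχ hc h01)) _
  have : LocallyCompactSpace X := ChartedSpace.locallyCompactSpace (Model n) X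
  rw [← setLIntegral_univ, ← iUnion_compactCovering, setLIntegral_iUnion_of_directed _
    (monotone_nat_of_le_succ fun i => compactCovering_subset X i.le_succ).directed_le]
  exact iSup_le fun i => key _ (isCompact_compactCovering X i)

end Domination

/-! ### Sums and multiples of currents -/

section Linear

variable {n : ℕ} {X : Type*} [TopologicalSpace X] [ChartedSpace (Model n) X]

theorem IsCurrent.add {p : ℕ} {T S : TestForm n X p →ₗ[ℂ] ℂ} (hT : IsCurrent T)
    (hS : IsCurrent S) : IsCurrent (T + S) := fun Ψ h => by
  simpa using (hT Ψ h).add (hS Ψ h)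

theorem IsCurrent.smul {p : ℕ} {T : TestForm n X p →ₗ[ℂ] ℂ} (hT : IsCurrent T) (c : ℂ) :
    IsCurrent (c • T) := fun Ψ h => by
  simpa using (hT Ψ h).const_mul c

theorem IsClosedCurrent.add {p : ℕ} {T S : TestForm n X p →ₗ[ℂ] ℂ} (hT : IsClosedCurrent T)
    (hS : IsClosedCurrent S) : IsClosedCurrent (T + S) := fun q hq η Ψ h => by
  rw [LinearMap.add_apply, hT q hq η Ψ h, hS q hq η Ψ h, add_zero]

theorem IsClosedCurrent.smul {p : ℕ} {T : TestForm n X p →ₗ[ℂ] ℂ} (hT : IsClosedCurrent T)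
    (c : ℂ) : IsClosedCurrent (c • T) := fun q hq η Ψ h => by
  rw [LinearMap.smul_apply, hT q hq η Ψ h, smul_zero]

theorem HasBidegree11.add {T S : TestForm n X (2 * n) →ₗ[ℂ] ℂ} (hT : HasBidegree11 T)
    (hS : HasBidegree11 S) : HasBidegree11 (T + S) := fun r s h1 h2 Ψ h => by
  rw [LinearMap.add_apply, hT r s h1 h2 Ψ h, hS r s h1 h2 Ψ h, add_zero]

theorem HasBidegree11.smul {T : TestForm n X (2 * n) →ₗ[ℂ] ℂ} (hT : HasBidegree11 T) (c : ℂ) :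
    HasBidegree11 (c • T) := fun r s h1 h2 Ψ h => by
  rw [LinearMap.smul_apply, hT r s h1 h2 Ψ h, smul_zero]

theorem KahlerForm.mass_add_le (κ : KahlerForm n X) (T S : TestForm n X (2 * n) →ₗ[ℂ] ℂ) :
    κ.mass (T + S) ≤ κ.mass T + κ.mass S := by
  refine iSup₂_le fun Ψ hΨ => ?_
  rw [LinearMap.add_apply, Complex.add_re]
  refine ENNReal.ofReal_add_le.trans (add_le_add ?_ ?_)
  · exact le_iSup₂ (f := fun Ψ _ => ENNReal.ofReal (T Ψ).re) Ψ hΨ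
  · exact le_iSup₂ (f := fun Ψ _ => ENNReal.ofReal (S Ψ).re) Ψ hΨ

theorem KahlerForm.mass_smul_le (κ : KahlerForm n X) {c : ℝ} (hc : 0 ≤ c)
    (T : TestForm n X (2 * n) →ₗ[ℂ] ℂ) :
    κ.mass ((c : ℂ) • T) ≤ ENNReal.ofReal c * κ.mass T := by
  refine iSup₂_le fun Ψ hΨ => ?_
  rw [LinearMap.smul_apply, smul_eq_mul, Complex.re_ofReal_mul, ENNReal.ofReal_mul hc]
  exact mul_le_mul_right (le_iSup₂ (f := fun Ψ _ => ENNReal.ofReal (T Ψ).re) Ψ hΨ) _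

theorem KahlerForm.mass_zero (κ : KahlerForm n X) :
    κ.mass (0 : TestForm n X (2 * n) →ₗ[ℂ] ℂ) = 0 := by
  simp [mass]

end Linear

/-! ### Sums and multiples of weak differentials -/

section Differentials

variable {n : ℕ} {X : Type*} [TopologicalSpace X] [ChartedSpace (Model n) X]

theorem IsPositiveCurrent.add {T S : TestForm n X (2 * n) →ₗ[ℂ] ℂ} (hT : IsPositiveCurrent T)
    (hS : IsPositiveCurrent S) :
    IsPositiveCurrent (T + S) := fun Ψ hΨ => by
  rw [LinearMap.add_apply]
  exact add_nonneg (hT Ψ hΨ) (hS Ψ hΨ)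

theorem IsPositiveCurrent.smul {T : TestForm n X (2 * n) →ₗ[ℂ] ℂ} (hT : IsPositiveCurrent T) {c : ℝ}
    (hc : 0 ≤ c) :
    IsPositiveCurrent ((c : ℂ) • T) := fun Ψ hΨ => by
  rw [LinearMap.smul_apply, smul_eq_mul]
  exact mul_nonneg (Complex.zero_le_real.2 hc) (hT Ψ hΨ)

theorem integral_le_of_le_add {Ω : Type*} [MeasurableSpace Ω] {μ : Measure Ω} {f g h : Ω → ℝ}
    (hf : Integrable f μ) (hg : Integrable g μ) (hh : Integrable h μ) {s t : ℝ}
    (H : ∀ x, f x ≤ s * g x + t * h x) : ∫ x, f x ∂μ ≤ s * ∫ x, g x ∂μ + t * ∫ x, h x ∂μ := by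
  rw [← integral_const_mul, ← integral_const_mul,
    ← integral_add (hg.const_mul s) (hh.const_mul t)]
  exact integral_mono hf ((hg.const_mul s).add (hh.const_mul t)) H

theorem ennreal_add_sq_le (a b : ℝ≥0∞) : (a + b) ^ 2 ≤ 2 * a ^ 2 + 2 * b ^ 2 := by
  rcases eq_or_ne a ⊤ with rfl | ha
  · simp
  rcases eq_or_ne b ⊤ with rfl | hb
  · simp
  lift a to NNReal using ha
  lift b to NNReal using hb
  rw [← mul_add]
  have h := add_sq_le (a := a) (b := b)
  exact_mod_cast h

theorem oneForm_add (l m : Model n →L[ℝ] ℂ) : oneForm (l + m) = oneForm l + oneForm m := rfl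

theorem oneForm_real_smul (c : ℝ) (l : Model n →L[ℝ] ℂ) : oneForm (c • l) = c • oneForm l := rfl

theorem KahlerForm.covPair_add (κ : KahlerForm n X) (α γ : X → Model n →L[ℝ] ℝ)
    (η : DForm n X (2 * n + 1)) (x : X) :
    κ.covPair (α + γ) η x = κ.covPair α η x + κ.covPair γ η x := by
  simp only [covPair, ratio, castDeg_apply, Pi.add_apply, ContinuousLinearMap.comp_add,
    oneForm_add, wedge_add_left, ContinuousAlternatingMap.add_apply, add_div]

theorem KahlerForm.covPair_smul (κ : KahlerForm n X) (c : ℝ) (α : X → Model n →L[ℝ] ℝ)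
    (η : DForm n X (2 * n + 1)) (x : X) :
    κ.covPair (c • α) η x = c * κ.covPair α η x := by
  simp only [covPair, ratio, castDeg_apply, Pi.smul_apply, ContinuousLinearMap.comp_smul,
    oneForm_real_smul, wedge_real_smul_left, ContinuousAlternatingMap.smul_apply,
    Complex.real_smul, mul_div_assoc]

theorem MeasurableOneForm.add {α γ : X → Model n →L[ℝ] ℝ} (hα : MeasurableOneForm α)
    (hγ : MeasurableOneForm γ) : MeasurableOneForm (α + γ) := fun e he => by
  refine ((hα e he).add (hγ e he)).congr (Eventually.of_forall fun y => ?_)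
  exact (ContinuousLinearMap.add_comp _ _ _).symm

theorem MeasurableOneForm.smul {α : X → Model n →L[ℝ] ℝ} (hα : MeasurableOneForm α) (c : ℝ) :
    MeasurableOneForm (c • α) := fun e he => by
  refine ((hα e he).const_smul c).congr (Eventually.of_forall fun y => ?_)
  exact (ContinuousLinearMap.smul_comp _ _ _).symm

theorem measurableOneForm_zero : MeasurableOneForm (0 : X → Model n →L[ℝ] ℝ) := fun e he => by
  simpa only [Pi.zero_apply, ContinuousLinearMap.zero_comp] using aestronglyMeasurable_const

theorem KahlerForm.gradPair_smul (κ : KahlerForm n X) (c : ℝ) (α : X → Model n →L[ℝ] ℝ)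
    (η : DForm n X (2 * n)) (x : X) :
    (κ.gradPair η (c • α) x).re = c ^ 2 * (κ.gradPair η α x).re := by
  rw [gradPair, gradPair, ratio, ratio, Pi.smul_apply, gradForm_smul, wedge_real_smul_right]
  have h : ∀ f : Alt n (2 * n + 2), ((c ^ 2 • f : Alt n (2 * n + 2)) : Alt n (2 * (n + 1)))
      (stdFrame n) = ((c ^ 2 : ℝ) : ℂ) * (f : Alt n (2 * (n + 1))) (stdFrame n) := fun f =>
    Complex.real_smul
  refine (congrArg (fun z : ℂ => (z / κ.pow (n + 1) x (stdFrame n)).re) (h _)).trans ?_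
  rw [mul_div_assoc, Complex.re_ofReal_mul]

theorem KahlerForm.gradPair_add_le (κ : KahlerForm n X) {η : DForm n X (2 * n)}
    (hη : ∀ x, IsPositiveForm (η x)) (α γ : X → Model n →L[ℝ] ℝ) {r : ℝ} (hr : r ≠ 0) (x : X) :
    (κ.gradPair η (α + γ) x).re ≤
      (1 + r ^ 2) * (κ.gradPair η α x).re + (1 + (r ^ 2)⁻¹) * (κ.gradPair η γ x).re :=
  wedge_gradForm_add_le (κ.isMetricForm x) (hη x) (α x) (γ x) hr

variable [MeasurableSpace X]

theorem KahlerForm.isWeakDifferential_iff (κ : KahlerForm n X) (φ : X → ℝ)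
    (α : X → Model n →L[ℝ] ℝ) :
    κ.IsWeakDifferential φ α ↔ ∀ η : TestForm n X (2 * n + 1),
      ∫ x, κ.covPair α η x ∂κ.vol =
        -∫ x, φ x • κ.ratio (extD (η : DForm n X (2 * n + 1))) x ∂κ.vol := by
  refine forall_congr' fun η => ?_
  rw [κ.integral_smul_extD]
  rfl

theorem KahlerForm.IsL2OneForm.smul {κ : KahlerForm n X} {α : X → Model n →L[ℝ] ℝ}
    (hα : κ.IsL2OneForm α) (c : ℝ) : κ.IsL2OneForm (c • α) := by
  refine ⟨MeasurableOneForm.smul hα.1 c, ?_⟩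
  have h1 : ∀ x, κ.covNorm x ((c • α) x) ^ 2 = ‖c‖ₑ ^ 2 * κ.covNorm x (α x) ^ 2 := fun x => by
    rw [Pi.smul_apply, covNorm_eq, dualNorm_smul, mul_pow, covNorm_eq]
  simp only [h1]
  rw [lintegral_const_mul' _ _ (by finiteness)]
  exact ENNReal.mul_lt_top (by finiteness) hα.2

theorem KahlerForm.HasL2Differential.smul {κ : KahlerForm n X} {φ : Lp ℝ 2 κ.vol}
    {α : X → Model n →L[ℝ] ℝ}
    (hα : κ.HasL2Differential φ α) (c : ℝ) : κ.HasL2Differential (c • φ) (c • α) := by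
  refine ⟨hα.1.smul c, (κ.isWeakDifferential_iff _ _).2 fun η => ?_⟩
  have h1 := (κ.isWeakDifferential_iff _ _).1 hα.2 η
  have h3 : ∫ x, (c • φ : Lp ℝ 2 κ.vol) x • κ.ratio (extD (η : DForm n X (2 * n + 1))) x ∂κ.vol =
      ∫ x, (c : ℂ) * (φ x • κ.ratio (extD (η : DForm n X (2 * n + 1))) x) ∂κ.vol := by
    refine integral_congr_ae ?_
    filter_upwards [Lp.coeFn_smul c φ] with x hx
    rw [hx, Pi.smul_apply, smul_eq_mul, Complex.real_smul, Complex.real_smul,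
      Complex.ofReal_mul, mul_assoc]
  simp only [κ.covPair_smul]
  rw [h3, integral_const_mul, integral_const_mul, h1, mul_neg]

theorem KahlerForm.hasL2Differential_zero (κ : KahlerForm n X) :
    κ.HasL2Differential 0 0 := by
  refine ⟨⟨measurableOneForm_zero, ?_⟩, (κ.isWeakDifferential_iff _ _).2 fun η => ?_⟩
  · simp [covNorm_eq, dualNorm_zero]
  · have h1 : ∀ x, κ.covPair 0 (η : DForm n X (2 * n + 1)) x = 0 := fun x => by
      have := κ.covPair_smul 0 0 (η : DForm n X (2 * n + 1)) x
      rwa [zero_smul, Complex.ofReal_zero, zero_mul] at this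
    have h2 : ∫ x, (0 : Lp ℝ 2 κ.vol) x • κ.ratio (extD (η : DForm n X (2 * n + 1))) x ∂κ.vol =
        0 := by
      refine (integral_congr_ae (g := fun _ => 0) ?_).trans (integral_zero _ _)
      filter_upwards [Lp.coeFn_zero ℝ 2 κ.vol] with x hx
      rw [hx, Pi.zero_apply, zero_smul]
    simp only [h1, h2, integral_zero, neg_zero]

theorem KahlerForm.smul_mem_admissible {κ : KahlerForm n X} {φ : Lp ℝ 2 κ.vol}
    {T : TestForm n X (2 * n) →ₗ[ℂ] ℂ} (hT : T ∈ κ.admissible φ) (c : ℝ) :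
    ((c ^ 2 : ℝ) : ℂ) • T ∈ κ.admissible (c • φ) := by
  obtain ⟨hT1, hT2, hT3, hT4⟩ := hT
  refine ⟨hT1.smul _, hT2.smul _, hT3.smul _, ?_⟩
  have hTp := hT4.isPositiveCurrent
  obtain ⟨α, hα, hTα⟩ := hT4
  have hp := hTp.smul (c := c ^ 2) (by positivity)
  refine ⟨c • α, hα.smul c, fun Ψ hΨ => (κ.integral_le_iff hp hΨ _).2 ?_⟩
  have h1 := (κ.integral_le_iff hTp hΨ _).1 (hTα Ψ hΨ)
  simp only [κ.gradPair_smul]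
  rw [integral_const_mul, LinearMap.smul_apply, smul_eq_mul, Complex.re_ofReal_mul]
  exact mul_le_mul_of_nonneg_left h1 (by positivity)

theorem KahlerForm.zero_mem_admissible (κ : KahlerForm n X) :
    (0 : TestForm n X (2 * n) →ₗ[ℂ] ℂ) ∈ κ.admissible 0 := by
  refine ⟨fun Ψ h => by simp, fun r s _ _ Ψ _ => rfl, fun q hq η Ψ _ => rfl, 0,
    κ.hasL2Differential_zero, fun Ψ hΨ => ?_⟩
  refine (κ.integral_le_iff (fun Ψ _ => le_rfl) hΨ _).2 (le_of_eq ?_)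
  have h1 : ∀ x, (κ.gradPair (Ψ : DForm n X (2 * n)) 0 x).re = 0 := fun x => by
    have := κ.gradPair_smul 0 0 (Ψ : DForm n X (2 * n)) x
    rwa [zero_smul, zero_pow two_ne_zero, zero_mul] at this
  simp [h1]

variable [IsManifold 𝓘(ℂ, Model n) ω X] [BorelSpace X] [SecondCountableTopology X]
  {κ : KahlerForm n X}

theorem KahlerForm.IsL2OneForm.add {α γ : X → Model n →L[ℝ] ℝ} (hα : κ.IsL2OneForm α)
    (hγ : κ.IsL2OneForm γ) : κ.IsL2OneForm (α + γ) := by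
  refine ⟨MeasurableOneForm.add hα.1 hγ.1, ?_⟩
  have h1 : ∀ x, κ.covNorm x ((α + γ) x) ^ 2 ≤
      2 * κ.covNorm x (α x) ^ 2 + 2 * κ.covNorm x (γ x) ^ 2 := fun x =>
    (pow_le_pow_left' (dualNorm_add_le (κ.form x) (α x) (γ x)) 2).trans (ennreal_add_sq_le _ _)
  refine (lintegral_mono h1).trans_lt ?_
  rw [lintegral_add_left' (((κ.aemeasurable_covNorm hα.1).pow_const 2).const_mul 2),
    lintegral_const_mul' _ _ (by simp), lintegral_const_mul' _ _ (by simp)]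
  exact ENNReal.add_lt_top.2 ⟨ENNReal.mul_lt_top (by simp) hα.2,
    ENNReal.mul_lt_top (by simp) hγ.2⟩

theorem KahlerForm.integral_gradPair_add_le (κ : KahlerForm n X) {Ψ : TestForm n X (2 * n)}
    (hΨ : ∀ x, IsPositiveForm ((Ψ : DForm n X (2 * n)) x)) {α γ : X → Model n →L[ℝ] ℝ}
    (hα : κ.IsL2OneForm α) (hγ : κ.IsL2OneForm γ) {r : ℝ} (hr : r ≠ 0) :
    ∫ x, (κ.gradPair Ψ (α + γ) x).re ∂κ.vol ≤ (1 + r ^ 2) * (∫ x, (κ.gradPair Ψ α x).re ∂κ.vol) +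
        (1 + (r ^ 2)⁻¹) * ∫ x, (κ.gradPair Ψ γ x).re ∂κ.vol := by
  exact integral_le_of_le_add (κ.integrable_gradPair hΨ (hα.add hγ))
    (κ.integrable_gradPair hΨ hα) (κ.integrable_gradPair hΨ hγ)
    fun x => κ.gradPair_add_le hΨ α γ hr x

variable [T2Space X]

theorem KahlerForm.HasL2Differential.add {φ ψ : Lp ℝ 2 κ.vol} {α γ : X → Model n →L[ℝ] ℝ}
    (hα : κ.HasL2Differential φ α) (hγ : κ.HasL2Differential ψ γ) :
    κ.HasL2Differential (φ + ψ) (α + γ) := by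
  refine ⟨hα.1.add hγ.1, (κ.isWeakDifferential_iff _ _).2 fun η => ?_⟩
  have h1 := (κ.isWeakDifferential_iff _ _).1 hα.2 η
  have h2 := (κ.isWeakDifferential_iff _ _).1 hγ.2 η
  have h3 : ∫ x, (φ + ψ : Lp ℝ 2 κ.vol) x • κ.ratio (extD (η : DForm n X (2 * n + 1))) x ∂κ.vol =
      ∫ x, (φ x • κ.ratio (extD (η : DForm n X (2 * n + 1))) x +
        ψ x • κ.ratio (extD (η : DForm n X (2 * n + 1))) x) ∂κ.vol := by
    refine integral_congr_ae ?_
    filter_upwards [Lp.coeFn_add φ ψ] with x hx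
    rw [hx, Pi.add_apply, add_smul]
  simp only [κ.covPair_add]
  rw [integral_add (κ.integrable_covPair η hα.1) (κ.integrable_covPair η hγ.1), h3, integral_add
    (κ.integrable_smul_extD (Lp.memLp φ) η) (κ.integrable_smul_extD (Lp.memLp ψ) η), h1, h2,
    neg_add]

/-- The basic inequality
`i ∂(φ + ψ) ∧ ∂̄(φ + ψ) ≤ (1 + r²) i ∂φ ∧ ∂̄φ + (1 + r⁻²) i ∂ψ ∧ ∂̄ψ` at the level of the dominating
currents. -/
theorem KahlerForm.add_mem_admissible {φ ψ : Lp ℝ 2 κ.vol}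
    {T S : TestForm n X (2 * n) →ₗ[ℂ] ℂ} (hT : T ∈ κ.admissible φ) (hS : S ∈ κ.admissible ψ)
    {r : ℝ} (hr : r ≠ 0) :
    ((1 + r ^ 2 : ℝ) : ℂ) • T + ((1 + (r ^ 2)⁻¹ : ℝ) : ℂ) • S ∈ κ.admissible (φ + ψ) := by
  obtain ⟨hT1, hT2, hT3, hT4⟩ := hT
  obtain ⟨hS1, hS2, hS3, hS4⟩ := hS
  refine ⟨(hT1.smul _).add (hS1.smul _), (hT2.smul _).add (hS2.smul _),
    (hT3.smul _).add (hS3.smul _), ?_⟩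
  have hTp := hT4.isPositiveCurrent
  have hSp := hS4.isPositiveCurrent
  obtain ⟨α, hα, hTα⟩ := hT4
  obtain ⟨γ, hγ, hSγ⟩ := hS4
  have hp := (hTp.smul (c := 1 + r ^ 2) (by positivity)).add
    (hSp.smul (c := 1 + (r ^ 2)⁻¹) (by positivity))
  refine ⟨α + γ, hα.add hγ, fun Ψ hΨ => (κ.integral_le_iff hp hΨ _).2 ?_⟩
  have h1 := (κ.integral_le_iff hTp hΨ _).1 (hTα Ψ hΨ)
  have h2 := (κ.integral_le_iff hSp hΨ _).1 (hSγ Ψ hΨ)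
  rw [LinearMap.add_apply, LinearMap.smul_apply, LinearMap.smul_apply, smul_eq_mul, smul_eq_mul,
    Complex.add_re, Complex.re_ofReal_mul, Complex.re_ofReal_mul]
  exact (κ.integral_gradPair_add_le hΨ hα.1 hγ.1 hr).trans
    (add_le_add (mul_le_mul_of_nonneg_left h1 (by positivity))
      (mul_le_mul_of_nonneg_left h2 (by positivity)))

end Differentials

/-! ### Series of dominating currents -/

section Series

theorem ennreal_sum_sq_le (N : ℕ) : ∀ a : ℕ → ℝ≥0∞,
    (∑ j ∈ Finset.range N, a j) ^ 2 ≤ ∑ j ∈ Finset.range N, 2 ^ (j + 1) * a j ^ 2 := by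
  induction N with
  | zero => intro a; simp
  | succ N ih =>
    intro a
    rw [Finset.sum_range_succ', Finset.sum_range_succ']
    refine (ennreal_add_sq_le _ _).trans (add_le_add ?_ (by simp))
    refine (mul_le_mul_right (ih fun j => a (j + 1)) 2).trans (le_of_eq ?_)
    rw [Finset.mul_sum]
    exact Finset.sum_congr rfl fun j _ => by rw [pow_succ' _ (j + 1), mul_assoc]

/-- The Cauchy–Schwarz inequality with the weights `2^{-(j+1)}`, whose sum is `1`. -/
theorem ennreal_tsum_sq_le (a : ℕ → ℝ≥0∞) :
    (∑' j, a j) ^ 2 ≤ ∑' j, 2 ^ (j + 1) * a j ^ 2 := by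
  refine le_of_tendsto' (((ENNReal.continuous_pow 2).tendsto _).comp
    (ENNReal.tendsto_nat_tsum a)) fun N => ?_
  exact (ennreal_sum_sq_le N a).trans (ENNReal.sum_le_tsum _)

theorem memLp_two_toReal {Ω : Type*} [MeasurableSpace Ω] {μ : Measure Ω} {f : Ω → ℝ≥0∞}
    (hf : AEMeasurable f μ) (h : ∫⁻ x, f x ^ 2 ∂μ < ⊤) : MemLp (fun x => (f x).toReal) 2 μ := by
  refine ⟨hf.ennreal_toReal.aestronglyMeasurable, ?_⟩
  rw [eLpNorm_lt_top_iff_lintegral_rpow_enorm_lt_top (by norm_num) (by norm_num)]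
  refine lt_of_le_of_lt (lintegral_mono fun x => ?_) h
  simp only [ENNReal.toReal_ofNat]
  rw [Real.enorm_of_nonneg ENNReal.toReal_nonneg, ← ENNReal.rpow_natCast (f x) 2]
  exact ENNReal.rpow_le_rpow ENNReal.ofReal_toReal_le (by norm_num)

variable {n : ℕ} {X : Type*} [TopologicalSpace X] [ChartedSpace (Model n) X]

/-- The Cauchy–Schwarz inequality for finite sums, from the case of two terms with equal weights,
splitting off the first term repeatedly. -/
theorem KahlerForm.gradPair_sum_le (κ : KahlerForm n X) {η : DForm n X (2 * n)}
    (hη : ∀ x, IsPositiveForm (η x)) (x : X) (N : ℕ) : ∀ α : ℕ → X → Model n →L[ℝ] ℝ,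
    (κ.gradPair η (∑ j ∈ Finset.range N, α j) x).re ≤
      ∑ j ∈ Finset.range N, 2 ^ (j + 1) * (κ.gradPair η (α j) x).re := by
  induction N with
  | zero =>
    intro α
    have := κ.gradPair_smul 0 0 η x
    rw [zero_smul, zero_pow two_ne_zero, zero_mul] at this
    simp [this]
  | succ N ih =>
    intro α
    rw [Finset.sum_range_succ', Finset.sum_range_succ']
    refine (κ.gradPair_add_le hη _ _ one_ne_zero x).trans ?_
    have h1 := ih fun j => α (j + 1)
    have h2 : ∑ j ∈ Finset.range N, 2 ^ (j + 1 + 1) * (κ.gradPair η (α (j + 1)) x).re =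
        2 * ∑ j ∈ Finset.range N, 2 ^ (j + 1) * (κ.gradPair η (α (j + 1)) x).re := by
      rw [Finset.mul_sum]
      exact Finset.sum_congr rfl fun j _ => by ring
    rw [h2]
    norm_num
    exact h1

theorem KahlerForm.covNorm_sum_le (κ : KahlerForm n X) (α : ℕ → X → Model n →L[ℝ] ℝ) (x : X)
    (N : ℕ) :
    κ.covNorm x ((∑ j ∈ Finset.range N, α j) x) ≤ ∑' j, κ.covNorm x (α j x) := by
  rw [Finset.sum_apply]
  exact (dualNorm_sum_le (β := κ.form x) (Finset.range N) fun j => α j x).trans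
    (ENNReal.sum_le_tsum _)

theorem KahlerForm.tendsto_gradPair (κ : KahlerForm n X) (η : DForm n X (2 * n))
    {α : ℕ → X → Model n →L[ℝ] ℝ} {γ : X → Model n →L[ℝ] ℝ} {x : X}
    (h : Tendsto (fun N => α N x) atTop (𝓝 (γ x))) :
    Tendsto (fun N => κ.gradPair η (α N) x) atTop (𝓝 (κ.gradPair η γ x)) := by
  have h0 : Continuous fun a : Model n →L[ℝ] ℝ =>
      wedge (η x) (gradForm a) (stdFrame n : Fin (2 * n + 2) → Model n) :=
by
    have h1 := continuous_wedge_gradForm_apply (n := n) (stdFrame n)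
    have h2 : Continuous fun a : Model n →L[ℝ] ℝ => (η x, a) := Continuous.prodMk_right (η x)
    have h3 := h1.comp h2
    exact h3
  have h4 := (h0.tendsto (γ x)).comp h
  have h5 := h4.div_const (κ.pow (n + 1) x (stdFrame n))
  exact h5

theorem KahlerForm.tendsto_covPair (κ : KahlerForm n X) (η : DForm n X (2 * n + 1))
    {α : ℕ → X → Model n →L[ℝ] ℝ} {γ : X → Model n →L[ℝ] ℝ} {x : X}
    (h : Tendsto (fun N => α N x) atTop (𝓝 (γ x))) :
    Tendsto (fun N => κ.covPair (α N) η x) atTop (𝓝 (κ.covPair γ η x)) := by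
  have h0 : Continuous fun a : Model n →L[ℝ] ℝ =>
      castDeg (show 1 + (2 * n + 1) = 2 * (n + 1) by omega)
        (wedge (oneForm (Complex.ofRealCLM.comp a)) (η x)) (stdFrame n) :=
by
    have h1 := continuous_wedge_oneForm_apply (n := n)
      (show 1 + (2 * n + 1) = 2 * (n + 1) by omega) (stdFrame n)
    have h2 : Continuous fun a : Model n →L[ℝ] ℝ => (η x, a) := Continuous.prodMk_right (η x)
    have h3 := h1.comp h2
    exact h3
  have h4 := (h0.tendsto (γ x)).comp h
  have h5 := h4.div_const (κ.pow (n + 1) x (stdFrame n))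
  exact h5

variable [MeasurableSpace X] [IsManifold 𝓘(ℂ, Model n) ω X] [BorelSpace X]
  [SecondCountableTopology X] (κ : KahlerForm n X)

/-- If `∑ |αⱼ|` is square integrable, then `∑ αⱼ` converges almost everywhere to an `L²` form,
whose norm is at most `∑ |αⱼ|`. -/
theorem KahlerForm.exists_ae_sum {α : ℕ → X → Model n →L[ℝ] ℝ} (hα : ∀ j, κ.IsL2OneForm (α j))
    (hS : ∫⁻ x, (∑' j, κ.covNorm x (α j x)) ^ 2 ∂κ.vol < ⊤) :
    ∃ γ : X → Model n →L[ℝ] ℝ, κ.IsL2OneForm γ ∧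
      ∀ᵐ x ∂κ.vol, Tendsto (fun N => ∑ j ∈ Finset.range N, α j x) atTop (𝓝 (γ x)) ∧
        (∑' j, κ.covNorm x (α j x)) ≠ ⊤ ∧ κ.covNorm x (γ x) ≤ ∑' j, κ.covNorm x (α j x) := by
  have hmeas : AEMeasurable (fun x => ∑' j, κ.covNorm x (α j x)) κ.vol :=
    AEMeasurable.tsum fun j => κ.aemeasurable_covNorm (hα j).1
  have hfin : ∀ᵐ x ∂κ.vol, (∑' j, κ.covNorm x (α j x)) ≠ ⊤ := by
    filter_upwards [ae_lt_top' (hmeas.pow_const 2) hS.ne] with x hx h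
    rw [h] at hx
    simp at hx
  have hconv : ∀ x, (∑' j, κ.covNorm x (α j x)) ≠ ⊤ →
      Tendsto (fun N => ∑ j ∈ Finset.range N, α j x) atTop (𝓝 (∑' j, α j x)) := by
    intro x hx
    refine (Summable.of_norm_bounded (g := fun j => Real.sqrt ‖κ.form x‖ *
      (κ.covNorm x (α j x)).toReal) ((ENNReal.summable_toReal hx).mul_left _)
      fun j => ?_).hasSum.tendsto_sum_nat
    exact norm_le_dualNorm (κ.isMetricForm x) (α j x)
  have hle : ∀ x, (∑' j, κ.covNorm x (α j x)) ≠ ⊤ →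
      κ.covNorm x (∑' j, α j x) ≤ ∑' j, κ.covNorm x (α j x) := fun x hx =>
    dualNorm_le_of_tendsto (hconv x hx) fun N =>
      (dualNorm_sum_le (β := κ.form x) (Finset.range N) fun j => α j x).trans
        (ENNReal.sum_le_tsum _)
  have hγ : MeasurableOneForm fun x => ∑' j, α j x := by
    intro e he
    have h1 : ∀ N : ℕ, AEStronglyMeasurable
        (fun y => (∑ j ∈ Finset.range N, α j (e.symm y)).comp (invDiff e y))
        (volume.restrict e.target) := by
      intro N
      refine (Finset.aestronglyMeasurable_fun_sum (Finset.range N)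
        fun j _ => (hα j).1 e he).congr (Eventually.of_forall fun y => ?_)
      exact (ContinuousLinearMap.finsetSum_comp _ _).symm
    refine aestronglyMeasurable_of_tendsto_ae atTop h1 ?_
    filter_upwards [κ.ae_chart hfin he] with y hy
    exact ((((ContinuousLinearMap.compL ℝ (Model n) (Model n) ℝ).flip
      (invDiff e y)).continuous.tendsto _).comp (hconv _ hy) :)
  refine ⟨fun x => ∑' j, α j x, ⟨hγ, (lintegral_mono_ae ?_).trans_lt hS⟩, ?_⟩
  · filter_upwards [hfin] with x hx
    exact pow_le_pow_left' (hle x hx) 2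
  · filter_upwards [hfin] with x hx
    exact ⟨hconv x hx, hx, hle x hx⟩

theorem KahlerForm.IsL2OneForm.sum {κ : KahlerForm n X} {α : ℕ → X → Model n →L[ℝ] ℝ}
    (hα : ∀ j, κ.IsL2OneForm (α j)) (N : ℕ) : κ.IsL2OneForm (∑ j ∈ Finset.range N, α j) := by
  induction N with
  | zero => simpa using ((hα 0).smul 0)
  | succ N ih => rw [Finset.sum_range_succ]; exact ih.add (hα N)

/-- The energies of the partial sums pass to the limit by dominated convergence, with the
majorant `(∑ |αⱼ|)²`. -/
theorem KahlerForm.integral_gradPair_le_of_series {α : ℕ → X → Model n →L[ℝ] ℝ}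
    (hα : ∀ j, κ.IsL2OneForm (α j)) (hS : ∫⁻ x, (∑' j, κ.covNorm x (α j x)) ^ 2 ∂κ.vol < ⊤)
    {γ : X → Model n →L[ℝ] ℝ}
    (hγ : ∀ᵐ x ∂κ.vol, Tendsto (fun N => ∑ j ∈ Finset.range N, α j x) atTop (𝓝 (γ x)) ∧
        (∑' j, κ.covNorm x (α j x)) ≠ ⊤)
    {Ψ : TestForm n X (2 * n)} (hΨ : ∀ x, IsPositiveForm ((Ψ : DForm n X (2 * n)) x)) {c : ℝ}
    (hc : ∀ N, ∑ j ∈ Finset.range N, 2 ^ (j + 1) * ∫ x, (κ.gradPair Ψ (α j) x).re ∂κ.vol ≤ c) :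
    ∫ x, (κ.gradPair Ψ γ x).re ∂κ.vol ≤ c := by
  have hmeas : AEMeasurable (fun x => ∑' j, κ.covNorm x (α j x)) κ.vol :=
    AEMeasurable.tsum fun j => κ.aemeasurable_covNorm (hα j).1
  obtain ⟨C, hC, hbound⟩ := κ.exists_gradPair_le Ψ hΨ
  have hlim : Tendsto (fun N => ∫ x, (κ.gradPair Ψ (∑ j ∈ Finset.range N, α j) x).re ∂κ.vol) atTop
      (𝓝 (∫ x, (κ.gradPair Ψ γ x).re ∂κ.vol)) := by
    refine tendsto_integral_of_dominated_convergence
      (fun x => C * (∑' j, κ.covNorm x (α j x)).toReal ^ 2)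
      (fun N => (κ.integrable_gradPair hΨ (KahlerForm.IsL2OneForm.sum hα N)).aestronglyMeasurable)
      ((memLp_two_toReal hmeas hS).integrable_sq.const_mul C) (fun N => ?_) ?_
    · filter_upwards [hγ] with x hx
      rw [Real.norm_of_nonneg (Complex.le_def.1 (κ.gradPair_nonneg hΨ _ x)).1]
      refine (hbound _ x).trans (mul_le_mul_of_nonneg_left ?_ hC)
      exact pow_le_pow_left₀ ENNReal.toReal_nonneg
        (ENNReal.toReal_mono hx.2 (κ.covNorm_sum_le α x N)) 2
    · filter_upwards [hγ] with x hx
      refine (Complex.continuous_re.tendsto _).comp (κ.tendsto_gradPair Ψ ?_)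
      simpa only [Finset.sum_apply] using hx.1
  refine le_of_tendsto' hlim fun N => le_trans ?_ (hc N)
  have hint := fun j => κ.integrable_gradPair hΨ (hα j)
  simp only [← integral_const_mul]
  rw [← integral_finsetSum _ fun j _ => (hint j).const_mul _]
  exact integral_mono (κ.integrable_gradPair hΨ (KahlerForm.IsL2OneForm.sum hα N))
    (integrable_finsetSum _ fun j _ => (hint j).const_mul _)
    fun x => κ.gradPair_sum_le hΨ x N α

theorem tendsto_integral_smul_of_tendsto_Lp {Ω : Type*} [MeasurableSpace Ω] {μ : Measure Ω}
    {u : ℕ → Lp ℝ 2 μ} {v : Lp ℝ 2 μ} (h : Tendsto u atTop (𝓝 v)) {g : Ω → ℂ}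
    (hg : MemLp g 2 μ) :
    Tendsto (fun N => ∫ x, u N x • g x ∂μ) atTop (𝓝 (∫ x, v x • g x ∂μ)) := by
  have hint : ∀ w : Lp ℝ 2 μ, Integrable (fun x => w x • g x) μ := fun w => by
    have h1 : MemLp (fun x => (w x : ℂ)) 2 μ := (Lp.memLp w).ofReal
    refine (h1.integrable_mul hg).congr (Eventually.of_forall fun x => ?_)
    exact Complex.real_smul.symm
  refine tendsto_integral_of_L1' _ (hint v).1 (Eventually.of_forall fun N => hint (u N)) ?_
  have h1 : ∀ N, eLpNorm ((fun x => u N x • g x) - fun x => v x • g x) 1 μ ≤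
      eLpNorm (⇑(u N) - ⇑v) 2 μ * eLpNorm g 2 μ := fun N => by
    have h2 : ((fun x => u N x • g x) - fun x => v x • g x) = (⇑(u N) - ⇑v) • g := by
      funext x
      simp [sub_smul]
    rw [h2]
    have h4 : AEStronglyMeasurable (⇑(u N) - ⇑v) μ :=
      (Lp.aestronglyMeasurable _).sub (Lp.aestronglyMeasurable _)
    exact eLpNorm_smul_le_mul_eLpNorm (p := 2) (q := 2) (r := 1) hg.1 h4
  have h3 : Tendsto (fun N => eLpNorm (⇑(u N) - ⇑v) 2 μ * eLpNorm g 2 μ) atTop (𝓝 0) := by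
    have h4 := (Lp.tendsto_Lp_iff_tendsto_eLpNorm' u v).1 h
    simpa using ENNReal.Tendsto.mul_const h4 (Or.inr hg.2.ne)
  exact tendsto_of_tendsto_of_tendsto_of_le_of_le tendsto_const_nhds h3 (fun _ => zero_le) h1

variable [T2Space X]

/-- The series of weak differentials of a convergent series is the weak differential of its sum. -/
theorem KahlerForm.hasL2Differential_of_series {ψ : ℕ → Lp ℝ 2 κ.vol} {φ : Lp ℝ 2 κ.vol}
    {α : ℕ → X → Model n →L[ℝ] ℝ} (hα : ∀ j, κ.HasL2Differential (ψ j) (α j))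
    (hφ : Tendsto (fun N => ∑ j ∈ Finset.range N, ψ j) atTop (𝓝 φ))
    (hS : ∫⁻ x, (∑' j, κ.covNorm x (α j x)) ^ 2 ∂κ.vol < ⊤)
    {γ : X → Model n →L[ℝ] ℝ} (hγ2 : κ.IsL2OneForm γ)
    (hγ : ∀ᵐ x ∂κ.vol, Tendsto (fun N => ∑ j ∈ Finset.range N, α j x) atTop (𝓝 (γ x)) ∧
        (∑' j, κ.covNorm x (α j x)) ≠ ⊤) : κ.HasL2Differential φ γ := by
  have hsum : ∀ N, κ.HasL2Differential (∑ j ∈ Finset.range N, ψ j) (∑ j ∈ Finset.range N, α j) := by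
    intro N
    induction N with
    | zero => simpa using κ.hasL2Differential_zero
    | succ N ih => rw [Finset.sum_range_succ, Finset.sum_range_succ]; exact ih.add (hα N)
  refine ⟨hγ2, (κ.isWeakDifferential_iff _ _).2 fun η => ?_⟩
  have hmeas : AEMeasurable (fun x => ∑' j, κ.covNorm x (α j x)) κ.vol :=
    AEMeasurable.tsum fun j => κ.aemeasurable_covNorm (hα j).1.1
  obtain ⟨C, hC, hbound⟩ := κ.exists_covPair_le η
  have h1 : Tendsto (fun N => ∫ x, κ.covPair (∑ j ∈ Finset.range N, α j) η x ∂κ.vol) atTop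
      (𝓝 (∫ x, κ.covPair γ η x ∂κ.vol)) := by
    refine tendsto_integral_of_dominated_convergence
      (fun x => (tsupport (η : DForm n X (2 * n + 1))).indicator (fun _ => C) x *
        (∑' j, κ.covNorm x (α j x)).toReal)
      (fun N => (κ.integrable_covPair η (hsum N).1).aestronglyMeasurable)
      ((κ.memLp_indicator η.2.2 (isClosed_tsupport _) C).integrable_mul
        (memLp_two_toReal hmeas hS)) (fun N => ?_) ?_
    · filter_upwards [hγ] with x hx
      refine (hbound _ x).trans (mul_le_mul_of_nonneg_left ?_
        (Set.indicator_nonneg (fun _ _ => hC) x))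
      exact ENNReal.toReal_mono hx.2 (κ.covNorm_sum_le α x N)
    · filter_upwards [hγ] with x hx
      refine κ.tendsto_covPair η ?_
      simpa only [Finset.sum_apply] using hx.1
  have h2 := (tendsto_integral_smul_of_tendsto_Lp hφ (κ.memLp_ratio_extD η)).neg
  refine tendsto_nhds_unique (h1.congr fun N => ?_) h2
  exact (κ.isWeakDifferential_iff _ _).1 (hsum N).2 η

end Series

section SeriesCurrents

variable {n : ℕ} {X : Type*} [TopologicalSpace X] [ChartedSpace (Model n) X]

/-- The current `∑ 2^{j+1} Tⱼ`. -/
def seriesCurrent {p : ℕ} (T : ℕ → TestForm n X p →ₗ[ℂ] ℂ)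
    (h : ∀ Ψ, Summable fun j => (2 : ℂ) ^ (j + 1) * T j Ψ) : TestForm n X p →ₗ[ℂ] ℂ where
  toFun Ψ := ∑' j, (2 : ℂ) ^ (j + 1) * T j Ψ
  map_add' Ψ Φ := by
    simp only [map_add, mul_add]
    exact (h Ψ).tsum_add (h Φ)
  map_smul' c Ψ := by
    simp only [map_smul, smul_eq_mul, RingHom.id_apply, ← tsum_mul_left]
    exact tsum_congr fun j => by ring

theorem seriesCurrent_apply {p : ℕ} (T : ℕ → TestForm n X p →ₗ[ℂ] ℂ)
    (h : ∀ Ψ, Summable fun j => (2 : ℂ) ^ (j + 1) * T j Ψ) (Ψ : TestForm n X p) :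
    seriesCurrent T h Ψ = ∑' j, (2 : ℂ) ^ (j + 1) * T j Ψ := rfl

theorem seriesCurrent_apply_re {p : ℕ} (T : ℕ → TestForm n X p →ₗ[ℂ] ℂ)
    (h : ∀ Ψ, Summable fun j => (2 : ℂ) ^ (j + 1) * T j Ψ) (Ψ : TestForm n X p) :
    HasSum (fun j => (2 : ℝ) ^ (j + 1) * (T j Ψ).re) (seriesCurrent T h Ψ).re := by
  convert Complex.hasSum_re (h Ψ).hasSum using 2 with j
  · rw [← Complex.re_ofReal_mul]
    push_cast
    rfl
  · rw [seriesCurrent_apply]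

variable [IsManifold 𝓘(ℂ, Model n) ω X] (κ : KahlerForm n X)
  {T : ℕ → TestForm n X (2 * n) →ₗ[ℂ] ℂ}

theorem KahlerForm.mass_seriesCurrent_le (hp : ∀ j, IsPositiveCurrent (T j))
    (h : ∀ Ψ, Summable fun j => (2 : ℂ) ^ (j + 1) * T j Ψ) :
    κ.mass (seriesCurrent T h) ≤ ∑' j, 2 ^ (j + 1) * κ.mass (T j) := by
  refine κ.mass_le _ fun χ hχ hc h01 => ?_
  have hs := seriesCurrent_apply_re T h (cutPow κ n χ hχ hc)
  have h0 : ∀ j, 0 ≤ (T j (cutPow κ n χ hχ hc)).re := fun j => (Complex.le_def.1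
    (hp j _ fun x => κ.isPositiveForm_cutPow n hχ hc (fun x => (h01 x).1) x)).1
  rw [← hs.tsum_eq, ENNReal.ofReal_tsum_of_nonneg (fun j => mul_nonneg (by positivity) (h0 j))
    hs.summable]
  refine ENNReal.tsum_le_tsum fun j => ?_
  rw [ENNReal.ofReal_mul (by positivity), ENNReal.ofReal_pow (by norm_num), ENNReal.ofReal_ofNat]
  exact mul_le_mul_right (κ.ofReal_re_le_mass (T j) hχ hc h01) _

variable [SecondCountableTopology X] [T2Space X]

theorem KahlerForm.norm_two_pow_mul_le (h11 : ∀ j, HasBidegree11 (T j))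
    (hp : ∀ j, IsPositiveCurrent (T j)) (hm : ∑' j, 2 ^ (j + 1) * κ.mass (T j) ≠ ⊤) {ε : ℝ}
    (hε : 0 ≤ ε) {Ψ : TestForm n X (2 * n)}
    (hb : ∀ x, FormBound (κ.form x) ε ((Ψ : DForm n X (2 * n)) x)) (j : ℕ) :
    ‖(2 : ℂ) ^ (j + 1) * T j Ψ‖ ≤ 2 * ε * (2 ^ (j + 1) * κ.mass (T j)).toReal := by
  have h1 : κ.mass (T j) ≠ ⊤ := fun h => ENNReal.ne_top_of_tsum_ne_top hm j (by
    rw [h, ENNReal.mul_top (by positivity)])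
  have h2 := κ.norm_apply_le (h11 j) (hp j) h1 hε hb
  rw [norm_mul, norm_pow, Complex.norm_ofNat, ENNReal.toReal_mul, ENNReal.toReal_pow,
    ENNReal.toReal_ofNat]
  calc (2 : ℝ) ^ (j + 1) * ‖T j Ψ‖ ≤ 2 ^ (j + 1) * (2 * ε * (κ.mass (T j)).toReal) :=
        mul_le_mul_of_nonneg_left h2 (by positivity)
    _ = _ := by ring

theorem KahlerForm.summable_two_pow_mul (h11 : ∀ j, HasBidegree11 (T j))
    (hp : ∀ j, IsPositiveCurrent (T j)) (hm : ∑' j, 2 ^ (j + 1) * κ.mass (T j) ≠ ⊤)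
    (Ψ : TestForm n X (2 * n)) : Summable fun j => (2 : ℂ) ^ (j + 1) * T j Ψ := by
  obtain ⟨C, hC, hb⟩ := exists_formBound κ (SmoothForm.contForm Ψ.2.1) Ψ.2.2
  exact Summable.of_norm_bounded ((ENNReal.summable_toReal hm).mul_left (2 * C))
    fun j => κ.norm_two_pow_mul_le h11 hp hm hC hb j

theorem KahlerForm.isCurrent_seriesCurrent (h11 : ∀ j, HasBidegree11 (T j))
    (hp : ∀ j, IsPositiveCurrent (T j)) (hm : ∑' j, 2 ^ (j + 1) * κ.mass (T j) ≠ ⊤)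
    (h : ∀ Ψ, Summable fun j => (2 : ℂ) ^ (j + 1) * T j Ψ) : IsCurrent (seriesCurrent T h) := by
  intro Ψ hΨ
  set M := ∑' j, (2 ^ (j + 1) * κ.mass (T j)).toReal with hM
  have hM0 : 0 ≤ M := tsum_nonneg fun j => ENNReal.toReal_nonneg
  have key : ∀ ε : ℝ, 0 ≤ ε → ∀ Φ : TestForm n X (2 * n),
      (∀ x, FormBound (κ.form x) ε ((Φ : DForm n X (2 * n)) x)) →
      ‖seriesCurrent T h Φ‖ ≤ 2 * ε * M := fun ε hε Φ hΦ => by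
    rw [hM, ← tsum_mul_left, seriesCurrent_apply]
    exact tsum_of_norm_bounded ((ENNReal.summable_toReal hm).mul_left (2 * ε)).hasSum
      fun j => κ.norm_two_pow_mul_le h11 hp hm hε hΦ j
  rw [Metric.tendsto_nhds]
  intro δ hδ
  have hε : 0 < δ / (2 * (M + 1)) := by positivity
  filter_upwards [TestTendsToZero.eventually_formBound κ hΨ hε] with j hj
  rw [dist_zero_right]
  refine (key _ hε.le _ hj).trans_lt ?_
  have : 2 * (δ / (2 * (M + 1))) * M = δ * (M / (M + 1)) := by
    field_simp
  rw [this]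
  refine mul_lt_of_lt_one_right hδ ?_
  rw [div_lt_one (by positivity)]
  linarith

variable [MeasurableSpace X] [BorelSpace X]

/-- If `φ = ∑ ψⱼ` and `Tⱼ` dominates `i ∂ψⱼ ∧ ∂̄ψⱼ`, then `∑ 2^{j+1} Tⱼ` dominates `i ∂φ ∧ ∂̄φ`. -/
theorem KahlerForm.exists_mem_admissible_of_series {ψ : ℕ → Lp ℝ 2 κ.vol} {φ : Lp ℝ 2 κ.vol}
    (hT : ∀ j, T j ∈ κ.admissible (ψ j)) (hm : ∑' j, 2 ^ (j + 1) * κ.mass (T j) ≠ ⊤)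
    (hφ : Tendsto (fun N => ∑ j ∈ Finset.range N, ψ j) atTop (𝓝 φ)) :
    ∃ S ∈ κ.admissible φ, κ.mass S ≤ ∑' j, 2 ^ (j + 1) * κ.mass (T j) := by
  have hp : ∀ j, IsPositiveCurrent (T j) := fun j => (hT j).2.2.2.isPositiveCurrent
  have h11 : ∀ j, HasBidegree11 (T j) := fun j => (hT j).2.1
  have hsum := κ.summable_two_pow_mul h11 hp hm
  choose α hα hdom using fun j => (hT j).2.2.2
  have hdom' : ∀ j, ∀ Ψ : TestForm n X (2 * n),
      (∀ x, IsPositiveForm ((Ψ : DForm n X (2 * n)) x)) →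
      ∫ x, (κ.gradPair Ψ (α j) x).re ∂κ.vol ≤ (T j Ψ).re := fun j Ψ hΨ =>
    (κ.integral_le_iff (hp j) hΨ _).1 (hdom j Ψ hΨ)
  have hS : ∫⁻ x, (∑' j, κ.covNorm x (α j x)) ^ 2 ∂κ.vol < ⊤ := by
    calc ∫⁻ x, (∑' j, κ.covNorm x (α j x)) ^ 2 ∂κ.vol
        ≤ ∫⁻ x, ∑' j, 2 ^ (j + 1) * κ.covNorm x (α j x) ^ 2 ∂κ.vol :=
          lintegral_mono fun x => ennreal_tsum_sq_le _
      _ = ∑' j, ∫⁻ x, 2 ^ (j + 1) * κ.covNorm x (α j x) ^ 2 ∂κ.vol :=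
          lintegral_tsum fun j => ((κ.aemeasurable_covNorm (hα j).1.1).pow_const 2).const_mul _
      _ = ∑' j, 2 ^ (j + 1) * ∫⁻ x, κ.covNorm x (α j x) ^ 2 ∂κ.vol :=
          tsum_congr fun j => lintegral_const_mul' _ _ (by finiteness)
      _ ≤ ∑' j, ENNReal.ofReal (2 * (n + 1)) * (2 ^ (j + 1) * κ.mass (T j)) :=
          ENNReal.tsum_le_tsum fun j => by
            rw [mul_left_comm]
            exact mul_le_mul_right (κ.lintegral_covNorm_sq_le (hα j).1 (hdom' j)) _
      _ = ENNReal.ofReal (2 * (n + 1)) * ∑' j, 2 ^ (j + 1) * κ.mass (T j) := ENNReal.tsum_mul_left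
      _ < ⊤ := ENNReal.mul_lt_top ENNReal.ofReal_lt_top hm.lt_top
  obtain ⟨γ, hγ, hae⟩ := κ.exists_ae_sum (fun j => (hα j).1) hS
  have hae' : ∀ᵐ x ∂κ.vol, Tendsto (fun N => ∑ j ∈ Finset.range N, α j x) atTop (𝓝 (γ x)) ∧
      (∑' j, κ.covNorm x (α j x)) ≠ ⊤ := hae.mono fun x hx => ⟨hx.1, hx.2.1⟩
  have hd := κ.hasL2Differential_of_series hα hφ hS hγ hae'
  have hpos : IsPositiveCurrent (seriesCurrent T hsum) := fun Ψ hΨ => by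
    rw [seriesCurrent_apply]
    refine tsum_nonneg fun j => mul_nonneg ?_ (hp j Ψ hΨ)
    exact_mod_cast Complex.zero_le_real.2 (by positivity : (0 : ℝ) ≤ 2 ^ (j + 1))
  refine ⟨seriesCurrent T hsum, ⟨κ.isCurrent_seriesCurrent h11 hp hm hsum, ?_, ?_, γ, hd, ?_⟩,
    κ.mass_seriesCurrent_le hp hsum⟩
  · intro r s h1 h2 Ψ hΨ
    simp only [seriesCurrent_apply, h11 _ r s h1 h2 Ψ hΨ, mul_zero, tsum_zero]
  · intro q hq η Ψ hΨ
    simp only [seriesCurrent_apply, (hT _).2.2.1 q hq η Ψ hΨ, mul_zero, tsum_zero]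
  · intro Ψ hΨ
    refine (κ.integral_le_iff hpos hΨ _).2 ?_
    refine κ.integral_gradPair_le_of_series (fun j => (hα j).1) hS hae' hΨ fun N => ?_
    have hs := seriesCurrent_apply_re T hsum Ψ
    refine le_trans (Finset.sum_le_sum fun j _ =>
      mul_le_mul_of_nonneg_left (hdom' j Ψ hΨ) (by positivity)) ?_
    exact sum_le_hasSum _ (fun j _ => mul_nonneg (by positivity)
      (Complex.le_def.1 (hp j Ψ hΨ)).1) hs

end SeriesCurrents

/-! ### The norm of `W^*` -/

section Norm

theorem sqrt_sq_add_sq_le (a b c d : ℝ) :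
    Real.sqrt ((a + c) ^ 2 + (b + d) ^ 2) ≤
      Real.sqrt (a ^ 2 + b ^ 2) + Real.sqrt (c ^ 2 + d ^ 2) := by
  have h := norm_add_le (⟨a, b⟩ : ℂ) ⟨c, d⟩
  simpa only [Complex.norm_eq_sqrt_sq_add_sq, Complex.add_re, Complex.add_im] using h

variable {n : ℕ} {X : Type*} [TopologicalSpace X] [ChartedSpace (Model n) X] [MeasurableSpace X]
  {κ : KahlerForm n X}

/-- Some current that dominates `i ∂φ ∧ ∂̄φ` has mass at most `a²`. -/
def KahlerForm.StarBound (κ : KahlerForm n X) (φ : Lp ℝ 2 κ.vol) (a : ℝ) : Prop :=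
  ∃ T ∈ κ.admissible φ, κ.mass T ≤ ENNReal.ofReal (a ^ 2)

/-- The square root of the infimum of the masses of the dominating currents. -/
def KahlerForm.starSemi (κ : KahlerForm n X) (φ : Lp ℝ 2 κ.vol) : ℝ :=
  Real.sqrt (⨅ T ∈ κ.admissible φ, κ.mass T).toReal

theorem KahlerForm.starNorm_eq (φ : Lp ℝ 2 κ.vol) :
    κ.starNorm φ = Real.sqrt (‖φ‖ ^ 2 + κ.starSemi φ ^ 2) := by
  rw [starNorm, starSemi, Real.sq_sqrt ENNReal.toReal_nonneg]

theorem KahlerForm.mem_Wstar_iff {φ : Lp ℝ 2 κ.vol} :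
    φ ∈ κ.Wstar ↔ ∃ T ∈ κ.admissible φ, κ.mass T < ⊤ := by
  refine ⟨fun h => h.2, fun h => ⟨?_, h⟩⟩
  obtain ⟨T, ⟨-, -, -, α, hα, -⟩, -⟩ := h
  exact ⟨α, hα⟩

theorem KahlerForm.StarBound.mem_Wstar {φ : Lp ℝ 2 κ.vol} {a : ℝ} (h : κ.StarBound φ a) :
    φ ∈ κ.Wstar :=
  let ⟨T, hT, hm⟩ := h
  mem_Wstar_iff.2 ⟨T, hT, hm.trans_lt ENNReal.ofReal_lt_top⟩

theorem KahlerForm.StarBound.starSemi_le {φ : Lp ℝ 2 κ.vol} {a : ℝ} (h : κ.StarBound φ a)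
    (ha : 0 ≤ a) : κ.starSemi φ ≤ a := by
  obtain ⟨T, hT, hm⟩ := h
  rw [starSemi, Real.sqrt_le_left ha]
  exact ENNReal.toReal_le_of_le_ofReal (sq_nonneg a) ((iInf₂_le T hT).trans hm)

theorem KahlerForm.starBound_of_lt {φ : Lp ℝ 2 κ.vol} (h : φ ∈ κ.Wstar) {a : ℝ}
    (ha : κ.starSemi φ < a) : κ.StarBound φ a := by
  obtain ⟨T, hT, hm⟩ := mem_Wstar_iff.1 h
  have hfin : (⨅ T ∈ κ.admissible φ, κ.mass T) ≠ ⊤ := ((iInf₂_le T hT).trans_lt hm).ne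
  have h0 : 0 ≤ κ.starSemi φ := Real.sqrt_nonneg _
  have h1 : (⨅ T ∈ κ.admissible φ, κ.mass T) < ENNReal.ofReal (a ^ 2) := by
    rw [ENNReal.lt_ofReal_iff_toReal_lt hfin]
    exact (Real.sqrt_lt' (h0.trans_lt ha)).1 ha
  obtain ⟨S, hSm⟩ := iInf_lt_iff.1 h1
  obtain ⟨hS, hSm⟩ := iInf_lt_iff.1 hSm
  exact ⟨S, hS, hSm.le⟩

theorem KahlerForm.StarBound.smul {φ : Lp ℝ 2 κ.vol} {a : ℝ} (h : κ.StarBound φ a) (c : ℝ) :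
    κ.StarBound (c • φ) (|c| * a) := by
  obtain ⟨T, hT, hm⟩ := h
  refine ⟨_, smul_mem_admissible hT c, (κ.mass_smul_le (sq_nonneg c) T).trans ?_⟩
  rw [mul_pow, sq_abs, ENNReal.ofReal_mul (sq_nonneg c)]
  exact mul_le_mul_right hm _

theorem KahlerForm.starBound_zero (κ : KahlerForm n X) : κ.StarBound 0 0 :=
  ⟨0, κ.zero_mem_admissible, by rw [κ.mass_zero]; exact zero_le⟩

theorem KahlerForm.starSemi_smul_le {φ : Lp ℝ 2 κ.vol} (hφ : φ ∈ κ.Wstar) (c : ℝ) :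
    κ.starSemi (c • φ) ≤ |c| * κ.starSemi φ := by
  refine le_of_forall_pos_le_add fun ε hε => ?_
  have h1 : 0 ≤ κ.starSemi φ := Real.sqrt_nonneg _
  have h2 : 0 < ε / (|c| + 1) := by positivity
  have h3 := ((starBound_of_lt hφ (lt_add_of_pos_right _ h2)).smul c).starSemi_le
    (by positivity)
  have h4 : |c| * (ε / (|c| + 1)) ≤ ε := by
    rw [mul_div_left_comm]
    exact mul_le_of_le_one_right hε.le ((div_le_one (by positivity)).2 (by linarith))
  linarith

theorem KahlerForm.norm_le_starNorm (φ : Lp ℝ 2 κ.vol) : ‖φ‖ ≤ κ.starNorm φ := by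
  rw [starNorm_eq]
  exact Real.le_sqrt_of_sq_le (by nlinarith [sq_nonneg (κ.starSemi φ)])

theorem KahlerForm.starSemi_le_starNorm (φ : Lp ℝ 2 κ.vol) : κ.starSemi φ ≤ κ.starNorm φ := by
  rw [starNorm_eq]
  exact Real.le_sqrt_of_sq_le (by nlinarith [sq_nonneg ‖φ‖])

variable [IsManifold 𝓘(ℂ, Model n) ω X] [BorelSpace X] [SecondCountableTopology X] [T2Space X]

/-- The triangle inequality for the square roots of the masses. -/
theorem KahlerForm.StarBound.add {φ ψ : Lp ℝ 2 κ.vol} {a b : ℝ} (hφ : κ.StarBound φ a)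
    (hψ : κ.StarBound ψ b) (ha : 0 < a) (hb : 0 < b) : κ.StarBound (φ + ψ) (a + b) := by
  obtain ⟨T, hT, hTm⟩ := hφ
  obtain ⟨S, hS, hSm⟩ := hψ
  -- the optimal weights are `1 + b / a` and `1 + a / b`
  have hr : Real.sqrt (b / a) ≠ 0 := (Real.sqrt_pos.2 (by positivity)).ne'
  refine ⟨_, add_mem_admissible hT hS hr, ?_⟩
  rw [Real.sq_sqrt (by positivity)]
  calc κ.mass _ ≤ ENNReal.ofReal (1 + b / a) * ENNReal.ofReal (a ^ 2) +
        ENNReal.ofReal (1 + (b / a)⁻¹) * ENNReal.ofReal (b ^ 2) :=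
        (κ.mass_add_le _ _).trans (add_le_add
          ((κ.mass_smul_le (by positivity) T).trans (mul_le_mul_right hTm _))
          ((κ.mass_smul_le (by positivity) S).trans (mul_le_mul_right hSm _)))
    _ = ENNReal.ofReal ((a + b) ^ 2) := by
        rw [← ENNReal.ofReal_mul (by positivity), ← ENNReal.ofReal_mul (by positivity),
          ← ENNReal.ofReal_add (by positivity) (by positivity)]
        congr 1
        field_simp
        ring

/-- Masses at most `ε² 4^{-j}` against the weights `2^{j+1}`: the series sums to `4 ε²`. -/
theorem KahlerForm.starBound_of_series {ψ : ℕ → Lp ℝ 2 κ.vol} {φ : Lp ℝ 2 κ.vol} {ε : ℝ}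
    (hψ : ∀ j, κ.StarBound (ψ j) (ε / 2 ^ j))
    (hφ : Tendsto (fun N => ∑ j ∈ Finset.range N, ψ j) atTop (𝓝 φ)) :
    κ.StarBound φ (2 * ε) := by
  choose T hT hm using hψ
  have h1 : ∑' j, 2 ^ (j + 1) * κ.mass (T j) ≤ ENNReal.ofReal ((2 * ε) ^ 2) := by
    calc ∑' j, 2 ^ (j + 1) * κ.mass (T j)
        ≤ ∑' j : ℕ, ENNReal.ofReal (2 * ε ^ 2 * (1 / 2) ^ j) := ENNReal.tsum_le_tsum fun j => by
          refine (mul_le_mul_right (hm j) _).trans (le_of_eq ?_)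
          rw [← ENNReal.ofReal_ofNat, ← ENNReal.ofReal_pow (by norm_num),
            ← ENNReal.ofReal_mul (by positivity)]
          congr 1
          rw [one_div, inv_pow]
          field_simp
          ring
      _ = ENNReal.ofReal ((2 * ε) ^ 2) := by
          rw [← ENNReal.ofReal_tsum_of_nonneg (fun j => by positivity)
            (summable_geometric_two.mul_left _), tsum_mul_left, tsum_geometric_two]
          congr 1
          ring
  obtain ⟨S, hS, hSm⟩ := κ.exists_mem_admissible_of_series hT
    (h1.trans_lt ENNReal.ofReal_lt_top).ne hφ
  exact ⟨S, hS, hSm.trans h1⟩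

variable (κ) in
/-- The space `W^*` as a linear subspace of `L²`. -/
def KahlerForm.starSpace : Submodule ℝ (Lp ℝ 2 κ.vol) where
  carrier := κ.Wstar
  zero_mem' := κ.starBound_zero.mem_Wstar
  add_mem' {φ ψ} hφ hψ := ((starBound_of_lt hφ (lt_add_one _)).add
    (starBound_of_lt hψ (lt_add_one _)) (by unfold starSemi; positivity)
    (by unfold starSemi; positivity)).mem_Wstar
  smul_mem' c _ hφ := ((starBound_of_lt hφ (lt_add_one _)).smul c).mem_Wstar

theorem KahlerForm.starSemi_add_le {φ ψ : Lp ℝ 2 κ.vol} (hφ : φ ∈ κ.Wstar) (hψ : ψ ∈ κ.Wstar) :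
    κ.starSemi (φ + ψ) ≤ κ.starSemi φ + κ.starSemi ψ := by
  refine le_of_forall_pos_le_add fun ε hε => ?_
  have h1 : 0 ≤ κ.starSemi φ := Real.sqrt_nonneg _
  have h2 : 0 ≤ κ.starSemi ψ := Real.sqrt_nonneg _
  have h3 := ((starBound_of_lt hφ (lt_add_of_pos_right _ (half_pos hε))).add
    (starBound_of_lt hψ (lt_add_of_pos_right _ (half_pos hε))) (by positivity)
    (by positivity)).starSemi_le (by positivity)
  linarith

variable (κ) in
/-- The norm of `W^*`. -/
def KahlerForm.starSeminorm : Seminorm ℝ κ.starSpace :=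
  Seminorm.ofSMulLE (fun φ => κ.starNorm φ)
    (by
      have h : κ.starSemi 0 = 0 :=
        le_antisymm (κ.starBound_zero.starSemi_le le_rfl) (Real.sqrt_nonneg _)
      simp [starNorm_eq, h])
    (fun φ ψ => by
      simp only [starNorm_eq, Submodule.coe_add]
      refine le_trans (Real.sqrt_le_sqrt ?_) (sqrt_sq_add_sq_le _ _ _ _)
      exact add_le_add (pow_le_pow_left₀ (norm_nonneg _) (norm_add_le _ _) 2)
        (pow_le_pow_left₀ (Real.sqrt_nonneg _) (starSemi_add_le φ.2 ψ.2) 2))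
    (fun c φ => by
      simp only [starNorm_eq, Submodule.coe_smul]
      rw [Real.norm_eq_abs, ← Real.sqrt_sq (abs_nonneg c), ← Real.sqrt_mul (sq_nonneg _)]
      refine Real.sqrt_le_sqrt ?_
      rw [mul_add, ← mul_pow, ← mul_pow]
      refine add_le_add (le_of_eq ?_) (pow_le_pow_left₀ (Real.sqrt_nonneg _)
        (starSemi_smul_le φ.2 c) 2)
      rw [norm_smul, Real.norm_eq_abs])

theorem KahlerForm.starSeminorm_apply (φ : κ.starSpace) : κ.starSeminorm φ = κ.starNorm φ := rfl

/-- A sequence with `‖uᵢ - uⱼ‖_* < ε` for large `i`, `j` and with `uᵢ → φ` in `L²` satisfies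
`‖uᵢ - φ‖_* ≤ 3 ε`. -/
theorem KahlerForm.starNorm_sub_le_of_cauchy {u : ℕ → κ.starSpace} {φ : Lp ℝ 2 κ.vol}
    (hφ : Tendsto (fun i => (u i : Lp ℝ 2 κ.vol)) atTop (𝓝 φ)) {M : ℝ → ℕ}
    (hM : ∀ ε : ℝ, 0 < ε → ∀ i j : ℕ, M ε ≤ i → M ε ≤ j → κ.starSeminorm (u i - u j) < ε)
    {ε : ℝ} (hε : 0 < ε) {i : ℕ} (hi : M ε ≤ i) :
    φ - u i ∈ κ.Wstar ∧ κ.starNorm (φ - u i) ≤ 3 * ε := by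
  have hL2 : ∀ δ : ℝ, 0 < δ → ∀ l, M δ ≤ l → ‖φ - u l‖ ≤ δ := by
    intro δ hδ l hl
    refine le_of_tendsto ((hφ.sub_const (u l : Lp ℝ 2 κ.vol)).norm) ?_
    filter_upwards [eventually_ge_atTop (M δ)] with j hj
    exact (norm_le_starNorm _).trans (hM δ hδ j l hj hl).le
  have hpos : ∀ j : ℕ, 0 < ε / 2 ^ j := fun j => by positivity
  -- `k 0 = i`, and both `k j` and `k (j + 1)` are at least `M (ε / 2 ^ j)`
  obtain ⟨k, hk0, hk1, hk2⟩ : ∃ k : ℕ → ℕ, k 0 = i ∧ (∀ j, M (ε / 2 ^ j) ≤ k j) ∧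
      ∀ j, M (ε / 2 ^ j) ≤ k (j + 1) := by
    refine ⟨fun j => Nat.rec i (fun j _ => max (M (ε / 2 ^ j)) (M (ε / 2 ^ (j + 1)))) j, rfl,
      fun j => ?_, fun j => le_max_left _ _⟩
    cases j with
    | zero => simpa using hi
    | succ j => exact le_max_right _ _
  have hψ : ∀ j, κ.StarBound ((u (k (j + 1)) : Lp ℝ 2 κ.vol) - u (k j)) (ε / 2 ^ j) := fun j =>
    starBound_of_lt (u (k (j + 1)) - u (k j)).2
      ((starSemi_le_starNorm _).trans_lt (hM _ (hpos j) _ _ (hk2 j) (hk1 j)))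
  have hlim : Tendsto (fun j => (u (k j) : Lp ℝ 2 κ.vol)) atTop (𝓝 φ) := by
    rw [tendsto_iff_norm_sub_tendsto_zero]
    have h0 : Tendsto (fun j : ℕ => ε / 2 ^ j) atTop (𝓝 0) := by
      have := (tendsto_pow_atTop_nhds_zero_of_lt_one (r := (1 / 2 : ℝ)) (by norm_num)
        (by norm_num)).const_mul ε
      rw [mul_zero] at this
      refine this.congr fun j => ?_
      rw [one_div, inv_pow, div_eq_mul_inv]
    refine squeeze_zero (fun j => norm_nonneg _) (fun j => ?_) h0
    rw [norm_sub_rev]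
    exact hL2 _ (hpos j) _ (hk1 j)
  have hB : κ.StarBound (φ - u i) (2 * ε) := by
    refine starBound_of_series hψ ((hlim.sub_const (u i : Lp ℝ 2 κ.vol)).congr fun N => ?_)
    rw [Finset.sum_range_sub (fun j => (u (k j) : Lp ℝ 2 κ.vol)), hk0]
  refine ⟨hB.mem_Wstar, ?_⟩
  rw [starNorm_eq, Real.sqrt_le_left (by positivity)]
  have h1 := pow_le_pow_left₀ (Real.sqrt_nonneg _) (hB.starSemi_le (by positivity)) 2
  have h2 := pow_le_pow_left₀ (norm_nonneg _) (hL2 ε hε i hi) 2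
  change κ.starSemi (φ - u i) ^ 2 ≤ _ at h1
  nlinarith [sq_nonneg ε]

theorem KahlerForm.exists_tendsto_of_cauchy (u : ℕ → κ.starSpace)
    (hu : ∀ ε : ℝ, 0 < ε → ∃ M : ℕ, ∀ i j : ℕ, M ≤ i → M ≤ j → κ.starSeminorm (u i - u j) < ε) :
    ∃ φ : κ.starSpace, Tendsto (fun i => κ.starSeminorm (u i - φ)) atTop (𝓝 0) := by
  have hM : ∀ ε : ℝ, ∃ M : ℕ, 0 < ε → ∀ i j : ℕ, M ≤ i → M ≤ j →
      κ.starSeminorm (u i - u j) < ε := fun ε => by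
    by_cases hε : 0 < ε
    · obtain ⟨M, h⟩ := hu ε hε
      exact ⟨M, fun _ => h⟩
    · exact ⟨0, fun h => absurd h hε⟩
  choose M hM using hM
  have hc : CauchySeq fun i => (u i : Lp ℝ 2 κ.vol) := by
    rw [Metric.cauchySeq_iff]
    refine fun ε hε => ⟨M ε, fun i hi j hj => ?_⟩
    rw [dist_eq_norm]
    exact (norm_le_starNorm _).trans_lt (hM ε hε i j hi hj)
  obtain ⟨φ, hφ⟩ := cauchySeq_tendsto_of_complete hc
  have key := fun (ε : ℝ) (hε : 0 < ε) (i : ℕ) (hi : M ε ≤ i) =>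
    starNorm_sub_le_of_cauchy hφ hM hε hi
  have hmem : φ ∈ κ.starSpace := by
    have h1 : φ - u (M 1) ∈ κ.starSpace := (key 1 one_pos (M 1) le_rfl).1
    simpa using add_mem h1 (u (M 1)).2
  refine ⟨⟨φ, hmem⟩, ?_⟩
  rw [Metric.tendsto_atTop]
  intro ε hε
  refine ⟨M (ε / 4), fun i hi => ?_⟩
  have h1 := (key (ε / 4) (by positivity) i hi).2
  rw [Real.dist_0_eq_abs, abs_of_nonneg (apply_nonneg _ _), ← neg_sub, map_neg_eq_map]
  refine lt_of_le_of_lt h1 ?_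
  linarith

end Norm

end KahlerSobolev

end

theorem proposition2p1 (n : ℕ) (X : Type*) [TopologicalSpace X] [T2Space X]
    [SecondCountableTopology X] [MeasurableSpace X] [BorelSpace X]
    [ChartedSpace (KahlerSobolev.Model n) X]
    [IsManifold 𝓘(ℂ, KahlerSobolev.Model n) ω X]
    (κ : KahlerSobolev.KahlerForm n X) :
    ∃ (W : Submodule ℝ (Lp ℝ 2 κ.vol)) (N : Seminorm ℝ W),
      (W : Set (Lp ℝ 2 κ.vol)) = κ.Wstar ∧
      (∀ φ : W, N φ = κ.starNorm φ) ∧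
      (∀ φ : W, N φ = 0 → φ = 0) ∧
      (∀ u : ℕ → W,
        (∀ ε : ℝ, 0 < ε → ∃ M : ℕ, ∀ i j : ℕ, M ≤ i → M ≤ j → N (u i - u j) < ε) →
        ∃ φ : W, Tendsto (fun i => N (u i - φ)) atTop (𝓝 0)) := by
  refine ⟨κ.starSpace, κ.starSeminorm, rfl, fun φ => rfl, fun φ hφ => ?_,
    KahlerSobolev.KahlerForm.exists_tendsto_of_cauchy⟩
  have h := KahlerSobolev.KahlerForm.norm_le_starNorm (φ : Lp ℝ 2 κ.vol)
  rw [← KahlerSobolev.KahlerForm.starSeminorm_apply, hφ] at h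
  exact Subtype.ext (norm_le_zero_iff.1 h)
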